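/- Let $m,B,\theta,\tau>0$, $q\in\mathbb R\setminus\{0\}$ and $\omega_c=qB/m$. For $w\in\mathbb R^3$ write $\overline w=(w_1,w_2)$, and ${}^\perp(w_1,w_2)=(w_2,-w_1)$. Let $M(v)=(2\pi\theta/m)^{-3/2}e^{-m|v|^2/(2\theta)}$, and let $L^2(M^{-1})$ be the space $L^2(\mathbb R^3\times\mathbb R^3;M(v)^{-1}\,dx\,dv)$. For $u=u(x,v)$ put $$\langle u\rangle(x,v)=\frac1{2\pi}\int_0^{2\pi}u\Big(\overline x+\frac{{}^\perp\overline v}{\omega_c}-\frac{{}^\perp\{R(\alpha)\overline v\}}{\omega_c},\,x_3,\,R(\alpha)\overline v,\,v_3\Big)\,d\alpha ,$$ where $R(\alpha)$ is the rotation of angle $\alpha$. Let $\sigma:[0,\infty)\to\mathbb R$ be measurable with $0<s_0\le\sigma\le S_0<\infty$, let $s(v,v')=\sigma(|v-v'|)$ and $$Q_B(f)(x,v)=\frac1\tau\int_{\mathbb R^3}s(v,v')\{M(v)f(x,v')-M(v')f(x,v)\}\,dv'.$$ Let $E=-\nabla_x\phi$ with $\phi\in W^{2,\infty}(\mathbb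 R^3)$, and let $0\le f_{\rm in}\in L^1(dx\,dv)\cap L^2(M^{-1})$. A weak solution of $\partial_tf+a\cdot\nabla_{x,v}f=Q(f)$, $f(0)=f_0$, with a divergence-free field $a=a(x,v)$, is a function $f\in L^\infty(\mathbb R_+;L^2(M^{-1}))$ such that $$\int_0^\infty\!\!\iint f\,(\partial_t\psi+a\cdot\nabla_{x,v}\psi)\,dx\,dv\,dt+\iint f_0\,\psi(0,\cdot)\,dx\,dv=-\int_0^\infty\!\!\iint Q(f)\,\psi\,dx\,dv\,dt$$ for all $\psi\in C^1_c(\mathbb R_+\times\mathbb R^3\times\mathbb R^3)$. For some $\varepsilon_0>0$ and every $\varepsilon\in(0,\varepsilon_0]$ let $f^\varepsilon$ be a weak solution of $$\partial_tf^\varepsilon+\frac1\varepsilon(v_1\partial_{x_1}f^\varepsilon+v_2\partial_{x_2}f^\varepsilon)+v_3\partial_{x_3}f^\varepsilon+\frac qmE\cdot\nabla_vf^\varepsilon+\frac{\omega_c}\varepsilon(v_2\partial_{v_1}f^\varepsilon-v_1\partial_{v_2}f^\varepsilon)=Q_B(f^\varepsilon),\qquad f^\varepsilon(0)=f_{\rm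 in},$$ and assume that $(f^\varepsilon)_{0<\varepsilon\le\varepsilon_0}$ is bounded in $L^\infty(\mathbb R_+;L^2(M^{-1}))$. Then, as $\varepsilon\searrow0$, $f^\varepsilon$ converges weakly-$\star$ in $L^\infty(\mathbb R_+;L^2(M^{-1}))$ (the dual of $L^1(\mathbb R_+;L^2(M^{-1}))$) to a function $f$ that is the unique weak solution of $$\partial_tf+\frac{\langle{}^\perp\overline E\rangle}{B}\cdot\nabla_{\overline x}f+v_3\partial_{x_3}f+\frac qm\langle E_3\rangle\partial_{v_3}f=\langle Q_B\rangle f,\qquad f(0)=\langle f_{\rm in}\rangle ,$$ where, with $z=\omega_c\overline x+{}^\perp\overline v-(\omega_c\overline x'+{}^\perp\overline v')$, $$\langle Q_B\rangle f(x,v)=\frac{\omega_c^2}\tau\int_{\mathbb R^2}\int_{\mathbb R^3}\mathcal S(|\overline v|,v_3,|\overline v'|,v_3',z)\{M(v)f(\overline x',x_3,v')-M(v')f(x,v)\}\,dv'\,d\overline x',$$ $$\mathcal S(r,v_3,r',v_3',z)=\sigma\big(\sqrt{|z|^2+(v_3-v_3')^2}\big)\,\chi(r,r',z),\qquad\chi(r,r',z)=\frac{\mathbf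 1_{\{|r-r'|<|z|<r+r'\}}}{\pi^2\sqrt{|z|^2-(r-r')^2}\sqrt{(r+r')^2-|z|^2}} .$$ Moreover $\langle Q_B\rangle$ is the average of $Q_B$ on densities constant along the cyclotronic flow: $\langle Q_B(u)\rangle=\langle Q_B\rangle u$ almost everywhere for every $u\in L^2(M^{-1})$ with $\overline v\cdot\nabla_{\overline x}u+\omega_c\,{}^\perp\overline v\cdot\nabla_{\overline v}u=0$ in the sense of distributions. -/

import Mathlib

open MeasureTheory Set Filter Topology

noncomputable section

namespace FiniteLarmor

abbrev R2 : Type := EuclideanSpace ℝ (Fin 2)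
abbrev R3 : Type := EuclideanSpace ℝ (Fin 3)

/-- Phase space: pairs `(x, v)` of a position and a velocity in `ℝ³`. -/
abbrev Phase : Type := R3 × R3

/-- The perpendicular part `(w₁, w₂)` of `w = (w₁, w₂, w₃)`. -/
def bar (w : R3) : R2 := !₂[w 0, w 1]

/-- `⊥(w₁, w₂) = (w₂, -w₁)`. -/
def perp (w : R2) : R2 := !₂[w 1, -w 0]

/-- The rotation of angle `α` in the plane. -/
def rot (α : ℝ) (w : R2) : R2 :=
  !₂[Real.cos α * w 0 - Real.sin α * w 1, Real.sin α * w 0 + Real.cos α * w 1]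

/-- The point `(y₁, y₂, c)` of `ℝ³`. -/
def glue (y : R2) (c : ℝ) : R3 := !₂[y 0, y 1, c]

/-! ### Sobolev regularity of the potential -/

/-- `g` is the weak (distributional) partial derivative `∂ᵢ u` on `ℝ³`. -/
def HasWeakPartial (i : Fin 3) (u g : R3 → ℝ) : Prop :=
  LocallyIntegrable u ∧ LocallyIntegrable g ∧
    ∀ ψ : R3 → ℝ, ContDiff ℝ ((⊤ : ℕ∞) : WithTop ℕ∞) ψ → HasCompactSupport ψ →
      ∫ x, u x * fderiv ℝ ψ x (EuclideanSpace.single i 1) = -∫ x, g x * ψ x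

/-- The Sobolev space `W^{2,∞}(ℝ³)`. -/
def MemW2Infty (u : R3 → ℝ) : Prop :=
  MemLp u ⊤ ∧ ∃ (g : Fin 3 → R3 → ℝ) (h : Fin 3 → Fin 3 → R3 → ℝ),
    (∀ i, MemLp (g i) ⊤ ∧ HasWeakPartial i u (g i)) ∧
    ∀ i j, MemLp (h i j) ⊤ ∧ HasWeakPartial j (g i) (h i j)

/-! ### The Maxwellian and the weighted spaces -/

/-- The Maxwellian with mass `m` and temperature `θ`. -/
def maxwellian (m θ : ℝ) (v : R3) : ℝ :=
  1 / (2 * Real.pi * θ / m) ^ (3 / 2 : ℝ) * Real.exp (-(m * ‖v‖ ^ 2 / (2 * θ)))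

/-- The measure `M(v)⁻¹ dx dv` on phase space. -/
def weighted (m θ : ℝ) : Measure Phase :=
  (volume : Measure Phase).withDensity fun p => ENNReal.ofReal (maxwellian m θ p.2)⁻¹

/-- Lebesgue measure `dt dx dv` on `ℝ₊ × ℝ³ × ℝ³`. -/
def timePhase : Measure (ℝ × Phase) :=
  ((volume : Measure ℝ).restrict (Ici 0)).prod (volume : Measure Phase)

/-- `f` belongs to `L^∞(ℝ₊; L²(M⁻¹ dx dv))` and its norm there is at most `C`. -/
def LinftyL2Bound (m θ C : ℝ) (f : ℝ → Phase → ℝ) : Prop :=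
  AEStronglyMeasurable (fun z : ℝ × Phase => f z.1 z.2) timePhase ∧
    ∀ᵐ t ∂((volume : Measure ℝ).restrict (Ici 0)),
      eLpNorm (f t) 2 (weighted m θ) ≤ ENNReal.ofReal C

/-- The space `L^∞(ℝ₊; L²(M⁻¹ dx dv))`. -/
def MemLinftyL2 (m θ : ℝ) (f : ℝ → Phase → ℝ) : Prop :=
  ∃ C : ℝ, LinftyL2Bound m θ C f

/-- The predual `L¹(ℝ₊; L²(M⁻¹ dx dv))`. -/
def MemL1L2 (m θ : ℝ) (ψ : ℝ → Phase → ℝ) : Prop :=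
  AEStronglyMeasurable (fun z : ℝ × Phase => ψ z.1 z.2) timePhase ∧
    ∫⁻ t in Ici (0 : ℝ), eLpNorm (ψ t) 2 (weighted m θ) < ⊤

/-- `f ε → g` weakly-* in `L^∞(ℝ₊; L²(M⁻¹ dx dv))` as `ε ↘ 0`. -/
def WeakStarTendsto (m θ : ℝ) (f : ℝ → ℝ → Phase → ℝ) (g : ℝ → Phase → ℝ) : Prop :=
  ∀ ψ : ℝ → Phase → ℝ, MemL1L2 m θ ψ →
    Tendsto
      (fun ε : ℝ => ∫ z, f ε z.1 z.2 * ψ z.1 z.2 * (maxwellian m θ z.2.2)⁻¹ ∂timePhase)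
      (𝓝[>] 0)
      (𝓝 (∫ z, g z.1 z.2 * ψ z.1 z.2 * (maxwellian m θ z.2.2)⁻¹ ∂timePhase))

/-! ### Average along the cyclotronic motion -/

/-- The cyclotronic frequency `ω_c = q B / m`. -/
def omegaC (m q B : ℝ) : ℝ := q * B / m

/-- The point of the Larmor circle through `(x, v)` whose perpendicular velocity is
`R(α) (v₁, v₂)`; it is the characteristic of `(v₁, v₂) · ∇ + ω_c ⊥(v₁, v₂) · ∇` issued from
`(x, v)`, at the time `s = -α / ω_c`. -/
def larmor (ω α : ℝ) (p : Phase) : Phase :=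
  (glue (bar p.1 + ω⁻¹ • perp (bar p.2) - ω⁻¹ • perp (rot α (bar p.2))) (p.1 2),
    glue (rot α (bar p.2)) (p.2 2))

/-- The average operator `⟨u⟩`. -/
def gyroAvg (ω : ℝ) (u : Phase → ℝ) (p : Phase) : ℝ :=
  1 / (2 * Real.pi) * ∫ α in (0 : ℝ)..(2 * Real.pi), u (larmor ω α p)

/-- The vector field `b = (v₁, v₂, 0, ω v₂, -ω v₁, 0)` of the operator `𝒯`. -/
def cyclotronField (ω : ℝ) (p : Phase) : Phase :=
  (glue (bar p.2) 0, glue (ω • perp (bar p.2)) 0)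

/-- `u` belongs to the kernel, in `L²(M⁻¹ dx dv)`, of `𝒯 u = div_{x,v}(u b)`. -/
def MemKerT (m θ ω : ℝ) (u : Phase → ℝ) : Prop :=
  MemLp u 2 (weighted m θ) ∧
    ∀ ψ : Phase → ℝ, ContDiff ℝ 1 ψ → HasCompactSupport ψ →
      ∫ p, u p * fderiv ℝ ψ p (cyclotronField ω p) = 0

/-! ### Collision operators -/

/-- The relaxation (linear Boltzmann) operator with scattering cross section `s`. -/
def QB (m θ τ : ℝ) (s : R3 → R3 → ℝ) (u : Phase → ℝ) (p : Phase) : ℝ :=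
  1 / τ * ∫ v' : R3, s p.2 v' *
    (maxwellian m θ p.2 * u (p.1, v') - maxwellian m θ v' * u p)

open Classical in
/-- The function `χ(r, r', z)`. -/
def chi (r r' : ℝ) (z : R2) : ℝ :=
  if |r - r'| < ‖z‖ ∧ ‖z‖ < r + r' then
    1 / (Real.pi ^ 2 * Real.sqrt (‖z‖ ^ 2 - (r - r') ^ 2) *
      Real.sqrt ((r + r') ^ 2 - ‖z‖ ^ 2))
  else 0

/-- The averaged scattering cross section `𝒮(r, v₃, r', v₃', z)`. -/
def avgSection (σ : ℝ → ℝ) (r v3 r' v3' : ℝ) (z : R2) : ℝ :=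
  σ (Real.sqrt (‖z‖ ^ 2 + (v3 - v3') ^ 2)) * chi r r' z

/-- The averaged relaxation operator `⟨Q_B⟩`; the integration variable is
`y = ((x₁', x₂'), v') ∈ ℝ² × ℝ³`. -/
def avgQB (m θ τ ω : ℝ) (σ : ℝ → ℝ) (u : Phase → ℝ) (p : Phase) : ℝ :=
  ω ^ 2 / τ * ∫ y : R2 × R3,
    avgSection σ ‖bar p.2‖ (p.2 2) ‖bar y.2‖ (y.2 2)
        (ω • bar p.1 + perp (bar p.2) - (ω • y.1 + perp (bar y.2))) *
      (maxwellian m θ p.2 * u (glue y.1 (p.1 2), y.2) - maxwellian m θ y.2 * u p)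

/-! ### Transport equations and weak solutions -/

/-- The vector field of the equation with parameter `ε`:
`ε⁻¹ (v₁ ∂_{x₁} + v₂ ∂_{x₂}) + v₃ ∂_{x₃} + (q/m) E · ∇_v + (ω_c/ε) (v₂ ∂_{v₁} - v₁ ∂_{v₂})`. -/
def epsField (m q B : ℝ) (E : R3 → R3) (ε : ℝ) (p : Phase) : Phase :=
  (glue (ε⁻¹ • bar p.2) (p.2 2),
    (q / m) • E p.1 + glue ((omegaC m q B / ε) • perp (bar p.2)) 0)

/-- The vector field of the limit equation:
`B⁻¹ ⟨⊥E⟩ · ∇_{(x₁,x₂)} + v₃ ∂_{x₃} + (q/m) ⟨E₃⟩ ∂_{v₃}`. -/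
def limitField (m q B : ℝ) (E : R3 → R3) (p : Phase) : Phase :=
  let avgE : Fin 3 → ℝ := fun i => gyroAvg (omegaC m q B) (fun p' => E p'.1 i) p
  (glue (B⁻¹ • perp !₂[avgE 0, avgE 1]) (p.2 2), glue 0 (q / m * avgE 2))

/-- `f` is a weak solution of `∂_t f + a · ∇_{x,v} f = Q(f)`, `f(0) = f₀` on `ℝ₊ × ℝ³ × ℝ³`, for
a divergence free field `a` on phase space; the test functions are the restrictions to `t ≥ 0` of
the compactly supported `C¹` functions on `ℝ × ℝ³ × ℝ³`. -/
def IsWeakSolution (a : Phase → Phase) (Q : (Phase → ℝ) → Phase → ℝ) (f₀ : Phase → ℝ)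
    (f : ℝ → Phase → ℝ) : Prop :=
  ∀ ψ : ℝ × Phase → ℝ, ContDiff ℝ 1 ψ → HasCompactSupport ψ →
    (∫ z, f z.1 z.2 * fderiv ℝ ψ z (1, a z.2) ∂timePhase) + ∫ p, f₀ p * ψ (0, p)
      = -∫ z, Q (f z.1) z.2 * ψ z ∂timePhase

end FiniteLarmor

end

open FiniteLarmor

noncomputable section

open scoped ENNReal NNReal Convolution

namespace FiniteLarmor

/-! ### Coordinates -/

/-! The singular part of the equation is `ε⁻¹` times the generator of the cyclotronic motion, and
that motion is a linear, `2π`-periodic, measure preserving flow `larmor`. Everything rests on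
averaging along this flow, written as an integral against the probability measure `gyroMeasure`.

Compactness: the family is bounded in the Hilbert space `L²(exp (-t) M⁻¹ dt dx dv)`, so it has a
weak limit along every ultrafilter finer than `𝓝[>] 0` (`exists_weak_limit_densities`). The
collision operator is bounded there by a Schur test (`IsColKernel`), hence weakly continuous.
Multiplying the equation by `ε` shows that a limit `g` is weakly annihilated by the generator, which
makes it invariant under the flow (`comp_flow_ae_eq`). Testing instead with averaged functions
`avgTest` removes the singular term for every `ε`, and the limit can be taken in what remains
(`weak_limit_avgTest`).

Transport: since `g` is invariant, the derivative of the averaged test function along the slow field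
may be replaced by its mean over each Larmor circle. The flow is linear, so the slow field can be
pulled back to one point of the circle. It gives the limit field plus a correction proportional to
the cyclotronic field, because the force derives from a potential and does no work along a closed
circle. Averaged tests do not see that correction (`integral_fderiv_avgTest_slowField`).

Collisions: averaging the gain term produces two independent rotations, one for each perpendicular
velocity. The difference of two independent uniform points on circles of radii `r` and `r'` has
density `χ(r, r', ·)` in the plane, by the law of cosines (`lintegral_rot_sub_rot`). A change of
variables from this difference to the position `x'` gives the kernel of `⟨Q_B⟩` (`avgGainL_eq`). The
loss frequency is invariant under rotations, so it is the same for both operators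
(`gyroAvg_QB_of_invariant`).

Uniqueness: the potential has a differentiable representative with Lipschitz gradient, so the limit
field is Lipschitz and divergence free. The DiPerna–Lions commutator estimate then gives the
equation for the square of the difference of two solutions (`integral_sq_mul_fderiv_of_weak`). The
limit field does not preserve `M⁻¹`, but it preserves the density `gibbs`, which is comparable to
`M⁻¹` because the potential is bounded. The weight `exp (-2 λ t)` times that density, with `λ`
large, absorbs the collision term (`ae_eq_zero_of_weak`).

Hence all ultrafilter limits coincide, which is convergence of the whole family. Boundedness and
truncation in time and in norm extend the convergence from `L²` tests to tests in `L¹(ℝ₊; L²)`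
(`tendsto_pairing_of_bounded`). -/

@[simp] lemma bar_apply_zero (w : R3) : bar w 0 = w 0 := rfl
@[simp] lemma bar_apply_one (w : R3) : bar w 1 = w 1 := rfl
@[simp] lemma perp_apply_zero (w : R2) : perp w 0 = w 1 := rfl
@[simp] lemma perp_apply_one (w : R2) : perp w 1 = -w 0 := rfl
@[simp] lemma rot_apply_zero (α : ℝ) (w : R2) :
    rot α w 0 = Real.cos α * w 0 - Real.sin α * w 1 := rfl
@[simp] lemma rot_apply_one (α : ℝ) (w : R2) :
    rot α w 1 = Real.sin α * w 0 + Real.cos α * w 1 := rfl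
@[simp] lemma glue_apply_zero (y : R2) (c : ℝ) : glue y c 0 = y 0 := rfl
@[simp] lemma glue_apply_one (y : R2) (c : ℝ) : glue y c 1 = y 1 := rfl
@[simp] lemma glue_apply_two (y : R2) (c : ℝ) : glue y c 2 = c := rfl

lemma R2.ext {x y : R2} (h0 : x 0 = y 0) (h1 : x 1 = y 1) : x = y := by
  ext i; fin_cases i <;> assumption

lemma R3.ext {x y : R3} (h0 : x 0 = y 0) (h1 : x 1 = y 1) (h2 : x 2 = y 2) : x = y := by
  ext i; fin_cases i <;> assumption

lemma norm_sq_R2 (w : R2) : ‖w‖ ^ 2 = w 0 ^ 2 + w 1 ^ 2 := by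
  simp [EuclideanSpace.norm_sq_eq, Fin.sum_univ_two]

lemma norm_sq_R3 (w : R3) : ‖w‖ ^ 2 = w 0 ^ 2 + w 1 ^ 2 + w 2 ^ 2 := by
  simp [EuclideanSpace.norm_sq_eq, Fin.sum_univ_three]

@[simp] lemma bar_glue (y : R2) (c : ℝ) : bar (glue y c) = y := R2.ext rfl rfl

lemma rot_add (α β : ℝ) (w : R2) : rot (α + β) w = rot α (rot β w) := by
  apply R2.ext <;> simp [Real.cos_add, Real.sin_add] <;> ring

@[simp] lemma rot_zero (w : R2) : rot 0 w = w := by apply R2.ext <;> simp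

@[simp] lemma rot_two_pi (w : R2) : rot (2 * Real.pi) w = w := by apply R2.ext <;> simp

lemma perp_rot (α : ℝ) (w : R2) : perp (rot α w) = rot α (perp w) := by
  apply R2.ext <;> simp <;> ring

lemma rot_sub (α : ℝ) (w w' : R2) : rot α (w - w') = rot α w - rot α w' := by
  apply R2.ext <;> simp <;> ring

@[simp] lemma norm_perp (w : R2) : ‖perp w‖ = ‖w‖ := by
  rw [← sq_eq_sq₀ (norm_nonneg _) (norm_nonneg _), norm_sq_R2, norm_sq_R2]
  simp; ring

/-! ### Regularity of the coordinate maps -/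

lemma contDiff_bar {n : WithTop ℕ∞} : ContDiff ℝ n bar := by
  rw [contDiff_euclidean]; intro i; fin_cases i <;> simp <;> fun_prop

lemma contDiff_perp {n : WithTop ℕ∞} : ContDiff ℝ n perp := by
  rw [contDiff_euclidean]; intro i; fin_cases i <;> simp <;> fun_prop

lemma contDiff_glue {n : WithTop ℕ∞} : ContDiff ℝ n fun a : R2 × ℝ => glue a.1 a.2 := by
  rw [contDiff_euclidean]; intro i; fin_cases i <;> simp <;> fun_prop

section comp
variable {X : Type*} [NormedAddCommGroup X] [NormedSpace ℝ X] {n : WithTop ℕ∞}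

@[fun_prop] lemma contDiff_bar_comp {f : X → R3} (hf : ContDiff ℝ n f) :
    ContDiff ℝ n fun x => bar (f x) := contDiff_bar.comp hf

@[fun_prop] lemma contDiff_perp_comp {f : X → R2} (hf : ContDiff ℝ n f) :
    ContDiff ℝ n fun x => perp (f x) := contDiff_perp.comp hf

@[fun_prop] lemma contDiff_rot_comp {a : X → ℝ} {f : X → R2} (ha : ContDiff ℝ n a)
    (hf : ContDiff ℝ n f) : ContDiff ℝ n fun x => rot (a x) (f x) := by
  rw [contDiff_euclidean]; intro i; fin_cases i <;> simp <;> fun_prop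

@[fun_prop] lemma contDiff_glue_comp {f : X → R2} {c : X → ℝ} (hf : ContDiff ℝ n f)
    (hc : ContDiff ℝ n c) : ContDiff ℝ n fun x => glue (f x) (c x) :=
  contDiff_glue.comp (hf.prodMk hc)

end comp

section cont
variable {X : Type*} [TopologicalSpace X]

@[fun_prop] lemma continuous_bar_comp {f : X → R3} (hf : Continuous f) :
    Continuous fun x => bar (f x) := (contDiff_bar (n := 0)).continuous.comp hf

@[fun_prop] lemma continuous_perp_comp {f : X → R2} (hf : Continuous f) :
    Continuous fun x => perp (f x) := (contDiff_perp (n := 0)).continuous.comp hf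

@[fun_prop] lemma continuous_glue_comp {f : X → R2} {c : X → ℝ} (hf : Continuous f)
    (hc : Continuous c) : Continuous fun x => glue (f x) (c x) :=
  (contDiff_glue (n := 0)).continuous.comp (hf.prodMk hc)

end cont

section meas
variable {X : Type*} [MeasurableSpace X]

@[fun_prop] lemma measurable_bar_comp {f : X → R3} (hf : Measurable f) :
    Measurable fun x => bar (f x) := (continuous_bar_comp continuous_id).measurable.comp hf

@[fun_prop] lemma measurable_perp_comp {f : X → R2} (hf : Measurable f) :
    Measurable fun x => perp (f x) := (continuous_perp_comp continuous_id).measurable.comp hf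

@[fun_prop] lemma measurable_rot_comp {a : X → ℝ} {f : X → R2} (ha : Measurable a)
    (hf : Measurable f) : Measurable fun x => rot (a x) (f x) := by
  refine (WithLp.measurable_toLp 2 _).comp (measurable_pi_lambda _ fun i => ?_)
  fin_cases i <;> simp <;> fun_prop

@[fun_prop] lemma measurable_glue_comp {f : X → R2} {c : X → ℝ} (hf : Measurable f)
    (hc : Measurable c) : Measurable fun x => glue (f x) (c x) :=
  (contDiff_glue (n := 0)).continuous.measurable.comp (hf.prodMk hc)

end meas

/-! ### The cyclotronic flow -/

/-- The rotation of angle `α` around the third axis. -/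
def axisRot (α : ℝ) : R3 ≃ₗᵢ[ℝ] R3 :=
  LinearIsometry.toLinearIsometryEquiv
    { toFun := fun v => glue (rot α (bar v)) (v 2)
      map_add' := by intro x y; apply R3.ext <;> simp <;> ring
      map_smul' := by intro c y; apply R3.ext <;> simp <;> ring
      norm_map' := by
        intro v
        change ‖glue (rot α (bar v)) (v 2)‖ = ‖v‖
        rw [← sq_eq_sq₀ (norm_nonneg _) (norm_nonneg _), norm_sq_R3, norm_sq_R3]
        simp only [glue_apply_zero, glue_apply_one, glue_apply_two, rot_apply_zero,
          rot_apply_one, bar_apply_zero, bar_apply_one]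
        linear_combination (v 0 ^ 2 + v 1 ^ 2) * Real.sin_sq_add_cos_sq α } rfl

lemma axisRot_apply (α : ℝ) (v : R3) : axisRot α v = glue (rot α (bar v)) (v 2) := rfl

/-- The displacement of the position along the cyclotronic motion. -/
def larmorShift (ω α : ℝ) (v : R3) : R3 :=
  glue (ω⁻¹ • perp (bar v) - ω⁻¹ • perp (rot α (bar v))) 0

lemma larmor_eq (ω α : ℝ) (p : Phase) :
    larmor ω α p = (p.1 + larmorShift ω α p.2, axisRot α p.2) := by
  refine Prod.ext ?_ rfl
  apply R3.ext <;> simp [larmor, larmorShift] <;> ring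

lemma contDiff_larmor {n : WithTop ℕ∞} (ω : ℝ) :
    ContDiff ℝ n fun a : ℝ × Phase => larmor ω a.1 a.2 := by
  unfold larmor; fun_prop

lemma continuous_larmor (ω : ℝ) : Continuous fun a : ℝ × Phase => larmor ω a.1 a.2 :=
  (contDiff_larmor (n := 0) ω).continuous

@[fun_prop] lemma measurable_larmor_comp {X : Type*} [MeasurableSpace X] {ω : ℝ} {a : X → ℝ}
    {f : X → Phase} (ha : Measurable a) (hf : Measurable f) :
    Measurable fun x => larmor ω (a x) (f x) := by
  unfold larmor; fun_prop

/-- `larmor ω α` as a continuous linear map. -/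
def larmorCLM (ω α : ℝ) : Phase →L[ℝ] Phase :=
  LinearMap.toContinuousLinearMap
    { toFun := larmor ω α
      map_add' := by
        intro x y; refine Prod.ext ?_ ?_ <;> apply R3.ext <;> simp [larmor] <;> ring
      map_smul' := by
        intro c y; refine Prod.ext ?_ ?_ <;> apply R3.ext <;> simp [larmor] <;> ring }

@[simp] lemma larmorCLM_apply (ω α : ℝ) (p : Phase) : larmorCLM ω α p = larmor ω α p := rfl

lemma larmor_add (ω α β : ℝ) (p : Phase) :
    larmor ω (α + β) p = larmor ω α (larmor ω β p) := by
  refine Prod.ext ?_ ?_ <;> apply R3.ext <;> simp [larmor, rot_add]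

@[simp] lemma larmor_zero (ω : ℝ) (p : Phase) : larmor ω 0 p = p := by
  refine Prod.ext ?_ ?_ <;> apply R3.ext <;> simp [larmor]

@[simp] lemma larmor_two_pi (ω : ℝ) (p : Phase) : larmor ω (2 * Real.pi) p = p := by
  refine Prod.ext ?_ ?_ <;> apply R3.ext <;> simp [larmor]

lemma larmor_periodic (ω : ℝ) (p : Phase) :
    Function.Periodic (fun α => larmor ω α p) (2 * Real.pi) := by
  intro α; simp [larmor_add]

lemma measurePreserving_axisRot (α : ℝ) : MeasurePreserving (axisRot α) :=
  (axisRot α).measurePreserving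

/-- The map is a rotation of the velocity together with a translation of the position by a vector
depending on the velocity alone, so it is a skew product. The swaps only put the velocity, which is
the base, in first place. -/
lemma measurePreserving_larmor (ω α : ℝ) : MeasurePreserving (larmor ω α) := by
  have h : MeasurePreserving
      (fun p : R3 × R3 => (axisRot α p.1, p.2 + larmorShift ω α p.1))
      ((volume : Measure R3).prod volume) ((volume : Measure R3).prod volume) := by
    refine (measurePreserving_axisRot α).skew_product
      (g := fun v x => x + larmorShift ω α v) ?_ ?_
    · unfold Function.uncurry larmorShift; fun_prop
    · exact Eventually.of_forall fun v => map_add_right_eq_self _ _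
  have h2 := (Measure.measurePreserving_swap (μ := (volume : Measure R3))
    (ν := (volume : Measure R3))).comp (h.comp (Measure.measurePreserving_swap
      (μ := (volume : Measure R3)) (ν := (volume : Measure R3))))
  have he : larmor ω α = Prod.swap ∘
      (fun p : R3 × R3 => (axisRot α p.1, p.2 + larmorShift ω α p.1)) ∘ Prod.swap := by
    funext p; simp [larmor_eq]
  rw [he]
  exact h2

lemma hasDerivAt_larmor (ω α : ℝ) (hω : ω ≠ 0) (p : Phase) :
    HasDerivAt (fun a => larmor ω a p) (-ω⁻¹ • cyclotronField ω (larmor ω α p)) α := by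
  have h3 : ∀ (f : ℝ → R3) (f' : R3), (∀ i, HasDerivAt (fun a => f a i) (f' i) α) →
      HasDerivAt f f' α := fun f f' h =>
    ((PiLp.continuousLinearEquiv 2 ℝ (fun _ : Fin 3 => ℝ)).symm :
      (Fin 3 → ℝ) →L[ℝ] R3).hasFDerivAt.comp_hasDerivAt α (hasDerivAt_pi.2 h)
  have hc := Real.hasDerivAt_cos α
  have hs := Real.hasDerivAt_sin α
  refine HasDerivAt.prodMk (h3 _ _ fun i => ?_) (h3 _ _ fun i => ?_)
  · fin_cases i
    · simp only [larmor, cyclotronField]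
      simp
      refine ((((hs.mul_const (p.2 0)).add (hc.mul_const (p.2 1))).const_mul ω⁻¹).const_sub
        (p.1 0 + ω⁻¹ * p.2 1)).congr_deriv ?_
      ring
    · simp only [larmor, cyclotronField]
      simp
      refine ((((hs.mul_const (p.2 1)).sub (hc.mul_const (p.2 0))).const_mul ω⁻¹).const_sub
        (p.1 1 + -(ω⁻¹ * p.2 0))).congr_deriv ?_
      ring
    · simp only [larmor, cyclotronField]
      simpa using hasDerivAt_const α (p.1 2)
  · fin_cases i
    · simp only [larmor, cyclotronField]
      simp
      refine ((hc.mul_const (p.2 0)).sub (hs.mul_const (p.2 1))).congr_deriv ?_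
      field_simp
      ring
    · simp only [larmor, cyclotronField]
      simp
      refine ((hs.mul_const (p.2 0)).add (hc.mul_const (p.2 1))).congr_deriv ?_
      field_simp
      ring
    · simp only [larmor, cyclotronField]
      simpa using hasDerivAt_const α (p.2 2)

lemma larmor_cyclotronField (ω α : ℝ) (p : Phase) (hω : ω ≠ 0) :
    larmor ω α (cyclotronField ω p) = cyclotronField ω (larmor ω α p) := by
  refine Prod.ext ?_ ?_ <;> apply R3.ext <;> simp [larmor, cyclotronField] <;> field_simp <;> ring

/-! ### Averages over the angle -/

/-- The uniform probability measure on the angles in `(0, 2π]`. -/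
def gyroMeasure : Measure ℝ :=
  ENNReal.ofReal (1 / (2 * Real.pi)) • (volume : Measure ℝ).restrict (Ioc 0 (2 * Real.pi))

instance : IsProbabilityMeasure gyroMeasure := by
  constructor
  simp only [gyroMeasure, Measure.smul_apply, Measure.restrict_apply MeasurableSet.univ,
    univ_inter, Real.volume_Ioc, smul_eq_mul, sub_zero]
  rw [← ENNReal.ofReal_mul (by positivity)]
  rw [one_div_mul_cancel Real.two_pi_pos.ne', ENNReal.ofReal_one]

lemma integral_gyroMeasure (f : ℝ → ℝ) :
    ∫ α, f α ∂gyroMeasure = 1 / (2 * Real.pi) * ∫ α in (0 : ℝ)..(2 * Real.pi), f α := by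
  rw [gyroMeasure, integral_smul_measure, ENNReal.toReal_ofReal (by positivity),
    intervalIntegral.integral_of_le (by positivity), smul_eq_mul]

lemma gyroAvg_eq (ω : ℝ) (u : Phase → ℝ) (p : Phase) :
    gyroAvg ω u p = ∫ α, u (larmor ω α p) ∂gyroMeasure := (integral_gyroMeasure _).symm

lemma lintegral_Ioc_periodic_add {T : ℝ} (hT : 0 < T) {f : ℝ → ℝ≥0∞}
    (hf : Function.Periodic f T) (c : ℝ) :
    ∫⁻ α in Ioc 0 T, f (α + c) = ∫⁻ α in Ioc 0 T, f α := by
  have h1 : ∫⁻ α in Ioc 0 T, f (α + c) = ∫⁻ α in Ioc c (c + T), f α := by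
    have := (measurePreserving_add_right (volume : Measure ℝ) c).setLIntegral_comp_preimage_emb
      (measurableEmbedding_addRight c) f (Ioc c (c + T))
    rw [← this]; simp
  rw [h1]
  have h0 := isAddFundamentalDomain_Ioc hT 0
  rw [zero_add] at h0
  refine (isAddFundamentalDomain_Ioc hT c).setLIntegral_eq h0 f ?_
  rintro ⟨g, hg⟩ x
  obtain ⟨n, rfl⟩ := AddSubgroup.mem_zmultiples_iff.1 hg
  have := hf.zsmul n x
  rw [add_comm] at this
  exact this

lemma lintegral_gyroMeasure_add {f : ℝ → ℝ≥0∞} (hf : Function.Periodic f (2 * Real.pi)) (c : ℝ) :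
    ∫⁻ α, f (α + c) ∂gyroMeasure = ∫⁻ α, f α ∂gyroMeasure := by
  simp only [gyroMeasure, lintegral_smul_measure]
  rw [lintegral_Ioc_periodic_add Real.two_pi_pos hf]

lemma integral_gyroMeasure_add {f : ℝ → ℝ} (hf : Function.Periodic f (2 * Real.pi)) (c : ℝ) :
    ∫ α, f (α + c) ∂gyroMeasure = ∫ α, f α ∂gyroMeasure := by
  simp only [integral_gyroMeasure]
  rw [intervalIntegral.integral_comp_add_right]
  have := hf.intervalIntegral_add_eq (t := c) (s := 0)
  rw [zero_add] at this ⊢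
  rw [add_comm, this]

/-- The average along the cyclotronic flow of a `[0, ∞]`-valued function. -/
def gyroLavg (ω : ℝ) (F : Phase → ℝ≥0∞) (p : Phase) : ℝ≥0∞ :=
  ∫⁻ α, F (larmor ω α p) ∂gyroMeasure

lemma gyroAvg_larmor (ω α : ℝ) (u : Phase → ℝ) (p : Phase) :
    gyroAvg ω u (larmor ω α p) = gyroAvg ω u p := by
  simp only [gyroAvg_eq, ← larmor_add]
  exact integral_gyroMeasure_add (f := fun a => u (larmor ω a p))
    ((larmor_periodic ω p).comp u) α

/-- Averaging is symmetric against densities invariant under the flow. -/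
lemma lintegral_gyroLavg_mul {ω : ℝ} {F w : Phase → ℝ≥0∞} (hF : Measurable F)
    (hw : Measurable w) (hinv : ∀ α p, w (larmor ω α p) = w p) :
    ∫⁻ p, gyroLavg ω F p * w p = ∫⁻ p, F p * w p := by
  have h1 : ∀ p, gyroLavg ω F p * w p
      = ∫⁻ α, F (larmor ω α p) * w (larmor ω α p) ∂gyroMeasure := by
    intro p
    simp only [hinv, gyroLavg]
    rw [lintegral_mul_const _ (by fun_prop)]
  simp only [h1]
  rw [lintegral_lintegral_swap (by fun_prop)]
  have h2 : ∀ α, ∫⁻ p, F (larmor ω α p) * w (larmor ω α p) = ∫⁻ p, F p * w p := fun α =>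
    (measurePreserving_larmor ω α).lintegral_comp (f := fun p => F p * w p) (by fun_prop)
  simp [h2]

@[fun_prop] lemma measurable_gyroLavg_fun {ω : ℝ} {F : Phase → ℝ≥0∞} (hF : Measurable F) :
    Measurable (gyroLavg ω F) := by
  refine Measurable.lintegral_prod_right'
    (f := fun a : Phase × ℝ => F (larmor ω a.2 a.1)) ?_
  fun_prop

/-- Averaging the indicator of a null set keeps its integral, which is zero. This is what makes
averages insensitive to modifications on null sets, although each circle is itself negligible. -/
lemma ae_ae_larmor (ω : ℝ) {P : Phase → Prop} (h : ∀ᵐ p, P p) :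
    ∀ᵐ p, ∀ᵐ α ∂gyroMeasure, P (larmor ω α p) := by
  obtain ⟨N, hN, hNm, hN0⟩ := exists_measurable_superset_of_null (ae_iff.1 h)
  have hNi : Measurable (N.indicator (1 : Phase → ℝ≥0∞)) := measurable_one.indicator hNm
  have h0 : ∫⁻ p, gyroLavg ω (N.indicator 1) p = 0 := by
    have := lintegral_gyroLavg_mul (ω := ω) (F := N.indicator 1) (w := 1)
      hNi measurable_one (fun _ _ => rfl)
    simpa [lintegral_indicator_one hNm, hN0] using this
  rw [lintegral_eq_zero_iff (by fun_prop)] at h0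
  filter_upwards [h0] with p hp
  have hm2 : Measurable fun α => N.indicator (1 : Phase → ℝ≥0∞) (larmor ω α p) := by fun_prop
  have h1 : ∫⁻ α, N.indicator (1 : Phase → ℝ≥0∞) (larmor ω α p) ∂gyroMeasure = 0 := hp
  filter_upwards [(lintegral_eq_zero_iff hm2).1 h1] with α hα
  by_contra hcon
  have : larmor ω α p ∈ N := hN hcon
  simp [this] at hα

/-! ### The law of the difference of two uniform points on circles -/

/-- The unit vector of the plane with angle `α`. -/
def unitVec (α : ℝ) : R2 := !₂[Real.cos α, Real.sin α]

@[simp] lemma unitVec_apply_zero (α : ℝ) : unitVec α 0 = Real.cos α := rfl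
@[simp] lemma unitVec_apply_one (α : ℝ) : unitVec α 1 = Real.sin α := rfl

@[fun_prop] lemma measurable_unitVec_comp {X : Type*} [MeasurableSpace X] {a : X → ℝ}
    (ha : Measurable a) : Measurable fun x => unitVec (a x) := by
  refine (WithLp.measurable_toLp 2 _).comp (measurable_pi_lambda _ fun i => ?_)
  fin_cases i <;> simp <;> fun_prop

lemma unitVec_periodic : Function.Periodic unitVec (2 * Real.pi) := by
  intro α; apply R2.ext <;> simp

lemma rot_smul_unitVec (α β r : ℝ) : rot α (r • unitVec β) = r • unitVec (α + β) := by
  apply R2.ext <;> simp [Real.cos_add, Real.sin_add] <;> ring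

lemma exists_smul_unitVec (w : R2) : ∃ γ, w = ‖w‖ • unitVec γ := by
  refine ⟨Complex.arg ⟨w 0, w 1⟩, ?_⟩
  have hn : ‖(⟨w 0, w 1⟩ : ℂ)‖ = ‖w‖ := by
    rw [← sq_eq_sq₀ (norm_nonneg _) (norm_nonneg _), norm_sq_R2, ← Complex.normSq_eq_norm_sq,
      Complex.normSq_mk]; ring
  have h := Complex.norm_mul_cos_add_sin_mul_I ⟨w 0, w 1⟩
  rw [hn] at h
  have hre := congrArg Complex.re h
  have him := congrArg Complex.im h
  apply R2.ext
  · simpa [Complex.cos_ofReal_re, Complex.sin_ofReal_re] using hre.symm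
  · simpa [Complex.cos_ofReal_re, Complex.sin_ofReal_re] using him.symm

lemma norm_smul_unitVec {r : ℝ} (hr : 0 ≤ r) (γ : ℝ) : ‖r • unitVec γ‖ = r := by
  have : ‖unitVec γ‖ = 1 := by
    rw [← sq_eq_sq₀ (norm_nonneg _) zero_le_one, norm_sq_R2]; simp
  rw [norm_smul, this, mul_one, Real.norm_of_nonneg hr]

lemma lintegral_gyroMeasure_neg {f : ℝ → ℝ≥0∞} (hf : Function.Periodic f (2 * Real.pi)) :
    ∫⁻ α, f (-α) ∂gyroMeasure = ∫⁻ α, f α ∂gyroMeasure := by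
  simp only [gyroMeasure, lintegral_smul_measure]
  congr 1
  have h1 : ∫⁻ α in Ioc 0 (2 * Real.pi), f (-α) = ∫⁻ α in Ico (-(2 * Real.pi)) 0, f α := by
    have := (Measure.measurePreserving_neg (volume : Measure ℝ)).setLIntegral_comp_preimage_emb
      (MeasurableEquiv.neg ℝ).measurableEmbedding f (Ico (-(2 * Real.pi)) 0)
    rw [← this]; simp
  have h2 : ∫⁻ α in Ioc (-(2 * Real.pi)) 0, f α = ∫⁻ α in Ioc 0 (2 * Real.pi), f α := by
    have h := lintegral_Ioc_periodic_add Real.two_pi_pos hf (-(2 * Real.pi))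
    rw [← h]
    have := (measurePreserving_add_right (volume : Measure ℝ)
      (-(2 * Real.pi))).setLIntegral_comp_preimage_emb
      (measurableEmbedding_addRight _) f (Ioc (-(2 * Real.pi)) 0)
    rw [← this]; simp
  rw [h1, setLIntegral_congr Ico_ae_eq_Ioc, h2]

/-- Polar coordinates in the plane. -/
lemma lintegral_R2_polar {F : R2 → ℝ≥0∞} (hF : Measurable F) :
    ∫⁻ z, F z = ∫⁻ ρ in Ioi (0 : ℝ),
      ENNReal.ofReal (2 * Real.pi * ρ) * ∫⁻ β, F (ρ • unitVec β) ∂gyroMeasure := by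
  have hpi := Real.pi_pos
  let e : R2 ≃ᵐ ℝ × ℝ :=
    (MeasurableEquiv.toLp 2 (Fin 2 → ℝ)).symm.trans MeasurableEquiv.finTwoArrow
  have he : MeasurePreserving e :=
    (volume_preserving_finTwoArrow ℝ).comp
      (EuclideanSpace.volume_preserving_symm_measurableEquiv_toLp (Fin 2))
  have h1 : ∫⁻ z, F z = ∫⁻ y : ℝ × ℝ, F (e.symm y) := by
    have := he.lintegral_comp (f := fun y => F (e.symm y)) (by fun_prop)
    rw [← this]; simp
  rw [h1, ← lintegral_comp_polarCoord_symm, polarCoord_target]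
  have h2 : ∀ y : ℝ × ℝ, e.symm (polarCoord.symm y) = y.1 • unitVec y.2 := by
    intro y
    apply R2.ext
    · simp [e, polarCoord_symm_apply, MeasurableEquiv.finTwoArrow]
    · simp [e, polarCoord_symm_apply, MeasurableEquiv.finTwoArrow]
  simp only [h2, smul_eq_mul]
  rw [Measure.volume_eq_prod, ← Measure.prod_restrict, lintegral_prod _ (by fun_prop)]
  refine lintegral_congr fun ρ => ?_
  dsimp only
  rw [lintegral_const_mul _ (by fun_prop), gyroMeasure, lintegral_smul_measure, smul_eq_mul,
    ← mul_assoc]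
  congr 1
  · rw [← ENNReal.ofReal_mul' (by positivity)]
    congr 1; field_simp
  -- Polar coordinates use angles in `(-π, π)`; periodicity moves the integral to `(0, 2π]`.
  · rw [setLIntegral_congr Ioo_ae_eq_Ioc]
    have hper : Function.Periodic (fun β => F (ρ • unitVec β)) (2 * Real.pi) := fun β => by
      simp only [unitVec_periodic β]
    rw [← lintegral_Ioc_periodic_add Real.two_pi_pos hper (-Real.pi)]
    have := (measurePreserving_add_right (volume : Measure ℝ)
      (-Real.pi)).setLIntegral_comp_preimage_emb
      (measurableEmbedding_addRight _) (fun β => F (ρ • unitVec β)) (Ioc (-Real.pi) Real.pi)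
    rw [← this]
    simp only [preimage_add_const_Ioc]
    congr 3 <;> ring

/-- A shift of the angle by the argument of `w` is invisible to the mean, so only the norm of `w`
matters. -/
lemma lintegral_rot_eq {F : R2 → ℝ≥0∞} (w : R2) :
    ∫⁻ α, F (rot α w) ∂gyroMeasure = ∫⁻ α, F (‖w‖ • unitVec α) ∂gyroMeasure := by
  obtain ⟨γ, hγ⟩ := exists_smul_unitVec w
  have hper : Function.Periodic (fun β => F (‖w‖ • unitVec β)) (2 * Real.pi) := fun β => by
      simp only [unitVec_periodic β]
  rw [← lintegral_gyroMeasure_add hper γ]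
  refine lintegral_congr fun α => ?_
  nth_rw 1 [hγ]
  rw [rot_smul_unitVec]

/-- The third side of a triangle with sides `r`, `r'` and angle `β`. -/
def thirdSide (r r' β : ℝ) : ℝ := Real.sqrt (r ^ 2 + r' ^ 2 - 2 * r * r' * Real.cos β)

lemma norm_sub_eq_thirdSide (r r' β : ℝ) :
    ‖r • unitVec 0 - r' • unitVec β‖ = thirdSide r r' β := by
  rw [thirdSide, ← Real.sqrt_sq (norm_nonneg (r • unitVec 0 - r' • unitVec β)), norm_sq_R2]
  congr 1
  simp
  linear_combination r' ^ 2 * Real.sin_sq_add_cos_sq β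

lemma lintegral_gyroMeasure_even {f : ℝ → ℝ≥0∞} (hper : Function.Periodic f (2 * Real.pi))
    (heven : ∀ x, f (-x) = f x) :
    ∫⁻ β, f β ∂gyroMeasure = ENNReal.ofReal (1 / Real.pi) * ∫⁻ β in Ioo 0 Real.pi, f β := by
  have hpi := Real.pi_pos
  simp only [gyroMeasure, lintegral_smul_measure, smul_eq_mul]
  rw [← Ioc_union_Ioc_eq_Ioc (b := Real.pi) (by positivity) (by linarith),
    lintegral_union measurableSet_Ioc (by
      rw [Set.disjoint_left]; intro x hx hx'; exact absurd hx.2 (not_le.2 hx'.1))]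
  have h2 : ∫⁻ β in Ioc Real.pi (2 * Real.pi), f β = ∫⁻ β in Ioo 0 Real.pi, f β := by
    have := (measurePreserving_add_right (volume : Measure ℝ)
      (2 * Real.pi)).setLIntegral_comp_preimage_emb
      (measurableEmbedding_addRight _) f (Ioc Real.pi (2 * Real.pi))
    rw [← this]
    have := (Measure.measurePreserving_neg (volume : Measure ℝ)).setLIntegral_comp_preimage_emb
      (MeasurableEquiv.neg ℝ).measurableEmbedding f (Ioc (-Real.pi) 0)
    simp only [hper _, heven, preimage_add_const_Ioc, sub_self] at this ⊢
    rw [show Real.pi - 2 * Real.pi = -Real.pi by ring, ← this]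
    simp only [Set.neg_preimage, Set.neg_Ioc, neg_zero, neg_neg]
    rw [setLIntegral_congr Ioo_ae_eq_Ico]
  rw [h2, setLIntegral_congr (Ioo_ae_eq_Ioc (a := (0 : ℝ)) (b := Real.pi)), ← two_mul,
    ← mul_assoc]
  congr 1
  rw [← ENNReal.ofReal_ofNat 2, ← ENNReal.ofReal_mul (by positivity)]
  congr 1; field_simp

/-- Law of cosines: the strict triangle inequalities describe exactly the sides opposite to an angle
in `(0, π)`, and the angle is recovered by `arccos`. The image is the range of norms on which `chi`
is supported. -/
lemma image_thirdSide {r r' : ℝ} (hr : 0 < r) (hr' : 0 < r') :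
    thirdSide r r' '' Ioo 0 Real.pi = Ioo |r - r'| (r + r') := by
  have hrr : 0 < r * r' := mul_pos hr hr'
  ext ρ
  constructor
  · rintro ⟨β, hβ, rfl⟩
    have hs := Real.sin_pos_of_mem_Ioo hβ
    have h1 := Real.sin_sq_add_cos_sq β
    have hc1 : Real.cos β < 1 := by nlinarith
    have hc2 : -1 < Real.cos β := by nlinarith
    constructor
    · rw [thirdSide, Real.lt_sqrt (abs_nonneg _), sq_abs]; nlinarith
    · rw [thirdSide, Real.sqrt_lt' (by positivity)]; nlinarith
  · rintro ⟨h1, h2⟩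
    have hρ : 0 < ρ := (abs_nonneg _).trans_lt h1
    have h1' : (r - r') ^ 2 < ρ ^ 2 := by rw [← sq_abs (r - r')]; gcongr
    have h2' : ρ ^ 2 < (r + r') ^ 2 := by gcongr
    set c := (r ^ 2 + r' ^ 2 - ρ ^ 2) / (2 * r * r') with hc
    have hc1 : c < 1 := by rw [hc, div_lt_one (by positivity)]; nlinarith
    have hc2 : -1 < c := by rw [hc, lt_div_iff₀ (by positivity)]; nlinarith
    refine ⟨Real.arccos c, ⟨Real.arccos_pos.2 hc1, ?_⟩, ?_⟩
    · refine lt_of_le_of_ne (Real.arccos_le_pi c) fun h => ?_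
      rw [Real.arccos_eq_pi] at h; linarith
    · rw [thirdSide, Real.cos_arccos hc2.le hc1.le, hc, Real.sqrt_eq_iff_mul_self_eq_of_pos hρ]
      field_simp
      ring

/-- Evenness folds the mean onto `(0, π)` with density `1 / π`, and the third side `ρ` becomes the
new variable, with Jacobian `r r' sin β / ρ`. Heron's identity `(ρ² - (r - r')²) ((r + r')² - ρ²) =
(2 r r' sin β)²` turns the Jacobian into the square roots of `chi`. The factor `2 π ρ` is kept apart
to match polar coordinates. -/
lemma lintegral_thirdSide {r r' : ℝ} (hr : 0 < r) (hr' : 0 < r') (G : ℝ → ℝ≥0∞) :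
    ∫⁻ β, G (thirdSide r r' β) ∂gyroMeasure
      = ∫⁻ ρ in Ioi (0 : ℝ), ENNReal.ofReal (2 * Real.pi * ρ) *
        (G ρ * ENNReal.ofReal (chi r r' (ρ • unitVec 0))) := by
  have hrr : 0 < r * r' := mul_pos hr hr'
  have hpi := Real.pi_pos
  rw [lintegral_gyroMeasure_even (fun β => by simp [thirdSide]) (fun β => by simp [thirdSide])]
  have hsub : Ioo |r - r'| (r + r') ⊆ Ioi (0 : ℝ) := fun ρ hρ => (abs_nonneg _).trans_lt hρ.1
  have hset : ∫⁻ ρ in Ioi (0 : ℝ), ENNReal.ofReal (2 * Real.pi * ρ) *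
        (G ρ * ENNReal.ofReal (chi r r' (ρ • unitVec 0)))
      = ∫⁻ ρ in Ioo |r - r'| (r + r'), ENNReal.ofReal (2 * Real.pi * ρ) *
        (G ρ * ENNReal.ofReal (chi r r' (ρ • unitVec 0))) := by
    rw [← lintegral_inter_add_sdiff _ (Ioi 0) measurableSet_Ioo,
      inter_eq_self_of_subset_right hsub]
    refine (congrArg _ ?_).trans (add_zero _)
    refine setLIntegral_eq_zero (measurableSet_Ioi.diff measurableSet_Ioo) fun ρ hρ => ?_
    have : chi r r' (ρ • unitVec 0) = 0 := by
      rw [chi, norm_smul_unitVec (le_of_lt hρ.1), if_neg]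
      exact fun h => hρ.2 h
    simp [this]
  have hder : ∀ β ∈ Ioo 0 Real.pi, HasDerivWithinAt (thirdSide r r')
      (r * r' * Real.sin β / thirdSide r r' β) (Ioo 0 Real.pi) β := by
    intro β hβ
    have hpos : 0 < thirdSide r r' β :=
      hsub (image_thirdSide hr hr' ▸ mem_image_of_mem _ hβ)
    have h := (((Real.hasDerivAt_cos β).const_mul (2 * r * r')).const_sub
      (r ^ 2 + r' ^ 2)).sqrt (Real.sqrt_pos.1 hpos).ne'
    refine (h.congr_deriv ?_).hasDerivWithinAt
    rw [thirdSide]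
    field_simp
  have hinj : InjOn (thirdSide r r') (Ioo 0 Real.pi) := by
    intro β hβ β' hβ' h
    have hp : ∀ γ ∈ Ioo 0 Real.pi, 0 ≤ r ^ 2 + r' ^ 2 - 2 * r * r' * Real.cos γ := fun γ hγ =>
      (Real.sqrt_pos.1 (hsub (image_thirdSide hr hr' ▸ mem_image_of_mem _ hγ))).le
    rw [thirdSide, thirdSide, Real.sqrt_inj (hp _ hβ) (hp _ hβ')] at h
    refine Real.injOn_cos (Ioo_subset_Icc_self hβ) (Ioo_subset_Icc_self hβ') ?_
    have : (2 * (r * r')) * Real.cos β = (2 * (r * r')) * Real.cos β' := by linarith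
    exact mul_left_cancel₀ (by positivity) this
  rw [hset, ← image_thirdSide hr hr',
    lintegral_image_eq_lintegral_abs_deriv_mul measurableSet_Ioo hder hinj,
    ← lintegral_const_mul' _ _ ENNReal.ofReal_ne_top]
  refine setLIntegral_congr_fun measurableSet_Ioo fun β hβ => ?_
  have hmem : thirdSide r r' β ∈ Ioo |r - r'| (r + r') :=
    image_thirdSide hr hr' ▸ mem_image_of_mem _ hβ
  have hpos : 0 < thirdSide r r' β := hsub hmem
  have hs := Real.sin_pos_of_mem_Ioo hβ
  have hsq : thirdSide r r' β ^ 2 = r ^ 2 + r' ^ 2 - 2 * r * r' * Real.cos β :=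
    Real.sq_sqrt (Real.sqrt_pos.1 hpos).le
  have hchi : chi r r' (thirdSide r r' β • unitVec 0)
      = 1 / (Real.pi ^ 2 * (2 * (r * r') * Real.sin β)) := by
    rw [chi, norm_smul_unitVec hpos.le, if_pos ⟨hmem.1, hmem.2⟩, mul_assoc, hsq,
      ← Real.sqrt_mul]
    · congr 2
      rw [Real.sqrt_eq_iff_mul_self_eq_of_pos (by positivity)]
      linear_combination 4 * r ^ 2 * r' ^ 2 * Real.sin_sq_add_cos_sq β
    · nlinarith [Real.cos_le_one β]
  rw [hchi, abs_of_pos (by positivity)]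
  rw [show ∀ a b c d : ℝ≥0∞, a * (b * (c * d)) = (a * b * d) * c by intros; ring,
    ← ENNReal.ofReal_mul (by positivity), ← ENNReal.ofReal_mul (by positivity)]
  congr 2
  field_simp

@[fun_prop] lemma measurable_chi {X : Type*} [MeasurableSpace X] {r r' : X → ℝ} {z : X → R2}
    (hr : Measurable r) (hr' : Measurable r') (hz : Measurable z) :
    Measurable fun x => chi (r x) (r' x) (z x) := by
  unfold chi
  refine Measurable.ite ?_ (by fun_prop) measurable_const
  exact (measurableSet_lt (f := fun x => |r x - r' x|) (g := fun x => ‖z x‖)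
      (by fun_prop) (by fun_prop)).inter
    (measurableSet_lt (f := fun x => ‖z x‖) (g := fun x => r x + r' x)
      (by fun_prop) (by fun_prop))

/-- Shifts and a reflection of the angles align both vectors with the first axis. Then `r u(α) - r'
u(α + β)` is the rotation by `α` of `r u(0) - r' u(β)`: the direction of the difference is uniform
and independent of its length, which has the law of `thirdSide`. Comparison with polar coordinates
identifies the density. -/
lemma lintegral_rot_sub_rot {a b : R2} (ha : a ≠ 0) (hb : b ≠ 0) {Φ : R2 → ℝ≥0∞}
    (hΦ : Measurable Φ) :
    ∫⁻ α, ∫⁻ β, Φ (rot α a - rot (-β) b) ∂gyroMeasure ∂gyroMeasure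
      = ∫⁻ z, Φ z * ENNReal.ofReal (chi ‖a‖ ‖b‖ z) := by
  obtain ⟨α₀, hα₀⟩ := exists_smul_unitVec a
  obtain ⟨β₀, hβ₀⟩ := exists_smul_unitVec b
  set r := ‖a‖ with hr
  set r' := ‖b‖ with hr'
  have h1 : ∀ α, ∫⁻ β, Φ (rot α a - rot (-β) b) ∂gyroMeasure
      = ∫⁻ β, Φ (r • unitVec (α + α₀) - r' • unitVec β) ∂gyroMeasure := by
    intro α
    have hper : Function.Periodic
        (fun β => Φ (r • unitVec (α + α₀) - r' • unitVec β)) (2 * Real.pi) := fun β => by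
      simp only [unitVec_periodic β]
    rw [← lintegral_gyroMeasure_add hper β₀, ← lintegral_gyroMeasure_neg (hper.add_const β₀)]
    refine lintegral_congr fun β => ?_
    rw [hα₀, hβ₀, rot_smul_unitVec, rot_smul_unitVec]
  have hper2 : Function.Periodic
      (fun α => ∫⁻ β, Φ (r • unitVec α - r' • unitVec β) ∂gyroMeasure) (2 * Real.pi) := fun β => by
    simp only [unitVec_periodic β]
  have h2 : ∀ α, ∫⁻ β, Φ (r • unitVec α - r' • unitVec β) ∂gyroMeasure
      = ∫⁻ β, Φ (rot α (r • unitVec 0 - r' • unitVec β)) ∂gyroMeasure := by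
    intro α
    have hper : Function.Periodic
        (fun β => Φ (r • unitVec α - r' • unitVec β)) (2 * Real.pi) := fun β => by
      simp only [unitVec_periodic β]
    rw [← lintegral_gyroMeasure_add hper α]
    refine lintegral_congr fun β => ?_
    rw [rot_sub, rot_smul_unitVec, rot_smul_unitVec, add_zero, add_comm β α]
  simp only [h1]
  rw [lintegral_gyroMeasure_add hper2 α₀]
  simp only [h2]
  rw [lintegral_lintegral_swap (by fun_prop)]
  simp only [lintegral_rot_eq, norm_sub_eq_thirdSide]
  rw [lintegral_thirdSide (norm_pos_iff.2 ha) (norm_pos_iff.2 hb)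
      (fun ρ => ∫⁻ α, Φ (ρ • unitVec α) ∂gyroMeasure),
    lintegral_R2_polar (by fun_prop)]
  refine setLIntegral_congr_fun measurableSet_Ioi fun ρ hρ => ?_
  have hchi : ∀ β, chi r r' (ρ • unitVec β) = chi r r' (ρ • unitVec 0) := fun β => by
    simp only [chi, norm_smul_unitVec (le_of_lt hρ)]
  simp only [hchi]
  rw [lintegral_mul_const _ (by fun_prop)]

/-! ### The averaged gain operator -/

/-- The gain operator with cross section `σ(|v - v'|)`, on `[0, ∞]`-valued functions. -/
def gainL (σ : ℝ → ℝ) (F : Phase → ℝ≥0∞) (p : Phase) : ℝ≥0∞ :=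
  ∫⁻ v' : R3, ENNReal.ofReal (σ ‖p.2 - v'‖) * F (p.1, v')

/-- The kernel of the averaged collision operator. -/
def avgKernel (ω : ℝ) (σ : ℝ → ℝ) (p : Phase) (y : R2 × R3) : ℝ :=
  avgSection σ ‖bar p.2‖ (p.2 2) ‖bar y.2‖ (y.2 2)
    (ω • bar p.1 + perp (bar p.2) - (ω • y.1 + perp (bar y.2)))

/-- The gain part of the averaged collision operator, on `[0, ∞]`-valued functions. -/
def avgGainL (ω : ℝ) (σ : ℝ → ℝ) (F : Phase → ℝ≥0∞) (p : Phase) : ℝ≥0∞ :=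
  ENNReal.ofReal (ω ^ 2) *
    ∫⁻ y : R2 × R3, ENNReal.ofReal (avgKernel ω σ p y) * F (glue y.1 (p.1 2), y.2)

@[fun_prop] lemma measurable_gainL {σ : ℝ → ℝ} (hσ : Measurable σ) {F : Phase → ℝ≥0∞}
    (hF : Measurable F) : Measurable (gainL σ F) := by
  refine Measurable.lintegral_prod_right'
    (f := fun a : Phase × R3 => ENNReal.ofReal (σ ‖a.1.2 - a.2‖) * F (a.1.1, a.2)) ?_
  fun_prop

lemma measurable_avgKernel {X : Type*} [MeasurableSpace X] (ω : ℝ) {σ : ℝ → ℝ}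
    (hσ : Measurable σ) {p : X → Phase} {y : X → R2 × R3} (hp : Measurable p)
    (hy : Measurable y) : Measurable fun x => avgKernel ω σ (p x) (y x) := by
  unfold avgKernel avgSection
  fun_prop

/-- The plane has dimension two, hence the factor `ω²`; it is the origin of the prefactor of the
averaged operator. -/
lemma lintegral_comp_sub_smul {ω : ℝ} (hω : ω ≠ 0) (c : R2) {H : R2 → ℝ≥0∞} (hH : Measurable H) :
    ∫⁻ z, H z = ENNReal.ofReal (ω ^ 2) * ∫⁻ x, H (c - ω • x) := by
  have h1 : ∫⁻ x, H (c - ω • x) = ENNReal.ofReal |(ω ^ 2)⁻¹| * ∫⁻ z, H (c - z) := by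
    have := Measure.map_addHaar_smul (volume : Measure R2) hω
    rw [finrank_euclideanSpace_fin] at this
    rw [← smul_eq_mul, ← lintegral_smul_measure, ← this, lintegral_map (by fun_prop) (by fun_prop)]
  rw [h1, lintegral_sub_left_eq_self, ← mul_assoc, ← ENNReal.ofReal_mul (by positivity),
    abs_of_pos (by positivity), mul_inv_cancel₀ (by positivity), ENNReal.ofReal_one, one_mul]

/-- Velocities without perpendicular part, for which the Larmor circle is a point and `chi` is no
longer a probability density, lie in a hyperplane. -/
lemma ae_bar_ne_zero : ∀ᵐ v : R3, bar v ≠ 0 := by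
  let s : Submodule ℝ R3 := LinearMap.ker (EuclideanSpace.proj (𝕜 := ℝ) (0 : Fin 3)).toLinearMap
  have hs : s ≠ ⊤ := by
    intro h
    have : EuclideanSpace.single (0 : Fin 3) (1 : ℝ) ∈ s := h ▸ Submodule.mem_top
    simp [s] at this
  have h0 := Measure.addHaar_submodule (volume : Measure R3) s hs
  refine measure_mono_null (fun v hv => ?_) h0
  simp only [mem_compl_iff, mem_ofPred_eq, ne_eq, not_not] at hv
  have := congrArg (fun w : R2 => w 0) hv
  simpa [s] using this

lemma ae_bar_snd_ne_zero : ∀ᵐ p : Phase, bar p.2 ≠ 0 :=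
  Measure.quasiMeasurePreserving_snd.ae ae_bar_ne_zero

/-- The averaged gain operator is the average of the gain operator acting on averages. -/
lemma avgGainL_eq {ω : ℝ} (hω : ω ≠ 0) {σ : ℝ → ℝ} (hσ : Measurable σ) {F : Phase → ℝ≥0∞}
    (hF : Measurable F) {p : Phase} (hp : bar p.2 ≠ 0) :
    avgGainL ω σ F p = gyroLavg ω (gainL σ (gyroLavg ω F)) p := by
  obtain ⟨x, v⟩ := p
  have hperp : ∀ w : R2, w ≠ 0 → perp w ≠ 0 := fun w hw => by
    rwa [← norm_ne_zero_iff, norm_perp, norm_ne_zero_iff]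
  -- The inner velocity is replaced by its rotation of angle `-β`, which is allowed under the
  -- integral in `v'`. The Larmor rotation of angle `β` inside `F` then restores `v'`, and the two
  -- angles survive only in the position and in the relative speed.
  set g : ℝ → ℝ → R3 → ℝ≥0∞ := fun α β v' =>
    ENNReal.ofReal (σ ‖axisRot α v - axisRot (-β) v'‖) *
      F (larmor ω β ((larmor ω α (x, v)).1, axisRot (-β) v')) with hg
  have hgm : Measurable fun a : ℝ × ℝ × R3 => g a.1 a.2.1 a.2.2 := by
    simp only [hg, axisRot_apply]; fun_prop
  have h1 : gyroLavg ω (gainL σ (gyroLavg ω F)) (x, v)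
      = ∫⁻ α, ∫⁻ β, (∫⁻ v', g α β v') ∂gyroMeasure ∂gyroMeasure := by
    refine lintegral_congr fun α => ?_
    have hgm' : Measurable fun a : R3 × ℝ => ENNReal.ofReal (σ ‖(larmor ω α (x, v)).2 - a.1‖) *
        F (larmor ω a.2 ((larmor ω α (x, v)).1, a.1)) := by fun_prop
    calc gainL σ (gyroLavg ω F) (larmor ω α (x, v))
        = ∫⁻ v', ∫⁻ β, ENNReal.ofReal (σ ‖(larmor ω α (x, v)).2 - v'‖) *
            F (larmor ω β ((larmor ω α (x, v)).1, v')) ∂gyroMeasure := by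
          refine lintegral_congr fun v' => ?_
          rw [gyroLavg, lintegral_const_mul _ (by fun_prop)]
      _ = ∫⁻ β, (∫⁻ v', ENNReal.ofReal (σ ‖(larmor ω α (x, v)).2 - v'‖) *
            F (larmor ω β ((larmor ω α (x, v)).1, v'))) ∂gyroMeasure :=
          lintegral_lintegral_swap hgm'.aemeasurable
      _ = _ := by
          refine lintegral_congr fun β => ?_
          exact ((measurePreserving_axisRot (-β)).lintegral_comp
            (f := fun v' => ENNReal.ofReal (σ ‖(larmor ω α (x, v)).2 - v'‖) *
            F (larmor ω β ((larmor ω α (x, v)).1, v'))) (by fun_prop)).symm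
  have h2 : ∫⁻ α, ∫⁻ β, (∫⁻ v', g α β v') ∂gyroMeasure ∂gyroMeasure
      = ∫⁻ v', ∫⁻ α, ∫⁻ β, g α β v' ∂gyroMeasure ∂gyroMeasure := by
    have h2' : ∀ α, ∫⁻ β, (∫⁻ v', g α β v') ∂gyroMeasure
        = ∫⁻ v', ∫⁻ β, g α β v' ∂gyroMeasure := fun α =>
      lintegral_lintegral_swap (hgm.comp (g := fun a : ℝ × ℝ × R3 => g a.1 a.2.1 a.2.2)
        (f := fun b : ℝ × R3 => (α, b.1, b.2)) (by fun_prop)).aemeasurable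
    simp only [h2']
    refine lintegral_lintegral_swap (Measurable.aemeasurable ?_)
    refine Measurable.lintegral_prod_right'
      (f := fun a : (ℝ × R3) × ℝ => g a.1.1 a.2 a.1.2) ?_
    exact hgm.comp (f := fun b : (ℝ × R3) × ℝ => (b.1.1, b.2, b.1.2)) (by fun_prop)
  set c : R3 → R2 := fun v' => ω • bar x + perp (bar v) - perp (bar v') with hc
  -- Both the relative speed and the position depend on the angles only through the difference `z`
  -- of the two rotated vectors; the perpendicular position is `ω⁻¹ (c v' - z)`.
  set Φ : R3 → R2 → ℝ≥0∞ := fun v' z =>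
    ENNReal.ofReal (σ (Real.sqrt (‖z‖ ^ 2 + (v 2 - v' 2) ^ 2))) *
      F (glue (ω⁻¹ • (c v' - z)) (x 2), v') with hΦ
  have hgΦ : ∀ α β v', g α β v' = Φ v' (rot α (perp (bar v)) - rot (-β) (perp (bar v'))) := by
    intro α β v'
    simp only [hg, hΦ]
    congr 2
    · congr 1
      rw [eq_comm, Real.sqrt_eq_iff_mul_self_eq (by positivity) (norm_nonneg _), ← pow_two,
        norm_sq_R3, ← perp_rot, ← perp_rot, norm_sq_R2]
      simp [axisRot_apply]
      ring
    · refine Prod.ext ?_ ?_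
      · apply R3.ext <;> simp [larmor, axisRot_apply, hc, ← rot_add, ← perp_rot] <;> field_simp <;>
          ring
      · apply R3.ext
        · have := congrArg (fun w : R2 => w 0) (rot_add β (-β) (bar v'))
          simpa [larmor, axisRot_apply] using this.symm
        · have := congrArg (fun w : R2 => w 1) (rot_add β (-β) (bar v'))
          simpa [larmor, axisRot_apply] using this.symm
        · simp [larmor, axisRot_apply]
  have hΦm : Measurable fun a : R3 × R2 => Φ a.1 a.2 := by
    simp only [hΦ, hc]; fun_prop
  have hΦm' : ∀ v', Measurable (Φ v') := fun v' =>
    hΦm.comp (f := fun z : R2 => (v', z)) (by fun_prop)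
  rw [h1, h2]
  simp only [hgΦ]
  have h3 : ∀ᵐ v', ∫⁻ α, ∫⁻ β, Φ v' (rot α (perp (bar v)) - rot (-β) (perp (bar v'))) ∂gyroMeasure
        ∂gyroMeasure
      = ENNReal.ofReal (ω ^ 2) * ∫⁻ x', ENNReal.ofReal (avgKernel ω σ (x, v) (x', v')) *
          F (glue x' (x 2), v') := by
    filter_upwards [ae_bar_ne_zero] with v' hv'
    rw [lintegral_rot_sub_rot (hperp _ hp) (hperp _ hv') (hΦm' v'),
      lintegral_comp_sub_smul hω (c v') (by have := hΦm' v'; fun_prop)]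
    congr 1
    refine lintegral_congr fun x' => ?_
    have hz : ω • bar x + perp (bar v) - (ω • x' + perp (bar v')) = c v' - ω • x' := by
      simp only [hc]; abel
    have hx' : ω⁻¹ • (c v' - (c v' - ω • x')) = x' := by
      rw [sub_sub_cancel, smul_smul, inv_mul_cancel₀ hω, one_smul]
    have hchi0 : 0 ≤ chi ‖bar v‖ ‖bar v'‖ (c v' - ω • x') := by
      unfold chi; split_ifs <;> positivity
    simp only [avgKernel, avgSection, hz, norm_perp, hΦ, hx']
    rw [ENNReal.ofReal_mul' hchi0]
    ring
  rw [lintegral_congr_ae h3, lintegral_const_mul', avgGainL]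
  · congr 1
    have hm : Measurable fun y : R2 × R3 => ENNReal.ofReal (avgKernel ω σ (x, v) y) *
        F (glue y.1 (x 2), y.2) := by
      have := measurable_avgKernel ω hσ (measurable_const (a := (x, v))) measurable_id
        (X := R2 × R3)
      fun_prop
    rw [Measure.volume_eq_prod, lintegral_prod_symm _ hm.aemeasurable]
  · exact ENNReal.ofReal_ne_top

/-! ### Integral operators bounded in `L²(M⁻¹)` -/

/-- Cauchy–Schwarz with a weight. -/
lemma lintegral_mul_sq_le {Y : Type*} [MeasurableSpace Y] {μ : Measure Y}
    {k f w w' : Y → ℝ≥0∞} (hk : AEMeasurable k μ) (hf : AEMeasurable f μ)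
    (hw : AEMeasurable w μ) (hw' : AEMeasurable w' μ) (hww : ∀ y, w y * w' y = 1) :
    (∫⁻ y, k y * f y ∂μ) ^ 2 ≤ (∫⁻ y, k y * w y ∂μ) * ∫⁻ y, k y * (f y ^ 2 * w' y) ∂μ := by
  have hr : ∀ a : ℝ≥0∞, (a ^ (1 / 2 : ℝ)) ^ (2 : ℝ) = a := fun a => by
    rw [← ENNReal.rpow_mul]; norm_num
  have hr2 : ∀ a : ℝ≥0∞, (a ^ (2 : ℝ)) ^ (1 / 2 : ℝ) = a := fun a => by
    rw [← ENNReal.rpow_mul]; norm_num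
  have h := ENNReal.lintegral_mul_le_Lp_mul_Lq μ Real.HolderConjugate.two_two
    (f := fun y => (k y * w y) ^ (1 / 2 : ℝ)) (g := fun y => (k y * (f y ^ 2 * w' y)) ^ (1 / 2 : ℝ))
    (by fun_prop) (by fun_prop)
  have he : ∀ y, ((fun y => (k y * w y) ^ (1 / 2 : ℝ)) *
      (fun y => (k y * (f y ^ 2 * w' y)) ^ (1 / 2 : ℝ))) y = k y * f y := by
    intro y
    simp only [Pi.mul_apply]
    rw [← ENNReal.mul_rpow_of_nonneg _ _ (by norm_num), ← hr2 (k y * f y)]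
    congr 1
    rw [ENNReal.rpow_two, show k y * w y * (k y * (f y ^ 2 * w' y))
      = (k y * f y) ^ 2 * (w y * w' y) by ring, hww, mul_one]
  simp only [he, hr] at h
  calc (∫⁻ y, k y * f y ∂μ) ^ 2
      ≤ ((∫⁻ y, k y * w y ∂μ) ^ (1 / 2 : ℝ) *
        (∫⁻ y, k y * (f y ^ 2 * w' y) ∂μ) ^ (1 / 2 : ℝ)) ^ 2 := by gcongr
    _ = _ := by rw [mul_pow, ← ENNReal.rpow_two, ← ENNReal.rpow_two, hr, hr]

section kernel

variable {Y : Type*} [MeasureSpace Y]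

/-- The gain operator with kernel `k`, the variable `y` standing for the point `j p y`. -/
def kerGain (k : Phase → Y → ℝ) (j : Phase → Y → Phase) (F : Phase → ℝ≥0∞) (p : Phase) : ℝ≥0∞ :=
  ∫⁻ y, ENNReal.ofReal (k p y) * F (j p y)

/-- The collision operator with kernel `k` and equilibrium `M`. -/
def kerCol (M : R3 → ℝ) (k : Phase → Y → ℝ) (j : Phase → Y → Phase) (u : Phase → ℝ)
    (p : Phase) : ℝ :=
  ∫ y, k p y * (M p.2 * u (j p y) - M (j p y).2 * u p)

/-- The squared norm of `L²(M⁻¹ dx dv)`. -/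
def wNormSq (M : R3 → ℝ) (u : Phase → ℝ) : ℝ≥0∞ :=
  ∫⁻ p, ‖u p‖ₑ ^ 2 * ENNReal.ofReal (M p.2)⁻¹

/-- The Schur type conditions that make `kerCol M k j` bounded in `L²(M⁻¹ dx dv)`. -/
structure IsColKernel (M : R3 → ℝ) (k : Phase → Y → ℝ) (j : Phase → Y → Phase)
    (C : ℝ≥0∞) : Prop where
  measurable_M : Measurable M
  pos_M : ∀ v, 0 < M v
  measurable_k : Measurable (Function.uncurry k)
  measurable_j : Measurable (Function.uncurry j)
  nonneg : ∀ p y, 0 ≤ k p y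
  ne_top : C ≠ ∞
  gain_le : ∀ᵐ p, kerGain k j (fun q => ENNReal.ofReal (M q.2)) p ≤ C
  lintegral_le : ∀ G : Phase → ℝ≥0∞, Measurable G →
    ∫⁻ p, ENNReal.ofReal (M p.2) * kerGain k j G p ≤ C * ∫⁻ p, G p

variable {M : R3 → ℝ} {k : Phase → Y → ℝ} {j : Phase → Y → Phase} {C : ℝ≥0∞}

namespace IsColKernel

lemma ofReal_mul_inv (h : IsColKernel M k j C) (v : R3) :
    ENNReal.ofReal (M v) * ENNReal.ofReal (M v)⁻¹ = 1 := by
  rw [← ENNReal.ofReal_mul (h.pos_M v).le, mul_inv_cancel₀ (h.pos_M v).ne', ENNReal.ofReal_one]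

lemma measurable_k_comp (h : IsColKernel M k j C) {X : Type*} [MeasurableSpace X] {p : X → Phase}
    {y : X → Y} (hp : Measurable p) (hy : Measurable y) : Measurable fun x => k (p x) (y x) :=
  h.measurable_k.comp (hp.prodMk hy)

lemma measurable_j_comp (h : IsColKernel M k j C) {X : Type*} [MeasurableSpace X] {p : X → Phase}
    {y : X → Y} (hp : Measurable p) (hy : Measurable y) : Measurable fun x => j (p x) (y x) :=
  h.measurable_j.comp (hp.prodMk hy)

lemma kerCol_smul (c : ℝ) (u : Phase → ℝ) :
    kerCol M k j (c • u) = c • kerCol M k j u := by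
  funext p
  simp only [kerCol, Pi.smul_apply, smul_eq_mul]
  rw [← integral_const_mul]
  exact integral_congr_ae (Eventually.of_forall fun y => by ring)

/-- First half of the Schur test: Cauchy–Schwarz for the measure `k p y dy` with the weights `M` and
`M⁻¹` at the point `j p y`. The factor carrying `M` is bounded by `gain_le`. -/
lemma kerGain_sq_le (h : IsColKernel M k j C) {F : Phase → ℝ≥0∞} (hF : Measurable F) :
    ∀ᵐ p, kerGain k j F p ^ 2
      ≤ C * kerGain k j (fun q => F q ^ 2 * ENNReal.ofReal (M q.2)⁻¹) p := by
  have hM := h.measurable_M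
  filter_upwards [h.gain_le] with p hp
  have hj := h.measurable_j_comp (X := Y) (measurable_const (a := p)) measurable_id
  have hk := h.measurable_k_comp (X := Y) (measurable_const (a := p)) measurable_id
  refine (lintegral_mul_sq_le (w := fun y => ENNReal.ofReal (M (j p y).2))
    (w' := fun y => ENNReal.ofReal (M (j p y).2)⁻¹) hk.ennreal_ofReal.aemeasurable
    (hF.comp hj).aemeasurable ?_ ?_ (fun y => h.ofReal_mul_inv _)).trans ?_
  · exact (hM.comp hj.snd).ennreal_ofReal.aemeasurable
  · exact (hM.comp hj.snd).inv.ennreal_ofReal.aemeasurable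
  · gcongr
    · exact hp
    · rfl

lemma integrable_k_mul_M (h : IsColKernel M k j C) :
    ∀ᵐ p, Integrable fun y => k p y * M (j p y).2 := by
  have hM := h.measurable_M
  filter_upwards [h.gain_le] with p hp
  have hj := h.measurable_j_comp (X := Y) (measurable_const (a := p)) measurable_id
  have hk := h.measurable_k_comp (X := Y) (measurable_const (a := p)) measurable_id
  refine ⟨(hk.mul (hM.comp hj.snd)).aestronglyMeasurable, ?_⟩
  rw [HasFiniteIntegral]
  refine lt_of_le_of_lt (le_of_eq ?_) (hp.trans_lt h.ne_top.lt_top)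
  refine lintegral_congr fun y => ?_
  rw [← ENNReal.ofReal_mul (h.nonneg p y), ← Real.enorm_of_nonneg
    (mul_nonneg (h.nonneg p y) (h.pos_M _).le)]

/-- Second half of the Schur test: one factor `M` cancels against `M⁻¹`, and the remaining integral
has exactly the form controlled by `lintegral_le`. -/
lemma lintegral_kerGain_sq_le (h : IsColKernel M k j C) {F : Phase → ℝ≥0∞} (hF : Measurable F) :
    ∫⁻ p, (ENNReal.ofReal (M p.2) * kerGain k j F p) ^ 2 * ENNReal.ofReal (M p.2)⁻¹
      ≤ C ^ 2 * ∫⁻ p, F p ^ 2 * ENNReal.ofReal (M p.2)⁻¹ := by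
  have hM := h.measurable_M
  calc ∫⁻ p, (ENNReal.ofReal (M p.2) * kerGain k j F p) ^ 2 * ENNReal.ofReal (M p.2)⁻¹
      ≤ ∫⁻ p, C * (ENNReal.ofReal (M p.2) *
          kerGain k j (fun q => F q ^ 2 * ENNReal.ofReal (M q.2)⁻¹) p) := by
        refine lintegral_mono_ae ?_
        filter_upwards [h.kerGain_sq_le hF] with p hp
        calc (ENNReal.ofReal (M p.2) * kerGain k j F p) ^ 2 * ENNReal.ofReal (M p.2)⁻¹
            = (ENNReal.ofReal (M p.2) * ENNReal.ofReal (M p.2)⁻¹) *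
              (ENNReal.ofReal (M p.2) * kerGain k j F p ^ 2) := by ring
          _ ≤ 1 * (ENNReal.ofReal (M p.2) *
            (C * kerGain k j (fun q => F q ^ 2 * ENNReal.ofReal (M q.2)⁻¹) p)) := by
              rw [h.ofReal_mul_inv]; gcongr
          _ = _ := by ring
    _ = C * ∫⁻ p, ENNReal.ofReal (M p.2) *
          kerGain k j (fun q => F q ^ 2 * ENNReal.ofReal (M q.2)⁻¹) p :=
        lintegral_const_mul' _ _ h.ne_top
    _ ≤ C * (C * ∫⁻ p, F p ^ 2 * ENNReal.ofReal (M p.2)⁻¹) := by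
        gcongr
        exact h.lintegral_le _ (by fun_prop)
    _ = _ := by ring

variable [SFinite (volume : Measure Y)]

lemma measurable_kerGain (h : IsColKernel M k j C) {X : Type*} [MeasurableSpace X]
    {F : X → Phase → ℝ≥0∞} (hF : Measurable (Function.uncurry F)) :
    Measurable fun a : X × Phase => kerGain k j (F a.1) a.2 := by
  refine Measurable.lintegral_prod_right'
    (f := fun a : (X × Phase) × Y => ENNReal.ofReal (k a.1.2 a.2) * F a.1.1 (j a.1.2 a.2)) ?_
  refine (h.measurable_k_comp (by fun_prop) (by fun_prop)).ennreal_ofReal.mul ?_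
  exact hF.comp (f := fun a : (X × Phase) × Y => (a.1.1, j a.1.2 a.2))
    (measurable_fst.fst.prodMk (h.measurable_j_comp (by fun_prop) (by fun_prop)))

lemma measurable_kerGain_fun (h : IsColKernel M k j C) {F : Phase → ℝ≥0∞} (hF : Measurable F) :
    Measurable (kerGain k j F) := by
  refine Measurable.lintegral_prod_right'
    (f := fun a : Phase × Y => ENNReal.ofReal (k a.1 a.2) * F (j a.1 a.2)) ?_
  exact (h.measurable_k_comp (by fun_prop) (by fun_prop)).ennreal_ofReal.mul
    (hF.comp (h.measurable_j_comp (by fun_prop) (by fun_prop)))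

/-- Null sets are not seen by the gain operator, uniformly with respect to a parameter. -/
lemma ae_ae_prod (h : IsColKernel M k j C) {X : Type*} [MeasurableSpace X] {μ : Measure X}
    {P : X × Phase → Prop} (hP : ∀ᵐ z ∂μ.prod volume, P z) :
    ∀ᵐ z ∂μ.prod volume, ∀ᵐ y, k z.2 y = 0 ∨ P (z.1, j z.2 y) := by
  have hM := h.measurable_M
  obtain ⟨N, hN, hNm, hN0⟩ := exists_measurable_superset_of_null (ae_iff.1 hP)
  have hNi : Measurable (N.indicator (1 : X × Phase → ℝ≥0∞)) := measurable_one.indicator hNm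
  set F : X → Phase → ℝ≥0∞ := fun t p => N.indicator 1 (t, p) with hF
  have hFm : Measurable (Function.uncurry F) := hNi
  have hgm := h.measurable_kerGain hFm
  have hm : Measurable fun a : X × Phase => ENNReal.ofReal (M a.2.2) * kerGain k j (F a.1) a.2 :=
    (hM.comp measurable_snd.snd).ennreal_ofReal.mul hgm
  -- By `lintegral_le`, the gain of the indicator of a null set has integral zero against the
  -- positive weight `M`. It therefore vanishes at almost every point, and so does its integrand
  -- wherever the kernel is not zero.
  have h0 : ∫⁻ a, ENNReal.ofReal (M a.2.2) * kerGain k j (F a.1) a.2 ∂μ.prod volume = 0 := by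
    rw [lintegral_prod _ hm.aemeasurable]
    refine le_antisymm ?_ zero_le
    calc ∫⁻ t, (∫⁻ p, ENNReal.ofReal (M p.2) * kerGain k j (F t) p) ∂μ
        ≤ ∫⁻ t, C * (∫⁻ p, F t p) ∂μ := lintegral_mono fun t =>
          h.lintegral_le (F t) (hFm.comp (measurable_const.prodMk measurable_id))
      _ = C * ∫⁻ t, (∫⁻ p, F t p) ∂μ := lintegral_const_mul' _ _ h.ne_top
      _ = C * ∫⁻ a, N.indicator (1 : X × Phase → ℝ≥0∞) a ∂μ.prod volume := by
          rw [lintegral_prod _ hNi.aemeasurable]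
      _ = 0 := by rw [lintegral_indicator_one hNm, hN0, mul_zero]
  rw [lintegral_eq_zero_iff hm] at h0
  filter_upwards [h0] with z hz
  have hz' : kerGain k j (F z.1) z.2 = 0 := by
    rcases mul_eq_zero.1 hz with h1 | h1
    · rw [ENNReal.ofReal_eq_zero] at h1; exact absurd (h.pos_M z.2.2) (not_lt.2 h1)
    · exact h1
  have hm2 : Measurable fun y => ENNReal.ofReal (k z.2 y) * F z.1 (j z.2 y) :=
    (h.measurable_k_comp measurable_const measurable_id).ennreal_ofReal.mul
      (hFm.comp (measurable_const.prodMk (h.measurable_j_comp measurable_const measurable_id)))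
  filter_upwards [(lintegral_eq_zero_iff hm2).1 hz'] with y hy
  by_contra! hcon
  have hmem : (z.1, j z.2 y) ∈ N := hN hcon.2
  have hpos := lt_of_le_of_ne (h.nonneg z.2 y) (Ne.symm hcon.1)
  simp [hF, hmem] at hy
  exact absurd hpos (not_lt.2 hy)

lemma ae_ae (h : IsColKernel M k j C) {P : Phase → Prop} (hP : ∀ᵐ p, P p) :
    ∀ᵐ p, ∀ᵐ y, k p y = 0 ∨ P (j p y) := by
  -- A Dirac mass on a one-point parameter space removes the parameter.
  have h1 : ∀ᵐ z ∂(Measure.dirac ()).prod (volume : Measure Phase), P z.2 :=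
    Measure.quasiMeasurePreserving_snd.ae hP
  have h2 := Measure.ae_ae_of_ae_prod (h.ae_ae_prod h1)
  rw [ae_dirac_eq] at h2
  simpa using h2

/-- The Schur bound applied to `|u|` makes its gain square integrable with a positive weight, hence
finite almost everywhere. -/
lemma integrable_k_mul (h : IsColKernel M k j C) {u : Phase → ℝ} (hu : Measurable u)
    (hu2 : wNormSq M u < ∞) : ∀ᵐ p, Integrable fun y => k p y * u (j p y) := by
  have hM := h.measurable_M
  have h1 := (h.lintegral_kerGain_sq_le (F := fun p => ‖u p‖ₑ) hu.enorm).trans_lt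
    (ENNReal.mul_lt_top (by simp [h.ne_top.lt_top]) hu2)
  have hgm := h.measurable_kerGain_fun hu.enorm
  have h2 := ae_lt_top (by fun_prop) h1.ne
  filter_upwards [h2] with p hp
  have hj := h.measurable_j_comp (X := Y) (measurable_const (a := p)) measurable_id
  have hk := h.measurable_k_comp (X := Y) (measurable_const (a := p)) measurable_id
  refine ⟨(hk.mul (hu.comp hj)).aestronglyMeasurable, ?_⟩
  have hne : kerGain k j (fun p => ‖u p‖ₑ) p ≠ ∞ := by
    intro hcon
    have hp0 := h.pos_M p.2
    rw [hcon, ENNReal.mul_top (by simpa using hp0), ENNReal.top_pow two_ne_zero,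
      ENNReal.top_mul (by simpa using hp0)] at hp
    exact lt_irrefl _ hp
  rw [HasFiniteIntegral]
  refine lt_of_le_of_lt (le_of_eq ?_) hne.lt_top
  refine lintegral_congr fun y => ?_
  rw [enorm_mul, Real.enorm_of_nonneg (h.nonneg p y)]

lemma kerCol_eq (h : IsColKernel M k j C) {u : Phase → ℝ} (hu : Measurable u)
    (hu2 : wNormSq M u < ∞) :
    ∀ᵐ p, kerCol M k j u p
      = M p.2 * (∫ y, k p y * u (j p y)) - (∫ y, k p y * M (j p y).2) * u p := by
  filter_upwards [h.integrable_k_mul hu hu2, h.integrable_k_mul_M] with p h1 h2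
  rw [← integral_const_mul, ← integral_mul_const, ← integral_sub (h1.const_mul _) (h2.mul_const _)]
  exact integral_congr_ae (Eventually.of_forall fun y => by ring)

/-- Functions equal almost everywhere have collision terms equal almost everywhere. -/
lemma kerCol_congr_prod (h : IsColKernel M k j C) {X : Type*} [MeasurableSpace X] {μ : Measure X}
    {f g : X → Phase → ℝ} (hfg : ∀ᵐ z ∂μ.prod volume, f z.1 z.2 = g z.1 z.2) :
    ∀ᵐ z ∂μ.prod volume, kerCol M k j (f z.1) z.2 = kerCol M k j (g z.1) z.2 := by
  filter_upwards [h.ae_ae_prod hfg, hfg] with z hz hz'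
  refine integral_congr_ae ?_
  filter_upwards [hz] with y hy
  rcases hy with hy | hy
  · simp [hy]
  · rw [show f z.1 (j z.2 y) = g z.1 (j z.2 y) from hy, hz']

lemma kerCol_congr (h : IsColKernel M k j C) {f g : Phase → ℝ} (hfg : f =ᵐ[volume] g) :
    kerCol M k j f =ᵐ[volume] kerCol M k j g := by
  filter_upwards [h.ae_ae hfg, hfg] with z hz hz'
  refine integral_congr_ae ?_
  filter_upwards [hz] with y hy
  rcases hy with hy | hy
  · simp [hy]
  · simp only [hy, hz']

lemma measurable_kerCol (h : IsColKernel M k j C) {X : Type*} [MeasurableSpace X]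
    {f : X → Phase → ℝ} (hf : Measurable (Function.uncurry f)) :
    Measurable fun z : X × Phase => kerCol M k j (f z.1) z.2 := by
  have hM := h.measurable_M
  refine (StronglyMeasurable.integral_prod_right' (f := fun a : (X × Phase) × Y =>
    k a.1.2 a.2 * (M a.1.2.2 * f a.1.1 (j a.1.2 a.2) - M (j a.1.2 a.2).2 * f a.1.1 a.1.2))
    (Measurable.stronglyMeasurable ?_)).measurable
  have hj : Measurable fun a : (X × Phase) × Y => j a.1.2 a.2 :=
    h.measurable_j_comp (by fun_prop) (by fun_prop)
  have hf1 : Measurable fun a : (X × Phase) × Y => f a.1.1 (j a.1.2 a.2) :=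
    hf.comp (measurable_fst.fst.prodMk hj)
  have hf2 : Measurable fun a : (X × Phase) × Y => f a.1.1 a.1.2 := hf.comp measurable_fst
  exact (h.measurable_k_comp (by fun_prop) (by fun_prop)).mul
    (((hM.comp (by fun_prop)).mul hf1).sub ((hM.comp hj.snd).mul hf2))

lemma kerCol_add (h : IsColKernel M k j C) {u w : Phase → ℝ} (hu : Measurable u)
    (hu2 : wNormSq M u < ∞) (hw : Measurable w) (hw2 : wNormSq M w < ∞) :
    kerCol M k j (u + w) =ᵐ[volume] kerCol M k j u + kerCol M k j w := by
  filter_upwards [h.integrable_k_mul hu hu2, h.integrable_k_mul hw hw2, h.integrable_k_mul_M]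
    with p h1 h2 h3
  simp only [kerCol, Pi.add_apply]
  rw [← integral_add]
  · exact integral_congr_ae (Eventually.of_forall fun y => by ring)
  · exact ((h1.const_mul (M p.2)).sub (h3.mul_const (u p))).congr
      (Eventually.of_forall fun y => by simp; ring)
  · exact ((h2.const_mul (M p.2)).sub (h3.mul_const (w p))).congr
      (Eventually.of_forall fun y => by simp; ring)

/-- The Schur test handles the gain, and the loss is multiplication by a frequency at most `C`. The
factor `4` comes from `(a + b)² ≤ 2 a² + 2 b²` with both terms bounded alike. -/
lemma wNormSq_kerCol_le (h : IsColKernel M k j C) {u : Phase → ℝ} (hu : Measurable u)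
    (hu2 : wNormSq M u < ∞) : wNormSq M (kerCol M k j u) ≤ 4 * C ^ 2 * wNormSq M u := by
  have hM := h.measurable_M
  have hgm := h.measurable_kerGain_fun hu.enorm
  calc wNormSq M (kerCol M k j u)
      ≤ ∫⁻ p, 2 * ((ENNReal.ofReal (M p.2) * kerGain k j (fun q => ‖u q‖ₑ) p) ^ 2 *
            ENNReal.ofReal (M p.2)⁻¹) + 2 * (C ^ 2 * (‖u p‖ₑ ^ 2 * ENNReal.ofReal (M p.2)⁻¹)) := by
        refine lintegral_mono_ae ?_
        filter_upwards [h.kerCol_eq hu hu2, h.gain_le] with p hp hC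
        have h1 : ‖kerCol M k j u p‖ₑ
            ≤ ENNReal.ofReal (M p.2) * kerGain k j (fun q => ‖u q‖ₑ) p + C * ‖u p‖ₑ := by
          rw [hp]
          refine (enorm_sub_le).trans ?_
          rw [enorm_mul, enorm_mul, Real.enorm_of_nonneg (h.pos_M _).le]
          gcongr
          · refine (enorm_integral_le_lintegral_enorm _).trans (le_of_eq ?_)
            refine lintegral_congr fun y => ?_
            rw [enorm_mul, Real.enorm_of_nonneg (h.nonneg p y)]
          · refine (enorm_integral_le_lintegral_enorm _).trans (le_trans (le_of_eq ?_) hC)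
            refine lintegral_congr fun y => ?_
            rw [enorm_mul, Real.enorm_of_nonneg (h.nonneg p y), Real.enorm_of_nonneg (h.pos_M _).le]
        calc ‖kerCol M k j u p‖ₑ ^ 2 * ENNReal.ofReal (M p.2)⁻¹
            ≤ (ENNReal.ofReal (M p.2) * kerGain k j (fun q => ‖u q‖ₑ) p + C * ‖u p‖ₑ) ^ 2 *
              ENNReal.ofReal (M p.2)⁻¹ := by gcongr
          _ ≤ (2 * ((ENNReal.ofReal (M p.2) * kerGain k j (fun q => ‖u q‖ₑ) p) ^ 2
              + (C * ‖u p‖ₑ) ^ 2)) * ENNReal.ofReal (M p.2)⁻¹ := by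
              gcongr
              have := ENNReal.rpow_add_le_mul_rpow_add_rpow
                (ENNReal.ofReal (M p.2) * kerGain k j (fun q => ‖u q‖ₑ) p) (C * ‖u p‖ₑ)
                (p := 2) (by norm_num)
              norm_num at this
              simpa using this
          _ = _ := by ring
    _ = 2 * (∫⁻ p, (ENNReal.ofReal (M p.2) * kerGain k j (fun q => ‖u q‖ₑ) p) ^ 2 *
            ENNReal.ofReal (M p.2)⁻¹) + 2 * (C ^ 2 * wNormSq M u) := by
        have hu' := hu.enorm
        rw [lintegral_add_left (by fun_prop), lintegral_const_mul _ (by fun_prop),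
          lintegral_const_mul _ (by fun_prop), lintegral_const_mul _ (by fun_prop), wNormSq]
    _ ≤ 2 * (C ^ 2 * wNormSq M u) + 2 * (C ^ 2 * wNormSq M u) := by
        gcongr
        exact h.lintegral_kerGain_sq_le hu.enorm
    _ = _ := by ring

end IsColKernel

end kernel

/-! ### The Maxwellian -/

section maxwellian
variable {m θ : ℝ} (hm : 0 < m) (hθ : 0 < θ)
include hm hθ

lemma maxwellian_pos (v : R3) : 0 < maxwellian m θ v := by
  unfold maxwellian; positivity

end maxwellian

lemma continuous_maxwellian (m θ : ℝ) : Continuous (maxwellian m θ) := by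
  unfold maxwellian; fun_prop

lemma measurable_maxwellian (m θ : ℝ) : Measurable (maxwellian m θ) :=
  (continuous_maxwellian m θ).measurable

lemma maxwellian_axisRot (m θ α : ℝ) (v : R3) :
    maxwellian m θ (axisRot α v) = maxwellian m θ v := by
  simp [maxwellian]

lemma maxwellian_larmor (m θ ω α : ℝ) (p : Phase) :
    maxwellian m θ (larmor ω α p).2 = maxwellian m θ p.2 := by
  rw [larmor_eq]; exact maxwellian_axisRot m θ α p.2

lemma integrable_maxwellian {m θ : ℝ} (hm : 0 < m) (hθ : 0 < θ) :
    Integrable (maxwellian m θ) := by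
  have hb : 0 < m / (2 * θ) := by positivity
  have h : Integrable fun v : R3 => Real.exp (-(m / (2 * θ)) * ‖v‖ ^ 2) := by
    -- If the Gaussian were not integrable, its integral would be `0` by convention, against the
    -- explicit positive value.
    by_contra hcon
    have := GaussianFourier.integral_rexp_neg_mul_sq_norm (V := R3) hb
    rw [integral_undef hcon] at this
    have : 0 < (Real.pi / (m / (2 * θ))) ^ ((Module.finrank ℝ R3 : ℝ) / 2) := by positivity
    linarith
  refine (h.const_mul (1 / (2 * Real.pi * θ / m) ^ (3 / 2 : ℝ))).congr
    (Eventually.of_forall fun v => ?_)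
  simp only [maxwellian]
  congr 2
  ring

lemma lintegral_maxwellian_ne_top {m θ : ℝ} (hm : 0 < m) (hθ : 0 < θ) :
    ∫⁻ v, ENNReal.ofReal (maxwellian m θ v) ≠ ∞ :=
  (integrable_maxwellian hm hθ).lintegral_lt_top.ne

/-! ### The two collision operators as integral operators -/

/-- The kernel of the relaxation operator. -/
def relaxKernel (σ : ℝ → ℝ) (p : Phase) (v' : R3) : ℝ := σ ‖p.2 - v'‖

/-- The phase space point at which the relaxation operator evaluates a density. -/
def relaxPoint (p : Phase) (v' : R3) : Phase := (p.1, v')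

/-- The phase space point at which the averaged operator evaluates a density. -/
def avgPoint (p : Phase) (y : R2 × R3) : Phase := (glue y.1 (p.1 2), y.2)

lemma QB_eq_kerCol (m θ τ : ℝ) (σ : ℝ → ℝ) (u : Phase → ℝ) :
    QB m θ τ (fun v v' => σ ‖v - v'‖) u
      = (1 / τ) • kerCol (maxwellian m θ) (relaxKernel σ) relaxPoint u := rfl

lemma avgQB_eq_kerCol (m θ τ ω : ℝ) (σ : ℝ → ℝ) (u : Phase → ℝ) :
    avgQB m θ τ ω σ u
      = (ω ^ 2 / τ) • kerCol (maxwellian m θ) (avgKernel ω σ) avgPoint u := rfl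

lemma avgGainL_eq_kerGain (ω : ℝ) (σ : ℝ → ℝ) (F : Phase → ℝ≥0∞) (p : Phase) :
    avgGainL ω σ F p = ENNReal.ofReal (ω ^ 2) * kerGain (avgKernel ω σ) avgPoint F p := rfl

/-- The bound of the relaxation operator. -/
def relaxBound (m θ S₀ : ℝ) : ℝ≥0∞ :=
  ENNReal.ofReal S₀ * ∫⁻ v, ENNReal.ofReal (maxwellian m θ v)

section bounds

variable {m θ : ℝ} (hm : 0 < m) (hθ : 0 < θ) {σ : ℝ → ℝ} (hσ : Measurable σ) {s₀ S₀ : ℝ}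
  (hs₀ : 0 < s₀) (hσ_bound : ∀ r : ℝ, 0 ≤ r → s₀ ≤ σ r ∧ σ r ≤ S₀)

include hσ_bound in
lemma gainL_maxwellian_le (p : Phase) :
    gainL σ (fun q => ENNReal.ofReal (maxwellian m θ q.2)) p ≤ relaxBound m θ S₀ := by
  have hM := measurable_maxwellian m θ
  rw [relaxBound, ← lintegral_const_mul _ (by fun_prop)]
  refine lintegral_mono fun v' => ?_
  gcongr
  exact (hσ_bound _ (norm_nonneg _)).2

include hσ_bound in
lemma lintegral_gainL_le {G : Phase → ℝ≥0∞} (hG : Measurable G) :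
    ∫⁻ p, ENNReal.ofReal (maxwellian m θ p.2) * gainL σ G p
      ≤ relaxBound m θ S₀ * ∫⁻ p, G p := by
  have hM := measurable_maxwellian m θ
  have h1 : ∀ x : R3, Measurable fun v' => G (x, v') := fun x => by fun_prop
  have hGm : Measurable fun x : R3 => ∫⁻ v', G (x, v') :=
    Measurable.lintegral_prod_right' (f := G) hG
  calc ∫⁻ p, ENNReal.ofReal (maxwellian m θ p.2) * gainL σ G p
      ≤ ∫⁻ p : Phase, ENNReal.ofReal (maxwellian m θ p.2) *
          (ENNReal.ofReal S₀ * ∫⁻ v', G (p.1, v')) := by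
        refine lintegral_mono fun p => ?_
        gcongr
        rw [gainL, ← lintegral_const_mul _ (h1 _)]
        refine lintegral_mono fun v' => ?_
        gcongr
        exact (hσ_bound _ (norm_nonneg _)).2
    _ = ∫⁻ x : R3, ∫⁻ v : R3, ENNReal.ofReal (maxwellian m θ v) *
          (ENNReal.ofReal S₀ * ∫⁻ v', G (x, v')) := by
        rw [Measure.volume_eq_prod, lintegral_prod]
        exact Measurable.aemeasurable (by fun_prop)
    _ = ∫⁻ x : R3, relaxBound m θ S₀ * ∫⁻ v', G (x, v') := by
        refine lintegral_congr fun x => ?_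
        rw [lintegral_mul_const _ (by fun_prop), relaxBound]; ring
    _ = _ := by
        rw [lintegral_const_mul _ hGm, Measure.volume_eq_prod, lintegral_prod _ hG.aemeasurable]

include hm hθ in
lemma relaxBound_ne_top : relaxBound m θ S₀ ≠ ∞ :=
  ENNReal.mul_ne_top ENNReal.ofReal_ne_top (lintegral_maxwellian_ne_top hm hθ)

include hm hθ hσ hs₀ hσ_bound

lemma isColKernel_relax :
    IsColKernel (maxwellian m θ) (relaxKernel σ) relaxPoint (relaxBound m θ S₀) where
  measurable_M := measurable_maxwellian m θ
  pos_M := maxwellian_pos hm hθ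
  measurable_k := by unfold Function.uncurry relaxKernel; fun_prop
  measurable_j := by unfold Function.uncurry relaxPoint; fun_prop
  nonneg p y := hs₀.le.trans (hσ_bound _ (norm_nonneg _)).1
  ne_top := relaxBound_ne_top hm hθ
  gain_le := Eventually.of_forall fun p => gainL_maxwellian_le hσ_bound p
  lintegral_le G hG := lintegral_gainL_le hσ_bound hG

/-- Off the null set of velocities without perpendicular part, the averaged gain is the average of
the gain of an average. Averaging fixes `M` and preserves integrals against functions of `M`, so
both Schur conditions are inherited from the relaxation operator. The inverse of `ω²` in the
constant appears because the kernel is taken without its prefactor. -/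
lemma isColKernel_avg {ω : ℝ} (hω : ω ≠ 0) :
    IsColKernel (maxwellian m θ) (avgKernel ω σ) avgPoint
      ((ENNReal.ofReal (ω ^ 2))⁻¹ * relaxBound m θ S₀) := by
  have hM := measurable_maxwellian m θ
  have hω0 : ENNReal.ofReal (ω ^ 2) ≠ 0 := by simpa using hω
  have hker : ∀ F p, kerGain (avgKernel ω σ) avgPoint F p
      = (ENNReal.ofReal (ω ^ 2))⁻¹ * avgGainL ω σ F p := fun F p => by
    rw [avgGainL_eq_kerGain, ← mul_assoc, ENNReal.inv_mul_cancel hω0 ENNReal.ofReal_ne_top, one_mul]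
  refine ⟨hM, maxwellian_pos hm hθ, ?_, ?_, ?_, ?_, ?_, ?_⟩
  · exact measurable_avgKernel ω hσ measurable_fst measurable_snd
  · unfold Function.uncurry avgPoint; fun_prop
  · intro p y
    unfold avgKernel avgSection
    refine mul_nonneg (hs₀.le.trans (hσ_bound _ (Real.sqrt_nonneg _)).1) ?_
    unfold chi; split_ifs <;> positivity
  · exact ENNReal.mul_ne_top (ENNReal.inv_ne_top.2 hω0) (relaxBound_ne_top hm hθ)
  · filter_upwards [ae_bar_snd_ne_zero] with p hp
    rw [hker, avgGainL_eq hω hσ (by fun_prop) hp]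
    gcongr
    have h1 : gyroLavg ω (fun q => ENNReal.ofReal (maxwellian m θ q.2))
        = fun q => ENNReal.ofReal (maxwellian m θ q.2) := by
      funext q; simp [gyroLavg, maxwellian_larmor]
    rw [h1]
    refine (lintegral_mono fun α => gainL_maxwellian_le hσ_bound _).trans ?_
    simp
  · intro G hG
    have h1 : ∫⁻ p, ENNReal.ofReal (maxwellian m θ p.2) * kerGain (avgKernel ω σ) avgPoint G p
        = ∫⁻ p, (ENNReal.ofReal (ω ^ 2))⁻¹ *
          (gyroLavg ω (gainL σ (gyroLavg ω G)) p * ENNReal.ofReal (maxwellian m θ p.2)) := by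
      refine lintegral_congr_ae ?_
      filter_upwards [ae_bar_snd_ne_zero] with p hp
      rw [hker, avgGainL_eq hω hσ hG hp]; ring
    rw [h1, lintegral_const_mul' _ _ (ENNReal.inv_ne_top.2 hω0),
      lintegral_gyroLavg_mul (by fun_prop) (by fun_prop)
        (fun α p => by rw [maxwellian_larmor]), mul_assoc]
    gcongr
    have h2 := lintegral_gainL_le (m := m) (θ := θ) hσ_bound (G := gyroLavg ω G) (by fun_prop)
    have h3 := lintegral_gyroLavg_mul (ω := ω) (w := 1) hG measurable_one (fun _ _ => rfl)
    simp only [Pi.one_apply, mul_one] at h3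
    rw [h3] at h2
    refine le_trans (le_of_eq ?_) h2
    simp only [mul_comm]

end bounds

/-! ### Averaging the relaxation operator -/

lemma gyroAvg_congr {ω : ℝ} {u w : Phase → ℝ} (h : u =ᵐ[volume] w) :
    gyroAvg ω u =ᵐ[volume] gyroAvg ω w := by
  filter_upwards [ae_ae_larmor ω h] with p hp
  rw [gyroAvg_eq, gyroAvg_eq]
  exact integral_congr_ae hp

lemma gyroLavg_congr {ω : ℝ} {u w : Phase → ℝ≥0∞} (h : u =ᵐ[volume] w) :
    gyroLavg ω u =ᵐ[volume] gyroLavg ω w := by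
  filter_upwards [ae_ae_larmor ω h] with p hp
  exact lintegral_congr_ae hp

/-- A measurable function invariant under each `larmor ω α` up to a null set is, at almost every
point, almost everywhere constant along the Larmor circle. -/
lemma ae_ae_larmor_eq {ω : ℝ} {X : Type*} [MeasurableSpace X] [TopologicalSpace X]
    [SecondCountableTopology X] [TopologicalSpace.MetrizableSpace X] [BorelSpace X] {u : Phase → X}
    (hu : Measurable u) (hinv : ∀ α, (fun p => u (larmor ω α p)) =ᵐ[volume] u) :
    ∀ᵐ p, ∀ᵐ α ∂gyroMeasure, u (larmor ω α p) = u p := by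
  have hm : MeasurableSet {z : ℝ × Phase | u (larmor ω z.1 z.2) = u z.2} :=
    StronglyMeasurable.measurableSet_eq_fun
      (Measurable.stronglyMeasurable (by fun_prop)) (Measurable.stronglyMeasurable (by fun_prop))
  have h1 : ∀ᵐ z ∂gyroMeasure.prod (volume : Measure Phase), u (larmor ω z.1 z.2) = u z.2 :=
    (Measure.ae_prod_iff_ae_ae hm).2 (Eventually.of_forall hinv)
  exact Measure.ae_ae_of_ae_prod
    (Measure.measurePreserving_swap.quasiMeasurePreserving.ae h1 :
      ∀ᵐ z ∂(volume : Measure Phase).prod gyroMeasure, u (larmor ω z.2 z.1) = u z.1)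

section
variable {m θ : ℝ} (hm : 0 < m) (hθ : 0 < θ) {σ : ℝ → ℝ} (hσ : Measurable σ) {s₀ S₀ : ℝ}
  (hs₀ : 0 < s₀) (hσ_bound : ∀ r : ℝ, 0 ≤ r → s₀ ≤ σ r ∧ σ r ≤ S₀) {ω : ℝ} (hω : ω ≠ 0)

include hm hθ hσ hs₀ hσ_bound hω

/-- For an invariant density the inner average in `avgGainL_eq` can be dropped: it changes the
density on a null set only, which neither the gain operator nor the outer average sees. -/
lemma avgGainL_of_invariant {U : Phase → ℝ≥0∞} (hU : Measurable U)
    (hinv : ∀ α, (fun p => U (larmor ω α p)) =ᵐ[volume] U) :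
    avgGainL ω σ U =ᵐ[volume] gyroLavg ω (gainL σ U) := by
  have hK := isColKernel_relax hm hθ hσ hs₀ hσ_bound
  have h1 : gyroLavg ω U =ᵐ[volume] U := by
    filter_upwards [ae_ae_larmor_eq hU hinv] with p hp
    rw [gyroLavg, lintegral_congr_ae hp]; simp
  have h2 : gainL σ (gyroLavg ω U) =ᵐ[volume] gainL σ U := by
    filter_upwards [hK.ae_ae h1] with p hp
    refine lintegral_congr_ae ?_
    filter_upwards [hp] with y hy
    rcases hy with hy | hy
    · change ENNReal.ofReal (relaxKernel σ p y) * _ = ENNReal.ofReal (relaxKernel σ p y) * _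
      simp [hy]
    · congr 1
  filter_upwards [gyroLavg_congr (ω := ω) h2, ae_bar_snd_ne_zero] with p hp hp'
  rw [avgGainL_eq hω hσ hU hp', hp]

/-- Passage from `[0, ∞]`-valued to real integrals. Nonnegativity allows the comparison, and the
finiteness needed for it comes from the bound of the averaged operator. Integrability in the angle
is recorded because the signed case subtracts two such integrals. -/
lemma avgKernel_integral_of_invariant_nonneg {u : Phase → ℝ} (hu : Measurable u)
    (hu0 : ∀ p, 0 ≤ u p) (hu2 : wNormSq (maxwellian m θ) u < ∞)
    (hinv : ∀ α, (fun p => u (larmor ω α p)) =ᵐ[volume] u) :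
    ∀ᵐ p, Integrable (fun α => ∫ v', relaxKernel σ (larmor ω α p) v' *
          u (relaxPoint (larmor ω α p) v')) gyroMeasure ∧
      ω ^ 2 * ∫ y, avgKernel ω σ p y * u (avgPoint p y)
        = ∫ α, (∫ v', relaxKernel σ (larmor ω α p) v' * u (relaxPoint (larmor ω α p) v'))
          ∂gyroMeasure := by
  have hK := isColKernel_relax hm hθ hσ hs₀ hσ_bound
  have hA := isColKernel_avg hm hθ hσ hs₀ hσ_bound hω
  set U : Phase → ℝ≥0∞ := fun p => ENNReal.ofReal (u p) with hUdef
  have hUm : Measurable U := by fun_prop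
  have hUinv : ∀ α, (fun p => U (larmor ω α p)) =ᵐ[volume] U := fun α => by
    filter_upwards [hinv α] with p hp; simp only [hUdef, hp]
  have hgain : ∀ p, ∫ v', relaxKernel σ p v' * u (relaxPoint p v') = (gainL σ U p).toReal := by
    intro p
    have hk : Measurable fun y => relaxKernel σ p y := hK.measurable_k_comp
      (measurable_const (a := p)) measurable_id
    have hj : Measurable fun y => relaxPoint p y := hK.measurable_j_comp
      (measurable_const (a := p)) measurable_id
    rw [integral_eq_lintegral_of_nonneg_ae
      (Eventually.of_forall fun v' => mul_nonneg (hK.nonneg p v') (hu0 _))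
      (hk.mul (hu.comp hj)).aestronglyMeasurable]
    congr 1
    exact lintegral_congr fun v' => ENNReal.ofReal_mul (hK.nonneg p v')
  have havg : ∀ p, ω ^ 2 * ∫ y, avgKernel ω σ p y * u (avgPoint p y)
      = (avgGainL ω σ U p).toReal := by
    intro p
    have hk : Measurable fun y => avgKernel ω σ p y := hA.measurable_k_comp
      (measurable_const (a := p)) measurable_id
    have hj : Measurable fun y => avgPoint p y := hA.measurable_j_comp
      (measurable_const (a := p)) measurable_id
    rw [integral_eq_lintegral_of_nonneg_ae
      (Eventually.of_forall fun v' => mul_nonneg (hA.nonneg p v') (hu0 _))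
      (hk.mul (hu.comp hj)).aestronglyMeasurable, avgGainL_eq_kerGain, ENNReal.toReal_mul,
      ENNReal.toReal_ofReal (sq_nonneg ω)]
    congr 2
    exact lintegral_congr fun v' => ENNReal.ofReal_mul (hA.nonneg p v')
  have hfin : ∀ᵐ p, avgGainL ω σ U p ≠ ∞ := by
    filter_upwards [hA.integrable_k_mul hu hu2] with p hp
    rw [avgGainL_eq_kerGain]
    refine ENNReal.mul_ne_top ENNReal.ofReal_ne_top ?_
    have := hp.lintegral_lt_top.ne
    refine ne_of_eq_of_ne (lintegral_congr fun y => ?_) this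
    rw [ENNReal.ofReal_mul (hA.nonneg p y)]
  filter_upwards [avgGainL_of_invariant hm hθ hσ hs₀ hσ_bound hω hUm hUinv, hfin] with p hp hp'
  have hmα : Measurable fun α => gainL σ U (larmor ω α p) := by fun_prop
  rw [hp] at hp'
  simp only [hgain, havg]
  refine ⟨integrable_toReal_of_lintegral_ne_top hmα.aemeasurable hp', ?_⟩
  rw [hp, integral_toReal hmα.aemeasurable (ae_lt_top hmα hp'), gyroLavg]

/-- The averaged operator is the average of the relaxation operator, on densities invariant under
the cyclotronic flow. -/
lemma gyroAvg_QB_of_invariant (τ : ℝ) {u : Phase → ℝ} (hu : Measurable u)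
    (hu2 : wNormSq (maxwellian m θ) u < ∞)
    (hinv : ∀ α, (fun p => u (larmor ω α p)) =ᵐ[volume] u) :
    gyroAvg ω (QB m θ τ (fun v v' => σ ‖v - v'‖) u) =ᵐ[volume] avgQB m θ τ ω σ u := by
  have hK := isColKernel_relax hm hθ hσ hs₀ hσ_bound
  have hA := isColKernel_avg hm hθ hσ hs₀ hσ_bound hω
  have hM := measurable_maxwellian m θ
  have hle : ∀ w : Phase → ℝ, (∀ p, |w p| ≤ |u p|) → wNormSq (maxwellian m θ) w < ∞ :=
    fun w hw => lt_of_le_of_lt (lintegral_mono fun p => by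
      gcongr
      rw [enorm_le_iff_norm_le]; exact hw p) hu2
  -- The positive and negative parts of an invariant density are invariant and have no larger
  -- weighted norm, so the nonnegative case applies to each.
  have hpos := avgKernel_integral_of_invariant_nonneg hm hθ hσ hs₀ hσ_bound hω
    (u := fun p => max (u p) 0) (by fun_prop) (fun p => le_max_right _ _)
    (hle _ fun p => abs_max_le_max_abs_abs.trans (by simp))
    (fun α => by filter_upwards [hinv α] with p hp; rw [hp])
  have hneg := avgKernel_integral_of_invariant_nonneg hm hθ hσ hs₀ hσ_bound hω
    (u := fun p => max (-u p) 0) (by fun_prop) (fun p => le_max_right _ _)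
    (hle _ fun p => abs_max_le_max_abs_abs.trans (by simp))
    (fun α => by filter_upwards [hinv α] with p hp; rw [hp])
  have hsplit : ∀ x : ℝ, x = max x 0 - max (-x) 0 := fun x => by
    rcases le_total 0 x with h | h <;> simp [h]
  have hKp := hK.integrable_k_mul (u := fun p => max (u p) 0) (by fun_prop)
    (hle _ fun p => abs_max_le_max_abs_abs.trans (by simp))
  have hKn := hK.integrable_k_mul (u := fun p => max (-u p) 0) (by fun_prop)
    (hle _ fun p => abs_max_le_max_abs_abs.trans (by simp))
  have hAp := hA.integrable_k_mul (u := fun p => max (u p) 0) (by fun_prop)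
    (hle _ fun p => abs_max_le_max_abs_abs.trans (by simp))
  have hAn := hA.integrable_k_mul (u := fun p => max (-u p) 0) (by fun_prop)
    (hle _ fun p => abs_max_le_max_abs_abs.trans (by simp))
  -- the loss frequency
  set Λ : Phase → ℝ := fun p => ∫ v', relaxKernel σ p v' * maxwellian m θ (relaxPoint p v').2
    with hΛ
  have hΛgain : ∀ p, Λ p
      = (gainL σ (fun q => ENNReal.ofReal (maxwellian m θ q.2)) p).toReal := by
    intro p
    have hk : Measurable fun y => relaxKernel σ p y := hK.measurable_k_comp
      (measurable_const (a := p)) measurable_id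
    have hj : Measurable fun y => relaxPoint p y := hK.measurable_j_comp
      (measurable_const (a := p)) measurable_id
    rw [hΛ]
    simp only
    rw [integral_eq_lintegral_of_nonneg_ae
      (Eventually.of_forall fun v' => mul_nonneg (hK.nonneg p v') (maxwellian_pos hm hθ _).le)
      (hk.mul (hM.comp hj.snd)).aestronglyMeasurable]
    congr 1
    exact lintegral_congr fun v' => ENNReal.ofReal_mul (hK.nonneg p v')
  have hgaininv : ∀ α p, gainL σ (fun q => ENNReal.ofReal (maxwellian m θ q.2)) (larmor ω α p)
      = gainL σ (fun q => ENNReal.ofReal (maxwellian m θ q.2)) p := by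
    intro α p
    rw [gainL, ← (measurePreserving_axisRot α).lintegral_comp (by fun_prop)]
    refine lintegral_congr fun v' => ?_
    simp only [larmor_eq, maxwellian_axisRot]
    rw [← map_sub, (axisRot α).norm_map]
  -- The loss frequency of the averaged kernel is its gain applied to `M`. Since `M` and the
  -- original frequency are both invariant under the flow, the averages in `avgGainL_eq` do nothing
  -- and the two frequencies agree.
  have hΛavg : ∀ᵐ p, ω ^ 2 * ∫ y, avgKernel ω σ p y * maxwellian m θ (avgPoint p y).2 = Λ p := by
    filter_upwards [ae_bar_snd_ne_zero] with p hp
    have hk : Measurable fun y => avgKernel ω σ p y := hA.measurable_k_comp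
      (measurable_const (a := p)) measurable_id
    have hj : Measurable fun y => avgPoint p y := hA.measurable_j_comp
      (measurable_const (a := p)) measurable_id
    have h1 : gyroLavg ω (fun q => ENNReal.ofReal (maxwellian m θ q.2))
        = fun q => ENNReal.ofReal (maxwellian m θ q.2) := by
      funext q; simp [gyroLavg, maxwellian_larmor]
    have h2 : avgGainL ω σ (fun q => ENNReal.ofReal (maxwellian m θ q.2)) p
        = gainL σ (fun q => ENNReal.ofReal (maxwellian m θ q.2)) p := by
      rw [avgGainL_eq hω hσ (by fun_prop) hp, h1, gyroLavg]
      simp [hgaininv]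
    rw [hΛgain, ← h2, integral_eq_lintegral_of_nonneg_ae
      (Eventually.of_forall fun v' => mul_nonneg (hA.nonneg p v') (maxwellian_pos hm hθ _).le)
      (hk.mul (hM.comp hj.snd)).aestronglyMeasurable, avgGainL_eq_kerGain, ENNReal.toReal_mul,
      ENNReal.toReal_ofReal (sq_nonneg ω)]
    congr 2
    exact lintegral_congr fun v' => ENNReal.ofReal_mul (hA.nonneg p v')
  filter_upwards [hpos, hneg, ae_ae_larmor ω hKp, ae_ae_larmor ω hKn, hAp, hAn, hΛavg,
    hA.kerCol_eq hu hu2, ae_ae_larmor ω (hK.kerCol_eq hu hu2), ae_ae_larmor_eq hu hinv]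
    with p h1 h2 h3 h4 h5 h6 h7 h8 h9 h10
  rw [QB_eq_kerCol, avgQB_eq_kerCol, Pi.smul_apply, h8, gyroAvg_eq]
  have hJ : ω ^ 2 * ∫ y, avgKernel ω σ p y * u (avgPoint p y)
      = ∫ α, ((∫ v', relaxKernel σ (larmor ω α p) v' * max (u (relaxPoint (larmor ω α p) v')) 0)
        - ∫ v', relaxKernel σ (larmor ω α p) v' * max (-u (relaxPoint (larmor ω α p) v')) 0)
          ∂gyroMeasure := by
    rw [integral_sub h1.1 h2.1, ← h1.2, ← h2.2, ← mul_sub, ← integral_sub h5 h6]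
    congr 1
    refine integral_congr_ae (Eventually.of_forall fun y => ?_)
    dsimp only
    rw [← mul_sub, ← hsplit]
  have hQ : (fun α => ((1 / τ) • kerCol (maxwellian m θ) (relaxKernel σ) relaxPoint u)
        (larmor ω α p))
      =ᵐ[gyroMeasure] fun α => (1 / τ) * (maxwellian m θ p.2 *
        ((∫ v', relaxKernel σ (larmor ω α p) v' * max (u (relaxPoint (larmor ω α p) v')) 0)
        - ∫ v', relaxKernel σ (larmor ω α p) v' * max (-u (relaxPoint (larmor ω α p) v')) 0)
        - Λ p * u p) := by
    filter_upwards [h3, h4, h9, h10] with α a3 a4 a9 a10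
    rw [Pi.smul_apply, a9, a10, maxwellian_larmor, ← integral_sub a3 a4]
    have hL : Λ (larmor ω α p) = Λ p := by rw [hΛgain, hΛgain, hgaininv]
    rw [smul_eq_mul]
    congr 2
    · congr 1
      refine integral_congr_ae (Eventually.of_forall fun y => ?_)
      dsimp only
      rw [← mul_sub, ← hsplit]
    · rw [← hL]
  have hI : Integrable (fun α =>
      (∫ v', relaxKernel σ (larmor ω α p) v' * max (u (relaxPoint (larmor ω α p) v')) 0)
        - ∫ v', relaxKernel σ (larmor ω α p) v' * max (-u (relaxPoint (larmor ω α p) v')) 0)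
      gyroMeasure := h1.1.sub h2.1
  rw [integral_congr_ae hQ, integral_const_mul, integral_sub (hI.const_mul _)
    (integrable_const _), integral_const_mul, ← hJ, integral_const, ← h7, smul_eq_mul]
  simp
  ring

end

/-! ### Weakly invariant functions are invariant under the flow -/

section flow

variable {X : Type*} [NormedAddCommGroup X] [NormedSpace ℝ X] [FiniteDimensional ℝ X]
  [MeasurableSpace X] [BorelSpace X] {μ : Measure X} {L : ℝ → X →L[ℝ] X} {b : X → X} {c : ℝ}

/-- If `u b` is divergence free in the sense of distributions, then `u` is invariant under the
measure preserving linear flow `L` of the field `c b`. -/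
lemma comp_flow_ae_eq (hL0 : ∀ p, L 0 p = p) (hLadd : ∀ a a' p, L (a + a') p = L a (L a' p))
    (hLcont : Continuous fun z : ℝ × X => L z.1 z.2) (hLmp : ∀ a, MeasurePreserving (L a) μ μ)
    (hLder : ∀ a p, HasDerivAt (fun a => L a p) (c • b (L a p)) a)
    (hLb : ∀ a p, L a (b p) = b (L a p)) (hb : Continuous b)
    {u : X → ℝ} (hu : LocallyIntegrable u μ)
    (h : ∀ ψ : X → ℝ, ContDiff ℝ 1 ψ → HasCompactSupport ψ →
      ∫ p, u p * fderiv ℝ ψ p (b p) ∂μ = 0) (α : ℝ) :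
    (fun p => u (L α p)) =ᵐ[μ] u := by
  have hinv : ∀ a p, L (-a) (L a p) = p := fun a p => by rw [← hLadd]; simp [hL0]
  have hinv' : ∀ a p, L a (L (-a) p) = p := fun a p => by rw [← hLadd]; simp [hL0]
  let e : ∀ a, X ≃L[ℝ] X := fun a =>
    ContinuousLinearEquiv.equivOfInverse (L a) (L (-a)) (hinv a) (hinv' a)
  have he : ∀ a, ⇑(e a) = L a := fun a => rfl
  -- the weak formulation is constant along the flow
  have key : ∀ ψ : X → ℝ, ContDiff ℝ 1 ψ → HasCompactSupport ψ →
      ∀ a, ∫ p, u p * ψ (L a p) ∂μ = ∫ p, u p * ψ p ∂μ := by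
    intro ψ hψ hψc
    have hcomp : ∀ a, HasCompactSupport fun p => ψ (L a p) := fun a =>
      hψc.comp_homeomorph (e a).toHomeomorph
    -- Differentiating `ψ (L a p)` in `a` gives `c` times its derivative along `b` at `L a p`.
    -- Because `L a` maps `b p` to `b (L a p)`, this is also the derivative of the test function `ψ
    -- ∘ L a` along `b` at `p`, whose integral against `u` vanishes by hypothesis.
    have hD : ∀ a, HasDerivAt (fun a => ∫ p, u p * ψ (L a p) ∂μ) 0 a := by
      intro a
      set g : ℝ × X → ℝ := fun z => fderiv ℝ ψ (L z.1 z.2) (c • b (L z.1 z.2)) with hg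
      have hgc : Continuous g := by
        have h1 : Continuous (fderiv ℝ ψ) := hψ.continuous_fderiv one_ne_zero
        exact (h1.comp hLcont).clm_apply ((hb.comp hLcont).const_smul c)
      -- A compact set containing the supports of all `ψ ∘ L a'` for `a'` near `a`; it supplies the
      -- domination.
      set S : Set X := (fun z : ℝ × X => L (-z.1) z.2) '' (Icc (a - 1) (a + 1) ×ˢ tsupport ψ)
        with hS
      have hSc : IsCompact S := by
        refine (isCompact_Icc.prod hψc).image ?_
        exact hLcont.comp (f := fun z : ℝ × X => (-z.1, z.2)) (by fun_prop)
      have hgS : ∀ a' ∈ Icc (a - 1) (a + 1), ∀ p ∉ S, g (a', p) = 0 := by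
        intro a' ha' p hp
        have : L a' p ∉ tsupport ψ := fun hmem => hp ⟨(a', L a' p), ⟨ha', hmem⟩, hinv a' p⟩
        have : fderiv ℝ ψ (L a' p) = 0 :=
          image_eq_zero_of_notMem_tsupport fun hcon => this (tsupport_fderiv_subset ℝ hcon)
        simp [hg, this]
      obtain ⟨K, hK⟩ := IsCompact.exists_bound_of_continuousOn (f := g)
        (isCompact_Icc.prod hSc : IsCompact (Icc (a - 1) (a + 1) ×ˢ S)) hgc.continuousOn
      have hbound : Integrable (fun p => S.indicator (fun p => ‖u p‖ * K) p) μ := by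
        rw [integrable_indicator_iff hSc.measurableSet]
        exact ((hu.integrableOn_isCompact hSc).norm).mul_const K
      have hder := hasDerivAt_integral_of_dominated_loc_of_deriv_le (μ := μ)
        (F := fun a p => u p * ψ (L a p)) (F' := fun a p => u p * g (a, p)) (x₀ := a)
        (s := Icc (a - 1) (a + 1)) (bound := S.indicator (fun p => ‖u p‖ * K))
        (Icc_mem_nhds (by linarith) (by linarith))
        (Eventually.of_forall fun a' => hu.aestronglyMeasurable.mul
          (hψ.continuous.comp (L a').continuous).aestronglyMeasurable)
        (by
          have := hu.integrable_smul_left_of_hasCompactSupport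
            (hψ.continuous.comp (L a).continuous) (hcomp a)
          refine this.congr (Eventually.of_forall fun p => ?_)
          simp [mul_comm])
        (hu.aestronglyMeasurable.mul
          (hgc.comp (Continuous.prodMk_right a)).aestronglyMeasurable)
        (Eventually.of_forall fun p a' ha' => by
          by_cases hp : p ∈ S
          · rw [indicator_of_mem hp, norm_mul]
            exact mul_le_mul_of_nonneg_left (hK (a', p) ⟨ha', hp⟩) (norm_nonneg _)
          · rw [indicator_of_notMem hp, hgS a' ha' p hp]; simp)
        hbound
        (Eventually.of_forall fun p a' _ => by
          have h1 : HasFDerivAt ψ (fderiv ℝ ψ (L a' p)) (L a' p) :=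
            (hψ.differentiable one_ne_zero _).hasFDerivAt
          exact (h1.comp_hasDerivAt a' (hLder a' p)).const_mul (u p))
      refine hder.2.congr_deriv ?_
      have h0 := h (fun p => ψ (L a p)) (hψ.comp (L a).contDiff) (hcomp a)
      have h1 : ∀ p, fderiv ℝ (fun p => ψ (L a p)) p (b p) = fderiv ℝ ψ (L a p) (b (L a p)) := by
        intro p
        have := (hψ.differentiable one_ne_zero (L a p)).hasFDerivAt.comp p (L a).hasFDerivAt
        rw [HasFDerivAt.fderiv (f := fun p => ψ (L a p)) this]
        simp [hLb]
      simp only [h1] at h0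
      have h2 : ∀ p, u p * g (a, p) = c * (u p * fderiv ℝ ψ (L a p) (b (L a p))) := by
        intro p; simp [hg]; ring
      simp only [h2]
      rw [integral_const_mul, h0, mul_zero]
    intro a
    have := is_const_of_deriv_eq_zero (fun a => (hD a).differentiableAt)
      (fun a => (hD a).deriv) a 0
    simpa [hL0] using this
  have huL : LocallyIntegrable (fun p => u (L α p)) μ := by
    rw [locallyIntegrable_iff] at hu ⊢
    intro K hK
    have := (hLmp α).integrableOn_comp_preimage (e α).toHomeomorph.measurableEmbedding
      (f := u) (s := L α '' K)
    rw [(show Function.Injective (L α) from (e α).injective).preimage_image] at this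
    exact this.2 (hu _ (hK.image (L α).continuous))
  have hz := ae_eq_zero_of_integral_contDiff_smul_eq_zero (huL.sub hu) (fun ψ hψ hψc => by
    have hψ1 : ContDiff ℝ 1 ψ := hψ.of_le (by exact_mod_cast le_top)
    have i1 := huL.integrable_smul_left_of_hasCompactSupport hψ.continuous hψc
    have i2 := hu.integrable_smul_left_of_hasCompactSupport hψ.continuous hψc
    -- The flow preserves the measure, so it moves from `u` to the test function with its sign
    -- reversed.
    have h1 : ∫ p, ψ p • u (L α p) ∂μ = ∫ p, u p * ψ (L (-α) p) ∂μ := by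
      rw [← (hLmp α).integral_comp (e α).toHomeomorph.measurableEmbedding
        (fun p => u p * ψ (L (-α) p))]
      simp only [hinv, smul_eq_mul, mul_comm]
    have h2 := key ψ hψ1 hψc (-α)
    simp only [Pi.sub_apply, smul_sub]
    rw [integral_sub i1 i2, h1, h2]
    simp [mul_comm])
  filter_upwards [hz] with p hp
  simpa [sub_eq_zero] using hp

end flow

lemma continuous_cyclotronField (ω : ℝ) : Continuous (cyclotronField ω) := by
  unfold cyclotronField; fun_prop

/-- Elements of the kernel of `𝒯` are constant along the cyclotronic flow. -/
lemma larmor_ae_eq_of_weak {ω : ℝ} (hω : ω ≠ 0) {u : Phase → ℝ} (hu : LocallyIntegrable u)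
    (h : ∀ ψ : Phase → ℝ, ContDiff ℝ 1 ψ → HasCompactSupport ψ →
      ∫ p, u p * fderiv ℝ ψ p (cyclotronField ω p) = 0) (α : ℝ) :
    (fun p => u (larmor ω α p)) =ᵐ[volume] u :=
  comp_flow_ae_eq (L := larmorCLM ω) (b := cyclotronField ω) (c := -ω⁻¹)
    (fun p => larmor_zero ω p) (fun a a' p => larmor_add ω a a' p) (continuous_larmor ω)
    (fun a => measurePreserving_larmor ω a) (fun a p => hasDerivAt_larmor ω a hω p)
    (fun a p => larmor_cyclotronField ω a p hω) (continuous_cyclotronField ω) hu h α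

lemma measurePreserving_prodMap_larmor (ω α : ℝ) :
    MeasurePreserving (Prod.map id (larmor ω α) : ℝ × Phase → ℝ × Phase) timePhase timePhase :=
  (MeasurePreserving.id _).prod (measurePreserving_larmor ω α)

/-- Time is an inert variable of the flow. The ambient measure lives on `t ≥ 0` and is not a Haar
measure, which is why `comp_flow_ae_eq` asks only for an invariant measure. -/
lemma larmor_ae_eq_of_weak_time {ω : ℝ} (hω : ω ≠ 0) {u : ℝ × Phase → ℝ}
    (hu : LocallyIntegrable u timePhase)
    (h : ∀ ψ : ℝ × Phase → ℝ, ContDiff ℝ 1 ψ → HasCompactSupport ψ →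
      ∫ z, u z * fderiv ℝ ψ z (0, cyclotronField ω z.2) ∂timePhase = 0) (α : ℝ) :
    ∀ᵐ z ∂timePhase, u (z.1, larmor ω α z.2) = u z :=
  comp_flow_ae_eq (L := fun a => (ContinuousLinearMap.id ℝ ℝ).prodMap (larmorCLM ω a))
    (b := fun z => (0, cyclotronField ω z.2)) (c := -ω⁻¹)
    (fun z => by simp [Prod.map]) (fun a a' z => by simp [Prod.map, larmor_add])
    (by
      have := continuous_larmor ω
      exact (continuous_fst.comp continuous_snd).prodMk (this.comp
        (f := fun z : ℝ × ℝ × Phase => (z.1, z.2.2)) (by fun_prop)))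
    (fun a => measurePreserving_prodMap_larmor ω a)
    (fun a z => by
      have h1 := (hasDerivAt_const a z.1).prodMk (hasDerivAt_larmor ω a hω z.2)
      refine h1.congr_deriv ?_
      simp)
    (fun a z => by simp [larmor_cyclotronField ω a _ hω])
    (continuous_const.prodMk ((continuous_cyclotronField ω).comp continuous_snd)) hu h α

/-! ### Regular representatives of Sobolev functions -/

/-- A family of bump functions shrinking to the origin of `ℝ³`. -/
def shrinkBump (n : ℕ) : ContDiffBump (0 : R3) :=
  ⟨1 / (n + 1), 2 / (n + 1), by positivity, by gcongr; norm_num⟩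

lemma tendsto_shrinkBump_rOut : Tendsto (fun n => (shrinkBump n).rOut) atTop (𝓝 0) := by
  have := (tendsto_one_div_add_atTop_nhds_zero_nat (𝕜 := ℝ)).const_mul 2
  simpa [shrinkBump, div_eq_mul_inv] using this

/-- The regularization of a function by convolution. -/
def mollify (n : ℕ) (u : R3 → ℝ) : R3 → ℝ :=
  (shrinkBump n).normed volume ⋆[ContinuousLinearMap.lsmul ℝ ℝ, volume] u

lemma mollify_eq (n : ℕ) (u : R3 → ℝ) (x : R3) :
    mollify n u x = ∫ y, (shrinkBump n).normed volume (x - y) * u y := by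
  rw [mollify, convolution_eq_swap]; rfl

/-- The derivative of the regularization of a function is the regularization of its gradient. -/
lemma hasFDerivAt_mollify {u : R3 → ℝ} {g : Fin 3 → R3 → ℝ} (h : ∀ i, HasWeakPartial i u (g i))
    (n : ℕ) (x : R3) :
    HasFDerivAt (mollify n u)
      (∑ i, mollify n (g i) x • (EuclideanSpace.proj i : R3 →L[ℝ] ℝ)) x := by
  set ρ := (shrinkBump n).normed (volume : Measure R3) with hρ
  have hρs : ContDiff ℝ ((⊤ : ℕ∞) : WithTop ℕ∞) ρ := (shrinkBump n).contDiff_normed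
  have hρ1 : ContDiff ℝ 1 ρ := (shrinkBump n).contDiff_normed
  have hρc : HasCompactSupport ρ := (shrinkBump n).hasCompactSupport_normed
  have hu : LocallyIntegrable u := (h 0).1
  have hd := hρc.hasFDerivAt_convolution_left (ContinuousLinearMap.lsmul ℝ ℝ) hρ1 hu x
  refine hd.congr_fderiv ?_
  have hval : ∀ i, (fderiv ℝ ρ ⋆[(ContinuousLinearMap.lsmul ℝ ℝ).precompL R3, volume] u) x
      (EuclideanSpace.single i 1) = mollify n (g i) x := by
    intro i
    have hex := (hρc.fderiv ℝ).convolutionExists_left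
      ((ContinuousLinearMap.lsmul ℝ ℝ).precompL R3) (hρ1.continuous_fderiv one_ne_zero) hu x
    rw [convolution, ContinuousLinearMap.integral_apply hex, mollify_eq]
    -- The weak derivative is tested against the reflected bump `y ↦ ρ (x - y)`; the sign of the
    -- reflection cancels the sign of the integration by parts.
    have hw := (h i).2.2 (fun y => ρ (x - y)) (hρs.comp (contDiff_const.sub contDiff_id))
      (hρc.comp_homeomorph (Homeomorph.subLeft x))
    have hD : ∀ y, fderiv ℝ (fun y => ρ (x - y)) y (EuclideanSpace.single i 1)
        = -(fderiv ℝ ρ (x - y) (EuclideanSpace.single i 1)) := by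
      intro y
      have h1 := (hρ1.differentiable one_ne_zero (x - y)).hasFDerivAt.comp y
        ((hasFDerivAt_id y).const_sub x)
      rw [HasFDerivAt.fderiv (f := fun y => ρ (x - y)) h1]
      simp
    simp only [hD, mul_neg, integral_neg, neg_inj] at hw
    rw [← integral_sub_left_eq_self _ volume x]
    simp only [ContinuousLinearMap.precompL_apply, sub_sub_cancel,
      ContinuousLinearMap.lsmul_apply, smul_eq_mul]
    calc _ = ∫ y, u y * fderiv ℝ ρ (x - y) (EuclideanSpace.single i 1) := by
          simp only [mul_comm]
      _ = _ := by rw [hw]; simp only [mul_comm, hρ]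
  ext v
  have hv : v = ∑ i, v i • (EuclideanSpace.single i (1 : ℝ) : R3) := by
    apply R3.ext <;> simp [Fin.sum_univ_three]
  conv_lhs => rw [hv]
  simp only [map_sum, map_smul, hval]
  simp [mul_comm]

lemma abs_mollify_le {g : R3 → ℝ} {C : ℝ} (hg : ∀ᵐ x, |g x| ≤ C) (n : ℕ) (x : R3) :
    |mollify n g x| ≤ C := by
  have hC : 0 ≤ C := by
    obtain ⟨y, hy⟩ := hg.exists
    exact (abs_nonneg _).trans hy
  have hintg : Integrable fun y => (shrinkBump n).normed volume (x - y) :=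
    (shrinkBump n).integrable_normed.comp_sub_left x
  rw [mollify_eq, ← Real.norm_eq_abs]
  calc ‖∫ y, (shrinkBump n).normed volume (x - y) * g y‖
      ≤ ∫ y, (shrinkBump n).normed volume (x - y) * C := by
        refine norm_integral_le_of_norm_le (hintg.mul_const C) ?_
        filter_upwards [hg] with y hy
        rw [norm_mul, Real.norm_of_nonneg ((shrinkBump n).nonneg_normed _), Real.norm_eq_abs]
        exact mul_le_mul_of_nonneg_left hy ((shrinkBump n).nonneg_normed _)
    _ = C := by
        rw [integral_mul_const, integral_sub_left_eq_self, (shrinkBump n).integral_normed, one_mul]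

lemma MemLp_top_ae_le {g : R3 → ℝ} (hg : MemLp g ⊤) : ∃ C : ℝ, ∀ᵐ x, |g x| ≤ C := by
  refine ⟨(eLpNormEssSup g volume).toReal, ?_⟩
  have hfin : eLpNormEssSup g volume ≠ ⊤ := by
    rw [← eLpNorm_exponent_top]; exact hg.2.ne
  filter_upwards [ae_le_eLpNormEssSup (f := g) (μ := volume)] with x hx
  have := ENNReal.toReal_mono hfin hx
  simpa using this

/-- A function with bounded weak gradient has a Lipschitz representative. -/
lemma exists_lipschitz_rep {u : R3 → ℝ} {g : Fin 3 → R3 → ℝ} (h : ∀ i, HasWeakPartial i u (g i))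
    (hg : ∀ i, MemLp (g i) ⊤) : ∃ (K : ℝ≥0) (w : R3 → ℝ), LipschitzWith K w ∧ u =ᵐ[volume] w := by
  choose C hC using fun i => MemLp_top_ae_le (hg i)
  have hlip : ∀ n, LipschitzWith (∑ i, (C i).toNNReal) (mollify n u) := by
    intro n
    refine lipschitzWith_of_nnnorm_fderiv_le (𝕜 := ℝ)
      (fun x => (hasFDerivAt_mollify h n x).differentiableAt) fun x => ?_
    rw [(hasFDerivAt_mollify h n x).fderiv]
    refine (nnnorm_sum_le _ _).trans (Finset.sum_le_sum fun i _ => ?_)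
    rw [← NNReal.coe_le_coe, coe_nnnorm, norm_smul]
    have h1 : ‖(EuclideanSpace.proj i : R3 →L[ℝ] ℝ)‖ ≤ 1 :=
      ContinuousLinearMap.opNorm_le_bound _ zero_le_one fun v => by
        simpa using PiLp.norm_apply_le v i
    calc ‖mollify n (g i) x‖ * ‖(EuclideanSpace.proj i : R3 →L[ℝ] ℝ)‖ ≤ C i * 1 := by
          gcongr
          · exact (abs_nonneg _).trans (abs_mollify_le (hC i) n x)
          · exact abs_mollify_le (hC i) n x
      _ ≤ _ := by rw [mul_one]; exact Real.le_coe_toNNReal _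
  -- Almost everywhere convergence needs bumps whose outer and inner radii have bounded ratio; here
  -- the ratio is `2`.
  have hconv : ∀ᵐ x, Tendsto (fun n => mollify n u x) atTop (𝓝 (u x)) :=
    ContDiffBump.ae_convolution_tendsto_right_of_locallyIntegrable (K := 2)
      tendsto_shrinkBump_rOut (Eventually.of_forall fun n => by
        simp only [shrinkBump]; rw [mul_one_div]) (h 0).1
  -- The mollifications share one Lipschitz constant, so `u` is Lipschitz on the set of full measure
  -- where they converge to it. It then extends from that set to the whole space.
  have hlipOn : LipschitzOnWith (∑ i, (C i).toNNReal) u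
      {x | Tendsto (fun n => mollify n u x) atTop (𝓝 (u x))} := by
    refine LipschitzOnWith.of_dist_le_mul fun x hx y hy => ?_
    exact le_of_tendsto (Tendsto.dist hx hy) (Eventually.of_forall fun n => (hlip n).dist_le_mul x y)
  obtain ⟨w, hw, hwe⟩ := hlipOn.extend_real
  refine ⟨_, w, hw, ?_⟩
  filter_upwards [hconv] with x hx
  exact hwe hx

lemma HasWeakPartial.congr {i : Fin 3} {u u' g g' : R3 → ℝ} (h : HasWeakPartial i u g)
    (hu : u =ᵐ[volume] u') (hg : g =ᵐ[volume] g') : HasWeakPartial i u' g' := by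
  refine ⟨(locallyIntegrable_congr hu).1 h.1, (locallyIntegrable_congr hg).1 h.2.1,
    fun ψ hψ hψc => ?_⟩
  have h1 := h.2.2 ψ hψ hψc
  have e1 : ∫ x, u x * fderiv ℝ ψ x (EuclideanSpace.single i 1)
      = ∫ x, u' x * fderiv ℝ ψ x (EuclideanSpace.single i 1) :=
    integral_congr_ae (hu.mono fun x hx => by simp only [hx])
  have e2 : ∫ x, g x * ψ x = ∫ x, g' x * ψ x :=
    integral_congr_ae (hg.mono fun x hx => by simp only [hx])
  rw [← e1, ← e2, h1]

lemma HasWeakPartial.ae_unique {i : Fin 3} {u g g' : R3 → ℝ} (h : HasWeakPartial i u g)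
    (h' : HasWeakPartial i u g') : g =ᵐ[volume] g' := by
  have := ae_eq_zero_of_integral_contDiff_smul_eq_zero (h.2.1.sub h'.2.1) (fun ψ hψ hψc => by
    have i1 := h.2.1.integrable_smul_left_of_hasCompactSupport hψ.continuous hψc
    have i2 := h'.2.1.integrable_smul_left_of_hasCompactSupport hψ.continuous hψc
    have e1 := h.2.2 ψ hψ hψc
    have e2 := h'.2.2 ψ hψ hψc
    simp only [Pi.sub_apply, smul_sub]
    rw [integral_sub i1 i2]
    simp only [smul_eq_mul, mul_comm (ψ _)]
    linarith)
  filter_upwards [this] with x hx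
  simpa [sub_eq_zero] using hx

/-- A continuous function with Lipschitz weak gradient is differentiable. -/
lemma hasFDerivAt_of_weak {u : R3 → ℝ} (hu : Continuous u) {g : Fin 3 → R3 → ℝ} {K : Fin 3 → ℝ≥0}
    (hg : ∀ i, LipschitzWith (K i) (g i)) (h : ∀ i, HasWeakPartial i u (g i)) (x : R3) :
    HasFDerivAt u (∑ i, g i x • (EuclideanSpace.proj i : R3 →L[ℝ] ℝ)) x := by
  refine hasFDerivAt_of_tendstoUniformly (l := atTop)
    (f := fun n => mollify n u)
    (f' := fun n x => ∑ i, mollify n (g i) x • (EuclideanSpace.proj i : R3 →L[ℝ] ℝ))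
    (g' := fun x => ∑ i, g i x • (EuclideanSpace.proj i : R3 →L[ℝ] ℝ)) ?_
    (fun n x => hasFDerivAt_mollify h n x) (fun x =>
      ContDiffBump.convolution_tendsto_right_of_continuous tendsto_shrinkBump_rOut hu x) x
  rw [Metric.tendstoUniformly_iff]
  intro ε hε
  -- The Lipschitz bound on the weak gradient gives a uniform rate, proportional to the radius of
  -- the bump, for the convergence of the mollified gradients. Uniform convergence is what permits
  -- differentiating the limit.
  have hlim : Tendsto (fun n => ∑ i, (K i : ℝ) * (shrinkBump n).rOut *
      ‖(EuclideanSpace.proj i : R3 →L[ℝ] ℝ)‖) atTop (𝓝 0) := by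
    have : Tendsto (fun n => ∑ i, (K i : ℝ) * (shrinkBump n).rOut *
      ‖(EuclideanSpace.proj i : R3 →L[ℝ] ℝ)‖) atTop
        (𝓝 (∑ i, (K i : ℝ) * 0 * ‖(EuclideanSpace.proj i : R3 →L[ℝ] ℝ)‖)) :=
      tendsto_finsetSum _ fun i _ => (tendsto_shrinkBump_rOut.const_mul _).mul_const _
    simpa using this
  filter_upwards [hlim.eventually_lt_const hε] with n hn x
  refine lt_of_le_of_lt ?_ hn
  rw [dist_eq_norm, ← Finset.sum_sub_distrib]
  refine (norm_sum_le _ _).trans (Finset.sum_le_sum fun i _ => ?_)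
  rw [← sub_smul, norm_smul]
  gcongr
  rw [← dist_eq_norm, dist_comm]
  refine ContDiffBump.dist_normed_convolution_le (hg i).continuous.aestronglyMeasurable
    fun y hy => ?_
  refine ((hg i).dist_le_mul y x).trans ?_
  gcongr
  exact (Metric.mem_ball.1 hy).le

/-- A potential in `W^{2,∞}` has a bounded differentiable representative whose gradient is
Lipschitz. -/
lemma exists_regular_potential {φ : R3 → ℝ} (hφ : MemW2Infty φ) {E : R3 → R3}
    (hE : ∀ i, HasWeakPartial i φ (fun x => -(E x i))) :
    ∃ (Ψ : R3 → ℝ) (G : Fin 3 → R3 → ℝ) (K : ℝ≥0) (C : ℝ),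
      (∀ x, |Ψ x| ≤ C) ∧ (∀ i, LipschitzWith K (G i)) ∧
      (∀ x, HasFDerivAt Ψ (-∑ i, G i x • (EuclideanSpace.proj i : R3 →L[ℝ] ℝ)) x) ∧
      ∀ᵐ x, ∀ i, E x i = G i x := by
  obtain ⟨hφ0, g, h, hg, hh⟩ := hφ
  obtain ⟨C, hC⟩ := MemLp_top_ae_le hφ0
  obtain ⟨K0, Ψ, hΨ, hφΨ⟩ := exists_lipschitz_rep (fun i => (hg i).2) (fun i => (hg i).1)
  choose K w hw hgw using fun i => exists_lipschitz_rep (fun j => (hh i j).2)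
    (fun j => (hh i j).1)
  refine ⟨Ψ, fun i x => -w i x, ∑ i, K i, C, ?_, ?_, ?_, ?_⟩
  -- The set where the continuous representative exceeds the essential bound is open and null, hence
  -- empty: the bound holds at every point.
  · have hopen : IsOpen {x | C < |Ψ x|} := isOpen_lt continuous_const hΨ.continuous.abs
    have h0 : volume {x | C < |Ψ x|} = 0 := by
      have : ∀ᵐ x, ¬ C < |Ψ x| := by
        filter_upwards [hC, hφΨ] with x hx hx'
        rw [← hx']; exact not_lt.2 hx
      simpa [ae_iff] using this
    rw [hopen.measure_eq_zero_iff volume] at h0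
    intro x
    by_contra hcon
    have : x ∈ {x | C < |Ψ x|} := not_le.1 hcon
    rw [h0] at this
    exact this
  · intro i
    refine ((hw i).neg).weaken ?_
    exact Finset.single_le_sum (f := K) (fun _ _ => zero_le) (Finset.mem_univ i)
  · intro x
    have := hasFDerivAt_of_weak hΨ.continuous hw
      (fun i => (hg i).2.congr hφΨ (hgw i)) x
    refine this.congr_fderiv ?_
    simp
  · rw [ae_all_iff]
    intro i
    filter_upwards [(hE i).ae_unique (hg i).2, hgw i] with x hx hx'
    linarith

/-! ### Mean oscillation of square integrable functions -/

section renorm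

variable {V : Type*} [NormedAddCommGroup V] [NormedSpace ℝ V] [FiniteDimensional ℝ V]
  [MeasurableSpace V] [BorelSpace V] {μ : Measure V} [μ.IsAddHaarMeasure]

/-- Continuity of translations in `L²`, read off from the continuous action of the group on `Lp`. -/
lemma tendsto_eLpNorm_sub_translate {b : V → ℝ} (hb : MemLp b 2 μ) :
    Tendsto (fun w => eLpNorm (fun x => b (x - w) - b x) 2 μ) (𝓝 0) (𝓝 0) := by
  have : Fact ((2 : ℝ≥0∞) ≠ ⊤) := ⟨by norm_num⟩
  have hc : Continuous fun w : V => (DomAddAct.mk (-w) +ᵥ MemLp.toLp b hb : Lp ℝ 2 μ) :=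
    (DomAddAct.continuous_mk.comp continuous_neg).vadd continuous_const
  have hc' : Continuous fun w : V =>
      (DomAddAct.mk (-w) +ᵥ MemLp.toLp b hb : Lp ℝ 2 μ) - MemLp.toLp b hb :=
    hc.sub continuous_const
  have h0 := hc'.enorm.tendsto 0
  have hz : ‖(DomAddAct.mk (-(0 : V)) +ᵥ MemLp.toLp b hb : Lp ℝ 2 μ) - MemLp.toLp b hb‖ₑ = 0 := by
    rw [DomAddAct.mk_vadd_toLp]
    simp
  rw [hz] at h0
  refine h0.congr fun w => ?_
  simp only [DomAddAct.mk_vadd_toLp]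
  rw [← MemLp.toLp_sub, Lp.enorm_def]
  refine eLpNorm_congr_ae ((MemLp.coeFn_toLp _).trans (Eventually.of_forall fun x => ?_))
  simp [sub_eq_add_neg, add_comm]

/-- The mean oscillation of `b` around `x` at scale `δ`. -/
def meanOsc (μ : Measure V) (b : V → ℝ) (δ : ℝ) (x : V) : ℝ≥0∞ :=
  ENNReal.ofReal (δ ^ Module.finrank ℝ V)⁻¹ *
    ∫⁻ w in Metric.closedBall 0 δ, ‖b (x - w) - b x‖ₑ ∂μ

/-- By Fubini the quantity is a normalised integral over `‖w‖ ≤ δ` of the pairings of `|a|` with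
`|b(· - w) - b|`. Cauchy–Schwarz and continuity of translations in `L²` make these pairings
uniformly small. -/
lemma tendsto_lintegral_mul_meanOsc {a b : V → ℝ} (ha : Measurable a) (hb : Measurable b)
    (ha2 : MemLp a 2 μ) {R : ℝ} (haR : ∀ x ∉ Metric.closedBall (0 : V) R, a x = 0)
    (hb2 : ∀ R : ℝ, MemLp b 2 (μ.restrict (Metric.closedBall 0 R))) :
    Tendsto (fun δ => ∫⁻ x, ‖a x‖ₑ * meanOsc μ b δ x ∂μ) (𝓝[>] 0) (𝓝 0) := by
  -- Only `δ < 1` matters and `a` lives in the ball of radius `R`, so cutting `b` off at radius `R +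
  -- 1` changes no oscillation that is used, and makes it globally square integrable.
  set b' : V → ℝ := (Metric.closedBall (0 : V) (R + 1)).indicator b with hb'
  have hb'm : Measurable b' := hb.indicator Metric.isClosed_closedBall.measurableSet
  have hb'2 : MemLp b' 2 μ :=
    (memLp_indicator_iff_restrict Metric.isClosed_closedBall.measurableSet).2 (hb2 _)
  have hT := tendsto_eLpNorm_sub_translate hb'2
  set Z : ℝ≥0∞ := eLpNorm a 2 μ * μ (Metric.ball 0 1) with hZ
  have hZt : Z ≠ ∞ := ENNReal.mul_ne_top ha2.2.ne Metric.isBounded_ball.measure_lt_top.ne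
  rw [ENNReal.tendsto_nhds_zero]
  intro ε hε
  obtain ⟨η, hη, hηε⟩ : ∃ η : ℝ≥0∞, 0 < η ∧ η * Z ≤ ε := by
    by_cases hZ0 : Z = 0
    · exact ⟨1, one_pos, by simp [hZ0]⟩
    · by_cases hεt : ε = ∞
      · exact ⟨1, one_pos, by simp [hεt]⟩
      exact ⟨ε / Z, ENNReal.div_pos hε.ne' hZt, (ENNReal.div_mul_cancel hZ0 hZt).le⟩
  obtain ⟨δ₀, hδ₀, hball⟩ := Metric.eventually_nhds_iff.1 ((ENNReal.tendsto_nhds_zero.1 hT) η hη)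
  have hpos : ∀ᶠ δ : ℝ in 𝓝[>] 0, 0 < δ := eventually_mem_nhdsWithin
  have hlt : ∀ᶠ δ : ℝ in 𝓝[>] 0, δ < min δ₀ 1 :=
    nhdsWithin_le_nhds (gt_mem_nhds (lt_min hδ₀ one_pos))
  filter_upwards [hpos, hlt] with δ hδ hδ1
  have hδδ₀ := hδ1.trans_le (min_le_left _ _)
  have hδ11 := hδ1.trans_le (min_le_right _ _)
  refine le_trans ?_ hηε
  set B := Metric.closedBall (0 : V) δ with hB
  have hBm : MeasurableSet B := Metric.isClosed_closedBall.measurableSet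
  have h1 : ∀ x, ‖a x‖ₑ * meanOsc μ b δ x
      = ENNReal.ofReal (δ ^ Module.finrank ℝ V)⁻¹ *
        ∫⁻ w in B, ‖a x‖ₑ * ‖b' (x - w) - b' x‖ₑ ∂μ := by
    intro x
    rw [meanOsc, lintegral_const_mul _ (by fun_prop), ← mul_assoc, mul_comm ‖a x‖ₑ, mul_assoc]
    congr 1
    by_cases hx : x ∈ Metric.closedBall (0 : V) R
    · congr 1
      refine setLIntegral_congr_fun hBm fun w hw => ?_
      simp only [Metric.mem_closedBall, dist_zero_right] at hx hw
      have hx' : x ∈ Metric.closedBall (0 : V) (R + 1) := by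
        simp only [Metric.mem_closedBall, dist_zero_right]; linarith
      have hxw : x - w ∈ Metric.closedBall (0 : V) (R + 1) := by
        simp only [Metric.mem_closedBall, dist_zero_right]
        exact (norm_sub_le x w).trans (by linarith)
      simp only [hb', indicator_of_mem hx', indicator_of_mem hxw]
    · simp [haR x hx]
  simp only [h1]
  rw [lintegral_const_mul' _ _ ENNReal.ofReal_ne_top, lintegral_lintegral_swap (by fun_prop)]
  have h2 : ∀ w ∈ B, ∫⁻ x, ‖a x‖ₑ * ‖b' (x - w) - b' x‖ₑ ∂μ ≤ eLpNorm a 2 μ * η := by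
    intro w hw
    have hd : MemLp (fun x => b' (x - w) - b' x) 2 μ := by
      refine MemLp.sub ?_ hb'2
      exact hb'2.comp_measurePreserving (measurePreserving_sub_right μ w)
    have := eLpNorm_smul_le_mul_eLpNorm (p := 2) (q := 2) (r := 1) hd.1 ha2.1
    rw [eLpNorm_one_eq_lintegral_enorm] at this
    calc ∫⁻ x, ‖a x‖ₑ * ‖b' (x - w) - b' x‖ₑ ∂μ
        = ∫⁻ x, ‖(a • fun x => b' (x - w) - b' x) x‖ₑ ∂μ := by simp [enorm_mul]
      _ ≤ _ := this
      _ ≤ _ := by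
        gcongr
        refine hball ?_
        simp only [hB, Metric.mem_closedBall] at hw
        exact hw.trans_lt hδδ₀
  calc ENNReal.ofReal (δ ^ Module.finrank ℝ V)⁻¹ *
        ∫⁻ w in B, (∫⁻ x, ‖a x‖ₑ * ‖b' (x - w) - b' x‖ₑ ∂μ) ∂μ
      ≤ ENNReal.ofReal (δ ^ Module.finrank ℝ V)⁻¹ * ∫⁻ w in B, (eLpNorm a 2 μ * η) ∂μ := by
        exact mul_le_mul' le_rfl (setLIntegral_mono' hBm h2)
    _ = η * Z := by
        rw [setLIntegral_const, hB, Measure.addHaar_closedBall μ 0 hδ.le, hZ]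
        have : ENNReal.ofReal (δ ^ Module.finrank ℝ V)⁻¹ *
            ENNReal.ofReal (δ ^ Module.finrank ℝ V) = 1 := by
          rw [← ENNReal.ofReal_mul (by positivity), inv_mul_cancel₀ (by positivity),
            ENNReal.ofReal_one]
        calc _ = (ENNReal.ofReal (δ ^ Module.finrank ℝ V)⁻¹ *
            ENNReal.ofReal (δ ^ Module.finrank ℝ V)) * (η * (eLpNorm a 2 μ * μ (Metric.ball 0 1))) := by
              ring
          _ = _ := by rw [this, one_mul]

/-- The common shape of the four limits in the renormalization argument: an error controlled
pointwise by a mean oscillation tends to zero in `L¹` against `a`. -/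
lemma tendsto_integral_mul_of_meanOsc {a b : V → ℝ} (ha : Measurable a) (hb : Measurable b)
    (ha2 : MemLp a 2 μ) {R : ℝ} (haR : ∀ x ∉ Metric.closedBall (0 : V) R, a x = 0)
    (hb2 : ∀ R : ℝ, MemLp b 2 (μ.restrict (Metric.closedBall 0 R))) {F : ℝ → V → ℝ} {f : V → ℝ}
    (hf : Measurable f) (hF : ∀ δ, 0 < δ → Continuous (F δ)) {c : ℝ≥0∞} (hc : c ≠ ∞)
    (h : ∀ δ, 0 < δ → δ < 1 → ∀ x, a x ≠ 0 → ‖F δ x - f x‖ₑ ≤ c * meanOsc μ b δ x) :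
    Tendsto (fun δ => ∫ x, a x * F δ x ∂μ) (𝓝[>] 0) (𝓝 (∫ x, a x * f x ∂μ)) := by
  have hpos : ∀ᶠ δ : ℝ in 𝓝[>] 0, 0 < δ := eventually_mem_nhdsWithin
  have hlt : ∀ᶠ δ : ℝ in 𝓝[>] 0, δ < 1 := nhdsWithin_le_nhds (gt_mem_nhds one_pos)
  refine tendsto_integral_of_L1 (f := fun x => a x * f x) (ha.mul hf).aestronglyMeasurable ?_ ?_
  · filter_upwards [hpos] with δ hδ
    have hB : IsCompact (Metric.closedBall (0 : V) R) := isCompact_closedBall 0 R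
    have haI : IntegrableOn a (Metric.closedBall (0 : V) R) μ := by
      have : IsFiniteMeasure (μ.restrict (Metric.closedBall (0 : V) R)) :=
        ⟨by simpa using hB.measure_lt_top⟩
      exact (ha2.restrict _).integrable (by norm_num)
    have := haI.mul_continuousOn (hF δ hδ).continuousOn hB
    refine (integrableOn_iff_integrable_of_support_subset ?_).1 this
    intro x hx
    by_contra hcon
    simp [haR x hcon] at hx
  · have hlim : Tendsto (fun δ => c * ∫⁻ x, ‖a x‖ₑ * meanOsc μ b δ x ∂μ) (𝓝[>] 0) (𝓝 0) := by
      have := ENNReal.Tendsto.const_mul (a := c)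
        (tendsto_lintegral_mul_meanOsc ha hb ha2 haR hb2) (Or.inr hc)
      rwa [mul_zero] at this
    refine tendsto_of_tendsto_of_tendsto_of_le_of_le' tendsto_const_nhds hlim
      (Eventually.of_forall fun _ => zero_le) ?_
    filter_upwards [hpos, hlt] with δ hδ hδ1
    rw [← lintegral_const_mul' _ _ hc]
    refine lintegral_mono fun x => ?_
    rw [← mul_sub, enorm_mul]
    by_cases hx : a x = 0
    · simp [hx]
    · calc ‖a x‖ₑ * ‖F δ x - f x‖ₑ ≤ ‖a x‖ₑ * (c * meanOsc μ b δ x) := by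
            gcongr; exact h δ hδ hδ1 x hx
        _ = _ := by ring

end renorm

/-! ### Renormalization for Lipschitz divergence free fields -/

section renorm

variable {V : Type*} [NormedAddCommGroup V] [NormedSpace ℝ V] [FiniteDimensional ℝ V]
  [MeasurableSpace V] [BorelSpace V] {μ : Measure V} [μ.IsAddHaarMeasure]

set_option linter.unusedSectionVars false

/-- A smooth mollifier `k` at scale `δ`, with constant `c` in its bounds. -/
structure IsMollifier (μ : Measure V) (c δ : ℝ) (k : V → ℝ) : Prop where
  contDiff : ContDiff ℝ ((⊤ : ℕ∞) : WithTop ℕ∞) k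
  hasCompactSupport : HasCompactSupport k
  integral_eq : ∫ x, k x ∂μ = 1
  eq_zero : ∀ x ∉ Metric.closedBall (0 : V) δ, k x = 0
  fderiv_eq_zero : ∀ x ∉ Metric.closedBall (0 : V) δ, fderiv ℝ k x = 0
  abs_le : ∀ x, |k x| ≤ c * (δ ^ Module.finrank ℝ V)⁻¹
  norm_fderiv_le : ∀ x, ‖fderiv ℝ k x‖ ≤ c * (δ ^ Module.finrank ℝ V)⁻¹ * δ⁻¹

lemma exists_isMollifier (μ : Measure V) [μ.IsAddHaarMeasure] :
    ∃ c : ℝ, 0 ≤ c ∧ ∃ k : ℝ → V → ℝ, ∀ δ, 0 < δ → IsMollifier μ c δ (k δ) := by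
  let b : ContDiffBump (0 : V) := ⟨1 / 2, 1, by norm_num, by norm_num⟩
  set ρ : V → ℝ := b.normed μ with hρ
  have hρs : ContDiff ℝ ((⊤ : ℕ∞) : WithTop ℕ∞) ρ := b.contDiff_normed
  have hρc : HasCompactSupport ρ := b.hasCompactSupport_normed
  have hρt : tsupport ρ = Metric.closedBall 0 1 := b.tsupport_normed_eq
  obtain ⟨c₀, hc₀⟩ := hρc.exists_bound_of_continuous hρs.continuous
  obtain ⟨c₁, hc₁⟩ := (hρc.fderiv (𝕜 := ℝ)).exists_bound_of_continuous
    (hρs.continuous_fderiv (by simp))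
  refine ⟨max c₀ c₁, le_max_of_le_left ((norm_nonneg _).trans (hc₀ 0)),
    fun δ x => (δ ^ Module.finrank ℝ V)⁻¹ * ρ (δ⁻¹ • x), fun δ hδ => ?_⟩
  have hD : ∀ x, fderiv ℝ (fun x => (δ ^ Module.finrank ℝ V)⁻¹ * ρ (δ⁻¹ • x)) x
      = (δ ^ Module.finrank ℝ V)⁻¹ • δ⁻¹ • fderiv ℝ ρ (δ⁻¹ • x) := by
    intro x
    have hd : DifferentiableAt ℝ (fun x => ρ (δ⁻¹ • x)) x :=
      ((hρs.comp (contDiff_const_smul δ⁻¹)).differentiable (by simp)) x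
    rw [fderiv_const_mul hd, fderiv_comp_smul]
  have hout : ∀ x ∉ Metric.closedBall (0 : V) δ, δ⁻¹ • x ∉ tsupport ρ := by
    intro x hx
    rw [hρt]
    simp only [Metric.mem_closedBall, dist_zero_right, not_le] at hx ⊢
    rw [norm_smul, norm_inv, Real.norm_of_nonneg hδ.le, inv_mul_eq_div, lt_div_iff₀ hδ]
    linarith
  have hN : 0 ≤ (δ ^ Module.finrank ℝ V)⁻¹ := by positivity
  refine ⟨contDiff_const.mul (hρs.comp (contDiff_const_smul δ⁻¹)), ?_, ?_, ?_, ?_, ?_, ?_⟩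
  · exact (hρc.comp_smul (inv_ne_zero hδ.ne')).mul_left
  · rw [integral_const_mul, Measure.integral_comp_inv_smul, abs_of_pos (by positivity), hρ,
      b.integral_normed, smul_eq_mul, mul_one, inv_mul_cancel₀ (by positivity)]
  · intro x hx
    simp [image_eq_zero_of_notMem_tsupport (hout x hx)]
  · intro x hx
    rw [hD, image_eq_zero_of_notMem_tsupport (fun h => hout x hx (tsupport_fderiv_subset ℝ h))]
    simp
  · intro x
    rw [abs_mul, abs_of_nonneg hN, mul_comm]
    exact mul_le_mul_of_nonneg_right ((hc₀ _).trans (le_max_left _ _)) hN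
  · intro x
    rw [hD, norm_smul, norm_smul, Real.norm_of_nonneg hN, norm_inv, Real.norm_of_nonneg hδ.le]
    have := (hc₁ (δ⁻¹ • x)).trans (le_max_right c₀ c₁)
    calc (δ ^ Module.finrank ℝ V)⁻¹ * (δ⁻¹ * ‖fderiv ℝ ρ (δ⁻¹ • x)‖)
        ≤ (δ ^ Module.finrank ℝ V)⁻¹ * (δ⁻¹ * max c₀ c₁) := by gcongr
      _ = _ := by ring

lemma enorm_integral_le_meanOsc {b F : V → ℝ} (hb : Measurable b) {c δ : ℝ} (hc : 0 ≤ c)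
    (hδ : 0 < δ) {x : V} (hF0 : ∀ t ∉ Metric.closedBall (0 : V) δ, F t = 0)
    (hF : ∀ t ∈ Metric.closedBall (0 : V) δ,
      ‖F t‖ ≤ c * (δ ^ Module.finrank ℝ V)⁻¹ * ‖b (x - t) - b x‖) :
    ‖∫ t, F t ∂μ‖ₑ ≤ ENNReal.ofReal c * meanOsc μ b δ x := by
  have hBm : MeasurableSet (Metric.closedBall (0 : V) δ) := Metric.isClosed_closedBall.measurableSet
  rw [← setIntegral_eq_integral_of_forall_compl_eq_zero hF0]
  refine (enorm_integral_le_lintegral_enorm _).trans ?_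
  rw [meanOsc, ← mul_assoc, ← ENNReal.ofReal_mul hc, ← lintegral_const_mul _ (by fun_prop)]
  refine setLIntegral_mono' hBm fun t ht => ?_
  rw [← ofReal_norm, ← ofReal_norm, ← ENNReal.ofReal_mul (by positivity)]
  exact ENNReal.ofReal_le_ofReal (hF t ht)

lemma integral_fderiv_apply_const {k : V → ℝ} (hk : ContDiff ℝ 1 k)
    (hkc : HasCompactSupport k) (v : V) : ∫ x, fderiv ℝ k x v ∂μ = 0 := by
  have hc : Continuous fun x => fderiv ℝ k x v := by
    have := hk.continuous_fderiv (by simp); fun_prop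
  have := integral_mul_fderiv_eq_neg_fderiv_mul_of_integrable (μ := μ) (f := fun _ : V => (1 : ℝ))
    (g := k) (v := v) (by simp)
    (by simpa using hc.integrable_of_hasCompactSupport (hkc.fderiv_apply ℝ v))
    (by simpa using hk.continuous.integrable_of_hasCompactSupport hkc)
    (fun _ _ => by fun_prop) (fun x _ => hk.differentiable (by simp) x)
  simpa using this

lemma memLp_two_mul_of_hasCompactSupport {b g : V → ℝ} (hb : Measurable b)
    (hb2 : ∀ R : ℝ, MemLp b 2 (μ.restrict (Metric.closedBall 0 R)))
    (hg : Continuous g) (hgc : HasCompactSupport g) :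
    MemLp (fun x => b x * g x) 2 μ ∧
      ∃ R : ℝ, ∀ x ∉ Metric.closedBall (0 : V) R, b x * g x = 0 := by
  obtain ⟨R, hR⟩ := hgc.isCompact.isBounded.subset_closedBall (0 : V)
  have h0 : ∀ x ∉ Metric.closedBall (0 : V) R, b x * g x = 0 := fun x hx => by
    rw [image_eq_zero_of_notMem_tsupport fun h => hx (hR h), mul_zero]
  obtain ⟨C, hC⟩ := hgc.exists_bound_of_continuous hg
  refine ⟨?_, R, h0⟩
  have hi : (fun x => b x * g x) = (Metric.closedBall (0 : V) R).indicator fun x => b x * g x := by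
    refine (indicator_eq_self.2 fun x hx => ?_).symm
    by_contra h
    exact hx (h0 x h)
  rw [hi, memLp_indicator_iff_restrict Metric.isClosed_closedBall.measurableSet]
  refine (hb2 R).of_le_mul (c := C) (hb.mul hg.measurable).aestronglyMeasurable
    (Eventually.of_forall fun x => ?_)
  rw [norm_mul, mul_comm]
  exact mul_le_mul_of_nonneg_right (hC x) (norm_nonneg _)

lemma locallyIntegrable_of_memLp_two_closedBall {b : V → ℝ}
    (hb2 : ∀ R : ℝ, MemLp b 2 (μ.restrict (Metric.closedBall 0 R))) : LocallyIntegrable b μ := by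
  intro x
  refine ⟨Metric.closedBall 0 (‖x‖ + 1), ?_, ?_⟩
  · exact mem_of_superset (Metric.closedBall_mem_nhds x one_pos)
      (Metric.closedBall_subset_closedBall' (by simp [add_comm]))
  · have : IsFiniteMeasure (μ.restrict (Metric.closedBall (0 : V) (‖x‖ + 1))) :=
      ⟨by simpa using (isCompact_closedBall (0 : V) _).measure_lt_top⟩
    exact (hb2 _).integrable (by norm_num)

/-! ### The DiPerna–Lions commutator estimate -/

section commutator

variable {A : V → V} {K : ℝ≥0} {H G : V → ℝ} {c δ : ℝ} {k : V → ℝ}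

lemma enorm_convolution_sub_le (hH : Measurable H) (hHl : LocallyIntegrable H μ) (hc : 0 ≤ c)
    (hδ : 0 < δ) (hk : IsMollifier μ c δ k) (x : V) :
    ‖(k ⋆[ContinuousLinearMap.lsmul ℝ ℝ, μ] H) x - H x‖ₑ
      ≤ ENNReal.ofReal c * meanOsc μ H δ x := by
  have hi : Integrable (fun t => k t * H (x - t)) μ :=
    hk.hasCompactSupport.convolutionExists_left (ContinuousLinearMap.lsmul ℝ ℝ)
      hk.contDiff.continuous hHl x
  have hi2 : Integrable (fun t => k t * H x) μ :=
    (hk.contDiff.continuous.integrable_of_hasCompactSupport hk.hasCompactSupport).mul_const _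
  have : (k ⋆[ContinuousLinearMap.lsmul ℝ ℝ, μ] H) x - H x
      = ∫ t, k t * (H (x - t) - H x) ∂μ := by
    simp only [mul_sub]
    rw [integral_sub hi hi2, integral_mul_const, hk.integral_eq, one_mul]
    rfl
  rw [this]
  refine enorm_integral_le_meanOsc hH hc hδ (fun t ht => by simp [hk.eq_zero t ht])
    fun t _ => ?_
  rw [norm_mul]
  exact mul_le_mul_of_nonneg_right (hk.abs_le t) (norm_nonneg _)

/-- The weak equation tested with `k (x - ·)` writes the mollified source as an integral of `H (x -
t)` against the derivative of `k` along `A (x - t)`. The difference therefore involves `A x - A (x -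
t)`, whose Lipschitz bound `K δ` cancels the factor `δ⁻¹` of the derivative of `k`. Replacing `H (x
- t)` by `H (x - t) - H x` costs nothing: the derivative of `k` has zero integral along a constant
vector, and along `A (x - ·)` because `A` is divergence free. What is left is a mean oscillation of
`H`. -/
lemma enorm_commutator_le (hA : LipschitzWith K A)
    (hdiv : ∀ ρ : V → ℝ, ContDiff ℝ ((⊤ : ℕ∞) : WithTop ℕ∞) ρ → HasCompactSupport ρ →
      ∫ x, fderiv ℝ ρ x (A x) ∂μ = 0)
    (hH : Measurable H) (hHl : LocallyIntegrable H μ)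
    (heq : ∀ ψ : V → ℝ, ContDiff ℝ 1 ψ → HasCompactSupport ψ →
      ∫ x, H x * fderiv ℝ ψ x (A x) ∂μ = -∫ x, G x * ψ x ∂μ)
    (hc : 0 ≤ c) (hδ : 0 < δ) (hk : IsMollifier μ c δ k) (x : V) :
    ‖fderiv ℝ (k ⋆[ContinuousLinearMap.lsmul ℝ ℝ, μ] H) x (A x)
        - (k ⋆[ContinuousLinearMap.lsmul ℝ ℝ, μ] G) x‖ₑ
      ≤ ENNReal.ofReal (c * K) * meanOsc μ H δ x := by
  have hk1 : ContDiff ℝ 1 k := hk.contDiff.of_le (by simp)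
  have hDc : Continuous (fderiv ℝ k) := hk1.continuous_fderiv (by simp)
  have hDs : HasCompactSupport (fderiv ℝ k) := hk.hasCompactSupport.fderiv (𝕜 := ℝ)
  have hAc := hA.continuous
  -- the function `y ↦ k (x - y)` as a test function
  set ψ : V → ℝ := fun y => k (x - y)
  have hψv : ∀ y, ψ y = k (x - y) := fun _ => rfl
  have hψs : ContDiff ℝ ((⊤ : ℕ∞) : WithTop ℕ∞) ψ :=
    hk.contDiff.comp (contDiff_const.sub contDiff_id)
  have hψc : HasCompactSupport ψ :=
    hk.hasCompactSupport.comp_homeomorph (Homeomorph.subLeft x)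
  have hψD : ∀ y v, fderiv ℝ ψ y v = -fderiv ℝ k (x - y) v := by
    intro y v
    have h1 : HasFDerivAt (fun y => x - y) (-ContinuousLinearMap.id ℝ V) y :=
      (hasFDerivAt_id y).const_sub x
    have h2 := ((hk1.differentiable (by simp) (x - y)).hasFDerivAt.comp y h1).fderiv
    have h3 : fderiv ℝ ψ y = (fderiv ℝ k (x - y)).comp (-ContinuousLinearMap.id ℝ V) := h2
    rw [h3]; simp
  have hw : ∫ t, H (x - t) * fderiv ℝ k t (A (x - t)) ∂μ
      = (k ⋆[ContinuousLinearMap.lsmul ℝ ℝ, μ] G) x := by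
    have h := heq ψ (hψs.of_le (by simp)) hψc
    rw [← integral_sub_left_eq_self _ μ x] at h
    rw [← integral_sub_left_eq_self (fun y => G y * ψ y) μ x] at h
    simp only [hψD, hψv, sub_sub_cancel, mul_neg, integral_neg, neg_inj] at h
    rw [h, convolution_def]
    refine integral_congr_ae (Eventually.of_forall fun t => ?_)
    simp [mul_comm]
  have hd : ∫ t, fderiv ℝ k t (A (x - t)) ∂μ = 0 := by
    have h := hdiv ψ hψs hψc
    rw [← integral_sub_left_eq_self _ μ x] at h
    simpa only [hψD, sub_sub_cancel, integral_neg, neg_eq_zero] using h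
  have hDH : fderiv ℝ (k ⋆[ContinuousLinearMap.lsmul ℝ ℝ, μ] H) x (A x)
      = ∫ t, H (x - t) * fderiv ℝ k t (A x) ∂μ := by
    rw [(hk.hasCompactSupport.hasFDerivAt_convolution_left _ hk1 hHl x).fderiv, convolution_def]
    have hintg := hDs.convolutionExists_left
      ((ContinuousLinearMap.lsmul ℝ ℝ).precompL V) hDc hHl x
    rw [ContinuousLinearMap.integral_apply hintg]
    refine integral_congr_ae (Eventually.of_forall fun t => ?_)
    simp [ContinuousLinearMap.precompL_apply, mul_comm]
  have hintg : ∀ g : V → V, Continuous g →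
      Integrable (fun t => fderiv ℝ k t (g t)) μ ∧
      Integrable (fun t => H (x - t) * fderiv ℝ k t (g t)) μ := by
    intro g hg
    have hgc : Continuous fun t => fderiv ℝ k t (g t) := by fun_prop
    have hgs : HasCompactSupport fun t => fderiv ℝ k t (g t) :=
      hDs.mono' fun t ht => subset_tsupport _ fun h0 => ht (by simp [h0])
    refine ⟨hgc.integrable_of_hasCompactSupport hgs, ?_⟩
    have := hgs.convolutionExists_left (ContinuousLinearMap.lsmul ℝ ℝ) hgc hHl x
    refine this.integrable.congr (Eventually.of_forall fun t => ?_)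
    simp [mul_comm]
  have hc1 : Continuous fun _ : V => A x := continuous_const
  have hc2 : Continuous fun t => A (x - t) := by fun_prop
  have key : fderiv ℝ (k ⋆[ContinuousLinearMap.lsmul ℝ ℝ, μ] H) x (A x)
      - (k ⋆[ContinuousLinearMap.lsmul ℝ ℝ, μ] G) x
      = ∫ t, (H (x - t) - H x) * fderiv ℝ k t (A x - A (x - t)) ∂μ := by
    have e : ∀ t, (H (x - t) - H x) * fderiv ℝ k t (A x - A (x - t))
        = (H (x - t) * fderiv ℝ k t (A x) - H (x - t) * fderiv ℝ k t (A (x - t)))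
          - H x * (fderiv ℝ k t (A x) - fderiv ℝ k t (A (x - t))) := by
      intro t; rw [map_sub]; ring
    simp only [e]
    have i1 : Integrable (fun t => H (x - t) * fderiv ℝ k t (A x)
        - H (x - t) * fderiv ℝ k t (A (x - t))) μ := (hintg _ hc1).2.sub (hintg _ hc2).2
    have i2 : Integrable (fun t => H x * (fderiv ℝ k t (A x) - fderiv ℝ k t (A (x - t)))) μ :=
      ((hintg _ hc1).1.sub (hintg _ hc2).1).const_mul _
    rw [integral_sub i1 i2, integral_sub (hintg _ hc1).2 (hintg _ hc2).2, integral_const_mul,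
      integral_sub (hintg _ hc1).1 (hintg _ hc2).1, hd, integral_fderiv_apply_const hk1
      hk.hasCompactSupport, hw, hDH]
    simp
  rw [key]
  refine enorm_integral_le_meanOsc hH (by positivity) hδ
    (fun t ht => by simp [hk.fderiv_eq_zero t ht]) fun t ht => ?_
  have ht' : ‖t‖ ≤ δ := by simpa using ht
  have h1 : ‖A x - A (x - t)‖ ≤ K * δ := by
    have := hA.norm_sub_le x (x - t)
    rw [sub_sub_cancel] at this
    exact this.trans (mul_le_mul_of_nonneg_left ht' K.2)
  have h2 : ‖fderiv ℝ k t (A x - A (x - t))‖ ≤ c * K * (δ ^ Module.finrank ℝ V)⁻¹ := by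
    refine (ContinuousLinearMap.le_opNorm _ _).trans ?_
    refine (mul_le_mul (hk.norm_fderiv_le t) h1 (norm_nonneg _) (by positivity)).trans (le_of_eq ?_)
    field_simp
  rw [norm_mul, mul_comm]
  exact mul_le_mul_of_nonneg_right h2 (norm_nonneg _)

/-- The formal choice `ζ H` is not an admissible test function, so the mollified `ζ H_δ` is used. In
the product rule the term with the derivative of `H_δ` equals the mollified source up to a
commutator. That commutator vanishes in the limit, and the source then appears twice, whence the
factor `2`. -/
theorem integral_sq_mul_fderiv_of_weak (hA : LipschitzWith K A)
    (hdiv : ∀ ρ : V → ℝ, ContDiff ℝ ((⊤ : ℕ∞) : WithTop ℕ∞) ρ → HasCompactSupport ρ →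
      ∫ x, fderiv ℝ ρ x (A x) ∂μ = 0)
    (hH : Measurable H) (hG : Measurable G)
    (hH2 : ∀ R : ℝ, MemLp H 2 (μ.restrict (Metric.closedBall 0 R)))
    (hG2 : ∀ R : ℝ, MemLp G 2 (μ.restrict (Metric.closedBall 0 R)))
    (heq : ∀ ψ : V → ℝ, ContDiff ℝ 1 ψ → HasCompactSupport ψ →
      ∫ x, H x * fderiv ℝ ψ x (A x) ∂μ = -∫ x, G x * ψ x ∂μ)
    {ζ : V → ℝ} (hζ : ContDiff ℝ 1 ζ) (hζc : HasCompactSupport ζ) :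
    ∫ x, H x ^ 2 * fderiv ℝ ζ x (A x) ∂μ = -(2 * ∫ x, G x * H x * ζ x ∂μ) := by
  obtain ⟨c, hc, k, hk⟩ := exists_isMollifier μ
  have hHl := locallyIntegrable_of_memLp_two_closedBall hH2
  have hGl := locallyIntegrable_of_memLp_two_closedBall hG2
  have hAc := hA.continuous
  have hDc : Continuous (fderiv ℝ ζ) := hζ.continuous_fderiv (by simp)
  have hDA : Continuous fun x => fderiv ℝ ζ x (A x) := by fun_prop
  have hDAs : HasCompactSupport fun x => fderiv ℝ ζ x (A x) :=
    (hζc.fderiv (𝕜 := ℝ)).mono' fun t ht => subset_tsupport _ fun h0 => ht (by simp [h0])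
  set Hd : ℝ → V → ℝ := fun δ => k δ ⋆[ContinuousLinearMap.lsmul ℝ ℝ, μ] H with hHd
  set Gd : ℝ → V → ℝ := fun δ => k δ ⋆[ContinuousLinearMap.lsmul ℝ ℝ, μ] G with hGd
  have hHd1 : ∀ δ, 0 < δ → ContDiff ℝ 1 (Hd δ) := fun δ hδ =>
    (hk δ hδ).hasCompactSupport.contDiff_convolution_left (n := 1) _
      ((hk δ hδ).contDiff.of_le (by simp)) hHl
  have hGd1 : ∀ δ, 0 < δ → ContDiff ℝ 1 (Gd δ) := fun δ hδ =>
    (hk δ hδ).hasCompactSupport.contDiff_convolution_left (n := 1) _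
      ((hk δ hδ).contDiff.of_le (by simp)) hGl
  have hHdA : ∀ δ, 0 < δ → Continuous fun x => fderiv ℝ (Hd δ) x (A x) := fun δ hδ => by
    have := (hHd1 δ hδ).continuous_fderiv (by simp); fun_prop
  obtain ⟨a1, R1, ha1⟩ := memLp_two_mul_of_hasCompactSupport hH hH2 hζ.continuous hζc
  obtain ⟨a2, R2, ha2⟩ := memLp_two_mul_of_hasCompactSupport hH hH2 hDA hDAs
  obtain ⟨a3, R3, ha3⟩ := memLp_two_mul_of_hasCompactSupport hG hG2 hζ.continuous hζc
  have m1 : Measurable fun x => H x * ζ x := hH.mul hζ.continuous.measurable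
  have m2 : Measurable fun x => H x * fderiv ℝ ζ x (A x) := hH.mul hDA.measurable
  have m3 : Measurable fun x => G x * ζ x := hG.mul hζ.continuous.measurable
  have T1 := tendsto_integral_mul_of_meanOsc (f := fun _ => 0)
    (F := fun δ x => fderiv ℝ (Hd δ) x (A x) - Gd δ x) m1 hH a1 ha1 hH2 measurable_const
    (fun δ hδ => (hHdA δ hδ).sub (hGd1 δ hδ).continuous) (c := ENNReal.ofReal (c * K))
    ENNReal.ofReal_ne_top (fun δ hδ _ x _ => by
      simpa using enorm_commutator_le hA hdiv hH hHl heq hc hδ (hk δ hδ) x)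
  have T2 := tendsto_integral_mul_of_meanOsc (F := Gd) m1 hG a1 ha1 hG2 hG
    (fun δ hδ => (hGd1 δ hδ).continuous) (c := ENNReal.ofReal c)
    ENNReal.ofReal_ne_top (fun δ hδ _ x _ => enorm_convolution_sub_le hG hGl hc hδ (hk δ hδ) x)
  have T3 := tendsto_integral_mul_of_meanOsc (F := Hd) m2 hH a2 ha2 hH2 hH
    (fun δ hδ => (hHd1 δ hδ).continuous) (c := ENNReal.ofReal c)
    ENNReal.ofReal_ne_top (fun δ hδ _ x _ => enorm_convolution_sub_le hH hHl hc hδ (hk δ hδ) x)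
  have T4 := tendsto_integral_mul_of_meanOsc (F := Hd) m3 hH a3 ha3 hH2 hH
    (fun δ hδ => (hHd1 δ hδ).continuous) (c := ENNReal.ofReal c)
    ENNReal.ofReal_ne_top (fun δ hδ _ x _ => enorm_convolution_sub_le hH hHl hc hδ (hk δ hδ) x)
  have hI : ∀ (b g F : V → ℝ), LocallyIntegrable b μ → Continuous g → HasCompactSupport g →
      Continuous F → Integrable (fun x => b x * g x * F x) μ := by
    intro b g F hb hg hgc hF
    refine (hb.integrable_smul_left_of_hasCompactSupport (hg.mul hF) hgc.mul_right).congr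
      (Eventually.of_forall fun x => ?_)
    simp; ring
  -- The weak equation tested with `ζ H_δ`, with the mollified source added and subtracted to
  -- isolate the commutator.
  have E : ∀ᶠ δ : ℝ in 𝓝[>] 0,
      (∫ x, H x * ζ x * (fderiv ℝ (Hd δ) x (A x) - Gd δ x) ∂μ) + (∫ x, H x * ζ x * Gd δ x ∂μ)
        + ∫ x, H x * fderiv ℝ ζ x (A x) * Hd δ x ∂μ = -∫ x, G x * ζ x * Hd δ x ∂μ := by
    filter_upwards [(eventually_mem_nhdsWithin : ∀ᶠ δ : ℝ in 𝓝[>] 0, δ ∈ Ioi (0 : ℝ))] with δ hδ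
    have h1 := hHd1 δ hδ
    have hw := heq (fun x => ζ x * Hd δ x) (hζ.mul h1) hζc.mul_right
    have hF : ∀ x, fderiv ℝ (fun x => ζ x * Hd δ x) x (A x)
        = ζ x * fderiv ℝ (Hd δ) x (A x) + Hd δ x * fderiv ℝ ζ x (A x) := by
      intro x
      rw [fderiv_fun_mul (hζ.differentiable (by simp) x) (h1.differentiable (by simp) x)]
      simp
    simp only [hF] at hw
    have i1 : Integrable (fun x => H x * ζ x * (fderiv ℝ (Hd δ) x (A x) - Gd δ x)) μ :=
      hI _ _ _ hHl hζ.continuous hζc ((hHdA δ hδ).sub (hGd1 δ hδ).continuous)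
    have i2 : Integrable (fun x => H x * ζ x * Gd δ x) μ :=
      hI _ _ _ hHl hζ.continuous hζc (hGd1 δ hδ).continuous
    have i3 : Integrable (fun x => H x * fderiv ℝ ζ x (A x) * Hd δ x) μ :=
      hI _ _ _ hHl hDA hDAs h1.continuous
    have i12 : Integrable (fun x => H x * ζ x * (fderiv ℝ (Hd δ) x (A x) - Gd δ x)
        + H x * ζ x * Gd δ x) μ := i1.add i2
    rw [← integral_add i1 i2, ← integral_add i12 i3]
    calc _ = _ := by congr 1; ext x; ring
      _ = _ := hw
      _ = _ := by congr 2; ext x; ring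
  have L := tendsto_nhds_unique (((T1.add T2).add T3).congr' E) T4.neg
  have e1 : ∫ x, H x ^ 2 * fderiv ℝ ζ x (A x) ∂μ = ∫ x, H x * fderiv ℝ ζ x (A x) * H x ∂μ := by
    congr 1; ext x; ring
  have e2 : ∫ x, H x * ζ x * G x ∂μ = ∫ x, G x * H x * ζ x ∂μ := by congr 1; ext x; ring
  have e3 : ∫ x, G x * ζ x * H x ∂μ = ∫ x, G x * H x * ζ x ∂μ := by congr 1; ext x; ring
  rw [e2, e3] at L
  simp only [mul_zero, integral_zero] at L
  rw [e1]; linarith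

end commutator

end renorm

/-! ### Averages of continuously differentiable functions -/

section angle

set_option linter.unusedSectionVars false

variable {X : Type*} [NormedAddCommGroup X] [NormedSpace ℝ X] [FiniteDimensional ℝ X]
  {Z : Type*} [NormedAddCommGroup Z] [NormedSpace ℝ Z]

lemma integral_gyroMeasure_Icc (f : ℝ → Z) :
    ∫ α, f α ∂gyroMeasure = (1 / (2 * Real.pi)) • ∫ α in Icc (0 : ℝ) (2 * Real.pi), f α := by
  rw [gyroMeasure, integral_smul_measure, ENNReal.toReal_ofReal (by positivity),
    integral_Icc_eq_integral_Ioc]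

lemma ae_gyroMeasure_mem_Icc : ∀ᵐ α ∂gyroMeasure, α ∈ Icc (0 : ℝ) (2 * Real.pi) := by
  refine Measure.ae_smul_measure ?_ _
  filter_upwards [ae_restrict_mem measurableSet_Ioc] with α hα
  exact Ioc_subset_Icc_self hα

lemma integrable_gyroMeasure_of_continuous {f : ℝ → Z} (hf : Continuous f) :
    Integrable f gyroMeasure :=
  (hf.integrableOn_Ioc (a := 0) (b := 2 * Real.pi)).smul_measure ENNReal.ofReal_ne_top

lemma continuous_integral_gyroMeasure {F : X → ℝ → Z} (hF : Continuous (Function.uncurry F)) :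
    Continuous fun x => ∫ α, F x α ∂gyroMeasure := by
  simp only [integral_gyroMeasure_Icc]
  have : ProperSpace X := FiniteDimensional.proper_real X
  exact (continuous_parametric_integral_of_continuous hF isCompact_Icc).const_smul _

variable {T : ℝ → X →L[ℝ] X} {u : X → ℝ}

lemma hasFDerivAt_angleAvg (hT : Continuous T) (hu : ContDiff ℝ 1 u) (x : X) :
    HasFDerivAt (fun x => ∫ α, u (T α x) ∂gyroMeasure)
      (∫ α, (fderiv ℝ u (T α x)).comp (T α) ∂gyroMeasure) x := by
  have : ProperSpace X := FiniteDimensional.proper_real X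
  have hD : Continuous (fderiv ℝ u) := hu.continuous_fderiv (by simp)
  have hc : Continuous fun a : X × ℝ => (fderiv ℝ u (T a.2 a.1)).comp (T a.2) := by fun_prop
  obtain ⟨C, hC⟩ := ((isCompact_closedBall x 1).prod
    (isCompact_Icc (a := (0 : ℝ)) (b := 2 * Real.pi))).exists_bound_of_continuousOn hc.continuousOn
  have huc := hu.continuous
  refine hasFDerivAt_integral_of_dominated_of_fderiv_le (bound := fun _ => C)
    (F' := fun x α => (fderiv ℝ u (T α x)).comp (T α)) (Metric.ball_mem_nhds x one_pos)
    (Eventually.of_forall fun y => ?_) ?_ ?_ ?_ (integrable_const C) ?_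
  · exact Continuous.aestronglyMeasurable (by fun_prop)
  · exact integrable_gyroMeasure_of_continuous (by fun_prop)
  · exact Continuous.aestronglyMeasurable (by fun_prop)
  · filter_upwards [ae_gyroMeasure_mem_Icc] with α hα y hy
    exact hC (y, α) ⟨Metric.ball_subset_closedBall hy, hα⟩
  · refine Eventually.of_forall fun α y _ => ?_
    exact ((hu.differentiable (by simp) _).hasFDerivAt).comp y (T α).hasFDerivAt

lemma fderiv_angleAvg (hT : Continuous T) (hu : ContDiff ℝ 1 u) (x w : X) :
    fderiv ℝ (fun x => ∫ α, u (T α x) ∂gyroMeasure) x w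
      = ∫ α, fderiv ℝ u (T α x) (T α w) ∂gyroMeasure := by
  have hD : Continuous (fderiv ℝ u) := hu.continuous_fderiv (by simp)
  rw [(hasFDerivAt_angleAvg hT hu x).fderiv, ContinuousLinearMap.integral_apply]
  · rfl
  · exact integrable_gyroMeasure_of_continuous (by fun_prop)

lemma contDiff_angleAvg (hT : Continuous T) (hu : ContDiff ℝ 1 u) :
    ContDiff ℝ 1 fun x => ∫ α, u (T α x) ∂gyroMeasure := by
  have hD : Continuous (fderiv ℝ u) := hu.continuous_fderiv (by simp)
  rw [contDiff_one_iff_fderiv]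
  refine ⟨fun x => (hasFDerivAt_angleAvg hT hu x).differentiableAt, ?_⟩
  have : fderiv ℝ (fun x => ∫ α, u (T α x) ∂gyroMeasure)
      = fun x => ∫ α, (fderiv ℝ u (T α x)).comp (T α) ∂gyroMeasure :=
    funext fun x => (hasFDerivAt_angleAvg hT hu x).fderiv
  rw [this]
  exact continuous_integral_gyroMeasure (F := fun x α => (fderiv ℝ u (T α x)).comp (T α))
    (by unfold Function.uncurry; fun_prop)

end angle

lemma continuous_larmorCLM (ω : ℝ) : Continuous (larmorCLM ω) := by
  refine continuous_clm_apply.2 fun p => ?_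
  simp only [larmorCLM_apply]
  have := continuous_larmor ω
  exact this.comp (f := fun a : ℝ => (a, p)) (by fun_prop)

/-- Periodicity reduces to angles in a compact interval, on which the operator norm is bounded. -/
lemma exists_norm_larmor_le (ω : ℝ) :
    ∃ C : ℝ≥0, ∀ α p, ‖larmor ω α p‖ ≤ C * ‖p‖ := by
  obtain ⟨C, hC⟩ := (isCompact_Icc (a := (0 : ℝ)) (b := 2 * Real.pi)).exists_bound_of_continuousOn
    (continuous_larmorCLM ω).continuousOn
  refine ⟨C.toNNReal, fun α p => ?_⟩
  obtain ⟨β, hβ, hβ'⟩ := (larmor_periodic ω p).exists_mem_Ico₀ Real.two_pi_pos α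
  rw [hβ']
  refine ((larmorCLM ω β).le_opNorm p).trans ?_
  exact mul_le_mul_of_nonneg_right ((hC β (Ico_subset_Icc_self hβ)).trans (Real.le_coe_toNNReal C))
    (norm_nonneg _)

lemma lipschitzWith_gyroAvg (ω : ℝ) {u : Phase → ℝ} {K : ℝ≥0} (hu : LipschitzWith K u) :
    ∃ K', LipschitzWith K' (gyroAvg ω u) := by
  obtain ⟨C, hC⟩ := exists_norm_larmor_le ω
  have hi : ∀ p, Integrable (fun α => u (larmor ω α p)) gyroMeasure := fun p => by
    refine integrable_gyroMeasure_of_continuous ?_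
    have := (continuous_larmor ω).comp (f := fun a : ℝ => (a, p)) (by fun_prop)
    exact hu.continuous.comp this
  refine ⟨K * C, LipschitzWith.of_dist_le_mul fun p p' => ?_⟩
  rw [Real.dist_eq, gyroAvg_eq, gyroAvg_eq, ← integral_sub (hi p) (hi p')]
  have := norm_integral_le_of_norm_le_const (μ := gyroMeasure) (C := K * C * dist p p')
    (f := fun α => u (larmor ω α p) - u (larmor ω α p')) (Eventually.of_forall fun α => ?_)
  · simpa using this
  · rw [← dist_eq_norm]
    refine (hu.dist_le_mul _ _).trans ?_
    rw [mul_assoc]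
    refine mul_le_mul_of_nonneg_left ?_ K.2
    rw [dist_eq_norm, ← larmorCLM_apply, ← larmorCLM_apply, ← map_sub, dist_eq_norm]
    exact hC α _

/-! ### Integration by parts for divergence free fields -/

instance : (volume : Measure Phase).IsAddHaarMeasure :=
  Measure.prod.instIsAddHaarMeasure volume volume

instance : (volume : Measure (ℝ × Phase)).IsAddHaarMeasure :=
  Measure.prod.instIsAddHaarMeasure volume volume

section ibp

variable {V : Type*} [NormedAddCommGroup V] [NormedSpace ℝ V] [FiniteDimensional ℝ V]
  [MeasurableSpace V] [BorelSpace V] {μ : Measure V} [μ.IsAddHaarMeasure]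

/-- Integration by parts along a direction in which `f` is constant; no regularity of `f` beyond
continuity is required. -/
lemma integral_mul_fderiv_of_invariant {f ρ : V → ℝ} {v : V} (hf : Continuous f)
    (hv : ∀ x (t : ℝ), f (x + t • v) = f x) (hρ : ContDiff ℝ 1 ρ) (hρc : HasCompactSupport ρ) :
    ∫ x, f x * fderiv ℝ ρ x v ∂μ = 0 := by
  have hD : Continuous fun x => fderiv ℝ ρ x v := by
    have := hρ.continuous_fderiv (by simp); fun_prop
  have h := integral_bilinear_hasLineDerivAt_right_eq_neg_left_of_integrable (μ := μ) (f := f)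
    (f' := fun _ => 0) (g := ρ) (g' := fun x => fderiv ℝ ρ x v) (v := v)
    (B := ContinuousLinearMap.mul ℝ ℝ) (by simp)
    ((hf.mul hD).integrable_of_hasCompactSupport (hρc.fderiv_apply ℝ v).mul_left)
    ((hf.mul hρ.continuous).integrable_of_hasCompactSupport hρc.mul_left)
    (fun x _ => by
      simp only [HasLineDerivAt, hv]
      exact hasDerivAt_const _ _)
    (fun x _ => (hρ.differentiable (by simp) x).hasFDerivAt.hasLineDerivAt v)
  simpa using h

/-- As `f` is only `C¹`, its mixed derivatives are not available. Both derivatives are moved to `ρ`,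
whose second derivative is symmetric. This is the weak form of the fact that a rotated gradient is
divergence free. -/
lemma integral_fderiv_mul_fderiv_comm {f ρ : V → ℝ} {v w : V} (hf : ContDiff ℝ 1 f)
    (hρ : ContDiff ℝ ((⊤ : ℕ∞) : WithTop ℕ∞) ρ) (hρc : HasCompactSupport ρ) :
    ∫ x, fderiv ℝ f x v * fderiv ℝ ρ x w ∂μ = ∫ x, fderiv ℝ f x w * fderiv ℝ ρ x v ∂μ := by
  have hDf : Continuous (fderiv ℝ f) := hf.continuous_fderiv (by simp)
  have hle : (2 : WithTop ℕ∞) ≤ ((⊤ : ℕ∞) : WithTop ℕ∞) := by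
    exact WithTop.coe_le_coe.2 (le_top : (2 : ℕ∞) ≤ ⊤)
  have hDρ : ContDiff ℝ 1 (fderiv ℝ ρ) :=
    hρ.fderiv_right (m := 1) (by rwa [one_add_one_eq_two])
  have hDw : ∀ w, ContDiff ℝ 1 fun x => fderiv ℝ ρ x w := fun w => hDρ.clm_apply contDiff_const
  have key : ∀ v w, ∫ x, fderiv ℝ f x v * fderiv ℝ ρ x w ∂μ
      = -∫ x, f x * fderiv ℝ (fderiv ℝ ρ) x v w ∂μ := by
    intro v w
    have hcs : HasCompactSupport fun x => fderiv ℝ ρ x w := hρc.fderiv_apply ℝ w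
    have hDD : Continuous fun x => fderiv ℝ (fun x => fderiv ℝ ρ x w) x v := by
      have := (hDw w).continuous_fderiv (by simp); fun_prop
    have h := integral_mul_fderiv_eq_neg_fderiv_mul_of_integrable (μ := μ)
      (f := f) (g := fun x => fderiv ℝ ρ x w) (v := v)
      (Continuous.integrable_of_hasCompactSupport
        (by have := (hDw w).continuous; fun_prop) hcs.mul_left)
      ((hf.continuous.mul hDD).integrable_of_hasCompactSupport (hcs.fderiv_apply ℝ v).mul_left)
      ((hf.continuous.mul (hDw w).continuous).integrable_of_hasCompactSupport hcs.mul_left)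
      (fun x _ => hf.differentiable (by simp) x) (fun x _ => (hDw w).differentiable (by simp) x)
    have e : ∀ x, fderiv ℝ (fun x => fderiv ℝ ρ x w) x v = fderiv ℝ (fderiv ℝ ρ) x v w := by
      intro x
      have := ((hDρ.differentiable (by simp) x).hasFDerivAt.clm_apply
        (hasFDerivAt_const w x)).fderiv
      rw [this]; simp
    simp only [e] at h
    rw [h, neg_neg]
  rw [key, key]
  congr 2
  ext x
  rw [(hρ.contDiffAt.isSymmSndFDerivAt (by simpa using hle)) v w]

end ibp

/-! ### The limit field of a regular electric field -/

/-- The third velocity direction. -/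
def axisV : Phase := (0, EuclideanSpace.single 2 1)

/-- The `i`th position direction. -/
def dirX (i : Fin 3) : Phase := (EuclideanSpace.single i 1, 0)

lemma limitField_eq_sum (m q B : ℝ) (E : R3 → R3) (p : Phase) :
    limitField m q B E p
      = (B⁻¹ * gyroAvg (omegaC m q B) (fun p' => E p'.1 1) p) • dirX 0
        + (-B⁻¹ * gyroAvg (omegaC m q B) (fun p' => E p'.1 0) p) • dirX 1
        + p.2 2 • dirX 2 + (q / m * gyroAvg (omegaC m q B) (fun p' => E p'.1 2) p) • axisV := by
  refine Prod.ext ?_ ?_ <;> apply R3.ext <;>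
    simp [limitField, dirX, axisV]

lemma limitField_congr (m q B : ℝ) {E E' : R3 → R3} (h : E =ᵐ[volume] E') :
    limitField m q B E =ᵐ[volume] limitField m q B E' := by
  have h1 : ∀ i, (fun p : Phase => E p.1 i) =ᵐ[volume] fun p => E' p.1 i := fun i => by
    have : ∀ᵐ p : Phase, E p.1 = E' p.1 := Measure.quasiMeasurePreserving_fst.ae h
    filter_upwards [this] with p hp
    rw [hp]
  have h2 := fun i => gyroAvg_congr (ω := omegaC m q B) (h1 i)
  filter_upwards [h2 0, h2 1, h2 2] with p h0 h1 h2
  simp only [limitField, h0, h1, h2]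

/-- `Ψ` is a bounded potential of the Lipschitz field `E`. -/
structure IsRegularPotential (Ψ : R3 → ℝ) (E : R3 → R3) (K : ℝ≥0) (C : ℝ) : Prop where
  abs_le : ∀ x, |Ψ x| ≤ C
  lipschitz : ∀ i, LipschitzWith K fun x => E x i
  hasFDerivAt : ∀ x, HasFDerivAt Ψ (-∑ i, E x i • (EuclideanSpace.proj i : R3 →L[ℝ] ℝ)) x

namespace IsRegularPotential

variable {Ψ : R3 → ℝ} {E : R3 → R3} {K : ℝ≥0} {C : ℝ}

lemma lipschitz_fst (h : IsRegularPotential Ψ E K C) (i : Fin 3) :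
    LipschitzWith K fun p : Phase => E p.1 i := by
  have := (h.lipschitz i).comp (LipschitzWith.prod_fst (α := R3) (β := R3))
  rwa [mul_one] at this

lemma exists_lipschitz_gyroAvg (h : IsRegularPotential Ψ E K C) (ω : ℝ) (i : Fin 3) :
    ∃ K', LipschitzWith K' (gyroAvg ω fun p => E p.1 i) :=
  lipschitzWith_gyroAvg ω (h.lipschitz_fst i)

lemma contDiff (h : IsRegularPotential Ψ E K C) : ContDiff ℝ 1 Ψ := by
  rw [contDiff_one_iff_fderiv]
  refine ⟨fun x => (h.hasFDerivAt x).differentiableAt, ?_⟩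
  have : fderiv ℝ Ψ = fun x => -∑ i, E x i • (EuclideanSpace.proj i : R3 →L[ℝ] ℝ) :=
    funext fun x => (h.hasFDerivAt x).fderiv
  rw [this]
  exact (continuous_finsetSum _ fun i _ =>
    (h.lipschitz i).continuous.smul continuous_const).neg

lemma contDiff_fst (h : IsRegularPotential Ψ E K C) : ContDiff ℝ 1 fun p : Phase => Ψ p.1 :=
  h.contDiff.comp _root_.contDiff_fst

lemma fderiv_fst (h : IsRegularPotential Ψ E K C) (p w : Phase) :
    fderiv ℝ (fun p : Phase => Ψ p.1) p w = -∑ i, E p.1 i * w.1 i := by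
  have := ((h.hasFDerivAt p.1).comp p (hasFDerivAt_fst (𝕜 := ℝ) (E := R3) (F := R3))).fderiv
  have e : fderiv ℝ (fun p : Phase => Ψ p.1) p
    = (-∑ i, E p.1 i • (EuclideanSpace.proj i : R3 →L[ℝ] ℝ)).comp
      (ContinuousLinearMap.fst ℝ R3 R3) := this
  rw [e]
  simp

/-- The average of the potential. -/
def avgPot (ω : ℝ) (Ψ : R3 → ℝ) : Phase → ℝ := gyroAvg ω fun p => Ψ p.1

lemma avgPot_eq (ω : ℝ) (Ψ : R3 → ℝ) :
    avgPot ω Ψ = fun p => ∫ α, (fun p : Phase => Ψ p.1) (larmorCLM ω α p) ∂gyroMeasure :=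
  funext fun p => gyroAvg_eq ω _ p

lemma contDiff_avgPot (h : IsRegularPotential Ψ E K C) (ω : ℝ) : ContDiff ℝ 1 (avgPot ω Ψ) := by
  rw [avgPot_eq]
  exact contDiff_angleAvg (continuous_larmorCLM ω) h.contDiff_fst

lemma abs_avgPot_le (h : IsRegularPotential Ψ E K C) (ω : ℝ) (p : Phase) :
    |avgPot ω Ψ p| ≤ C := by
  rw [avgPot_eq]
  have := norm_integral_le_of_norm_le_const (μ := gyroMeasure) (C := C)
    (f := fun α => Ψ (larmorCLM ω α p).1) (Eventually.of_forall fun α => h.abs_le _)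
  simpa using this

lemma fderiv_avgPot (h : IsRegularPotential Ψ E K C) (ω : ℝ) (p w : Phase) :
    fderiv ℝ (avgPot ω Ψ) p w
      = ∫ α, -∑ i, E (larmor ω α p).1 i * (larmor ω α w).1 i ∂gyroMeasure := by
  rw [avgPot_eq, fderiv_angleAvg (continuous_larmorCLM ω) h.contDiff_fst]
  simp only [h.fderiv_fst, larmorCLM_apply]

/-- The linear flow fixes the position directions, so the spatial gradient commutes with the
average. -/
lemma fderiv_avgPot_dirX (h : IsRegularPotential Ψ E K C) (ω : ℝ) (p : Phase) (i : Fin 3) :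
    fderiv ℝ (avgPot ω Ψ) p (dirX i) = -gyroAvg ω (fun p => E p.1 i) p := by
  have e : ∀ α, larmor ω α (dirX i) = dirX i := fun α => by
    refine Prod.ext ?_ ?_ <;> apply R3.ext <;> simp [larmor, dirX]
  rw [h.fderiv_avgPot, gyroAvg_eq, ← integral_neg]
  congr 1
  ext α
  rw [e]
  simp [dirX]

lemma fderiv_avgPot_axisV (h : IsRegularPotential Ψ E K C) (ω : ℝ) (p : Phase) :
    fderiv ℝ (avgPot ω Ψ) p axisV = 0 := by
  have e : ∀ α, larmor ω α axisV = axisV := fun α => by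
    refine Prod.ext ?_ ?_ <;> apply R3.ext <;> simp [larmor, axisV]
  rw [h.fderiv_avgPot]
  simp only [e]
  simp [axisV]

lemma exists_lipschitz_limitField (h : IsRegularPotential Ψ E K C) (m q B : ℝ) :
    ∃ K', LipschitzWith K' (limitField m q B E) := by
  obtain ⟨K0, h0⟩ := h.exists_lipschitz_gyroAvg (omegaC m q B) 0
  obtain ⟨K1, h1⟩ := h.exists_lipschitz_gyroAvg (omegaC m q B) 1
  obtain ⟨K2, h2⟩ := h.exists_lipschitz_gyroAvg (omegaC m q B) 2
  have hs : ∀ {f : Phase → ℝ} {K : ℝ≥0} (_ : LipschitzWith K f) (c : ℝ) (v : Phase),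
      ∃ K', LipschitzWith K' fun p => (c * f p) • v := fun {f K} hf c v =>
    ⟨_, ((c • (1 : ℝ →L[ℝ] ℝ)).smulRight v).lipschitz.comp hf⟩
  have hv : LipschitzWith ‖(EuclideanSpace.proj 2 : R3 →L[ℝ] ℝ).comp
      (ContinuousLinearMap.snd ℝ R3 R3)‖₊ fun p : Phase => p.2 2 :=
    ((EuclideanSpace.proj 2 : R3 →L[ℝ] ℝ).comp (ContinuousLinearMap.snd ℝ R3 R3)).lipschitz
  obtain ⟨L1, l1⟩ := hs h1 B⁻¹ (dirX 0)
  obtain ⟨L2, l2⟩ := hs h0 (-B⁻¹) (dirX 1)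
  obtain ⟨L3, l3⟩ := hs hv 1 (dirX 2)
  obtain ⟨L4, l4⟩ := hs h2 (q / m) axisV
  refine ⟨L1 + L2 + L3 + L4, ?_⟩
  have := ((l1.add l2).add l3).add l4
  simp only [one_mul] at this
  have e : limitField m q B E = _ := funext (limitField_eq_sum m q B E)
  rw [e]
  exact this

/-- The perpendicular drift is a rotated gradient of the averaged potential, so its two
contributions cancel by symmetry of mixed derivatives. The other components, `1`, `v₃` and `⟨E₃⟩`,
do not depend on the variable in which they differentiate. -/
lemma integral_fderiv_limitField (h : IsRegularPotential Ψ E K C) (m q B : ℝ)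
    {ρ : ℝ × Phase → ℝ} (hρ : ContDiff ℝ ((⊤ : ℕ∞) : WithTop ℕ∞) ρ) (hρc : HasCompactSupport ρ) :
    ∫ z, fderiv ℝ ρ z (1, limitField m q B E z.2) = 0 := by
  set ω := omegaC m q B
  have hρ1 : ContDiff ℝ 1 ρ := hρ.of_le (by simp)
  have hD : Continuous (fderiv ℝ ρ) := hρ1.continuous_fderiv (by simp)
  have hcont : ∀ i, Continuous (gyroAvg ω fun p => E p.1 i) := fun i =>
    (h.exists_lipschitz_gyroAvg ω i).choose_spec.continuous
  have hI : ∀ (f : ℝ × Phase → ℝ) (v : ℝ × Phase), Continuous f →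
      Integrable fun z => f z * fderiv ℝ ρ z v := fun f v hf =>
    Continuous.integrable_of_hasCompactSupport (by fun_prop) (hρc.fderiv_apply ℝ v).mul_left
  have hΦ1 : ContDiff ℝ 1 fun z : ℝ × Phase => avgPot ω Ψ z.2 :=
    (h.contDiff_avgPot ω).comp contDiff_snd
  have hΦD : ∀ (z : ℝ × Phase) (w : Phase), fderiv ℝ (fun z : ℝ × Phase => avgPot ω Ψ z.2) z (0, w)
      = fderiv ℝ (avgPot ω Ψ) z.2 w := by
    intro z w
    have e : fderiv ℝ (fun z : ℝ × Phase => avgPot ω Ψ z.2) z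
      = (fderiv ℝ (avgPot ω Ψ) z.2).comp (ContinuousLinearMap.snd ℝ ℝ Phase) :=
      (((h.contDiff_avgPot ω).differentiable (by simp) z.2).hasFDerivAt.comp z
        hasFDerivAt_snd).fderiv
    rw [e]; simp
  have comm := integral_fderiv_mul_fderiv_comm (μ := (volume : Measure (ℝ × Phase)))
    (v := (0, dirX 1)) (w := (0, dirX 0)) hΦ1 hρ hρc
  simp only [hΦD, h.fderiv_avgPot_dirX] at comm
  have t1 : ∫ z, fderiv ℝ ρ z (1, 0) = 0 := integral_fderiv_apply_const hρ1 hρc _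
  have t2 : ∫ z : ℝ × Phase, z.2.2 2 * fderiv ℝ ρ z (0, dirX 2) = 0 :=
    integral_mul_fderiv_of_invariant (by fun_prop) (fun x t => by simp [dirX]) hρ1 hρc
  have t3 : ∫ z : ℝ × Phase, gyroAvg ω (fun p => E p.1 2) z.2 * fderiv ℝ ρ z (0, axisV) = 0 := by
    refine integral_mul_fderiv_of_invariant
      (f := fun z : ℝ × Phase => gyroAvg ω (fun p => E p.1 2) z.2)
      ((hcont 2).comp continuous_snd) (fun x t => ?_) hρ1 hρc
    simp only [gyroAvg_eq]
    congr 1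
    ext α
    have : (larmor ω α (x + t • ((0 : ℝ), axisV)).2).1 = (larmor ω α x.2).1 := by
      apply R3.ext <;> simp [larmor, axisV]
    rw [this]
  have e : ∀ z, fderiv ℝ ρ z (1, limitField m q B E z.2)
      = fderiv ℝ ρ z (1, 0) + B⁻¹ * (gyroAvg ω (fun p => E p.1 1) z.2 * fderiv ℝ ρ z (0, dirX 0))
        - B⁻¹ * (gyroAvg ω (fun p => E p.1 0) z.2 * fderiv ℝ ρ z (0, dirX 1))
        + z.2.2 2 * fderiv ℝ ρ z (0, dirX 2)
        + q / m * (gyroAvg ω (fun p => E p.1 2) z.2 * fderiv ℝ ρ z (0, axisV)) := by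
    intro z
    have : ((1 : ℝ), limitField m q B E z.2) = (1, 0)
        + (B⁻¹ * gyroAvg ω (fun p => E p.1 1) z.2) • (0, dirX 0)
        + (-B⁻¹ * gyroAvg ω (fun p => E p.1 0) z.2) • (0, dirX 1)
        + z.2.2 2 • (0, dirX 2)
        + (q / m * gyroAvg ω (fun p => E p.1 2) z.2) • (0, axisV) := by
      rw [limitField_eq_sum]
      refine Prod.ext ?_ ?_ <;> simp [ω]
    rw [this]
    simp only [map_add, map_smul, smul_eq_mul]
    ring
  simp only [e]
  have i1 : Integrable fun z => fderiv ℝ ρ z (1, 0) := by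
    simpa using hI (fun _ => 1) (1, 0) continuous_const
  have i2 := (hI (fun z => gyroAvg ω (fun p => E p.1 1) z.2) (0, dirX 0)
    ((hcont 1).comp continuous_snd)).const_mul B⁻¹
  have i3 := (hI (fun z => gyroAvg ω (fun p => E p.1 0) z.2) (0, dirX 1)
    ((hcont 0).comp continuous_snd)).const_mul B⁻¹
  have i4 := hI (fun z => z.2.2 2) (0, dirX 2) (by fun_prop)
  have i5 := (hI (fun z => gyroAvg ω (fun p => E p.1 2) z.2) (0, axisV)
    ((hcont 2).comp continuous_snd)).const_mul (q / m)
  refine (integral_add (((i1.add i2).sub i3).add i4) i5).trans ?_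
  rw [integral_add' ((i1.add i2).sub i3) i4, integral_sub' (i1.add i2) i3, integral_add' i1 i2]
  simp only [integral_const_mul]
  rw [t1, t2, t3]
  simp only [neg_mul, integral_neg, neg_inj] at comm
  rw [comm]
  ring

/-- The stationary density `exp ((m |v|² / 2 + q ⟨Ψ⟩) / θ)` of the limit transport. -/
def gibbs (m q θ ω : ℝ) (Ψ : R3 → ℝ) (p : Phase) : ℝ :=
  Real.exp ((m * ‖p.2‖ ^ 2 / 2 + q * avgPot ω Ψ p) / θ)

lemma contDiff_gibbs (h : IsRegularPotential Ψ E K C) (m q θ ω : ℝ) :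
    ContDiff ℝ 1 (gibbs m q θ ω Ψ) := by
  have h1 := h.contDiff_avgPot ω
  have h2 : ContDiff ℝ 1 fun p : Phase => ‖p.2‖ ^ 2 := contDiff_snd.norm_sq ℝ
  unfold gibbs
  exact ((((contDiff_const.mul h2).div_const 2).add (contDiff_const.mul h1)).div_const θ).exp

/-- Conservation of energy for the guiding centre: the drift is orthogonal to the perpendicular
gradient of the averaged potential, and the work of `⟨E₃⟩` on `v₃` balances the variation of that
potential along `x₃`. -/
lemma fderiv_gibbs_limitField (h : IsRegularPotential Ψ E K C) {m : ℝ} (hm : m ≠ 0) (q B θ : ℝ)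
    (p : Phase) :
    fderiv ℝ (gibbs m q θ (omegaC m q B) Ψ) p (limitField m q B E p) = 0 := by
  set ω := omegaC m q B
  have h1 : HasFDerivAt (avgPot ω Ψ) (fderiv ℝ (avgPot ω Ψ) p) p :=
    ((h.contDiff_avgPot ω).differentiable (by simp) p).hasFDerivAt
  have h2 : HasFDerivAt (fun p : Phase => ‖p.2‖ ^ 2)
      ((2 • innerSL ℝ p.2).comp (ContinuousLinearMap.snd ℝ R3 R3)) p :=
    (hasFDerivAt_snd (𝕜 := ℝ) (E := R3) (F := R3)).norm_sq
  have h3 : HasFDerivAt (fun p : Phase => (m / 2 * ‖p.2‖ ^ 2 + q * avgPot ω Ψ p) * θ⁻¹) _ p :=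
    ((h2.const_mul (m / 2)).add (h1.const_mul q)).mul_const θ⁻¹
  have h4 : HasFDerivAt (gibbs m q θ ω Ψ) _ p :=
    h3.exp.congr_of_eventuallyEq (Eventually.of_forall fun p => by
      simp only [gibbs]; congr 1; ring)
  rw [h4.fderiv]
  have hΦ : fderiv ℝ (avgPot ω Ψ) p (limitField m q B E p)
      = -(p.2 2 * gyroAvg ω (fun p => E p.1 2) p) := by
    rw [limitField_eq_sum]
    simp only [map_add, map_smul, h.fderiv_avgPot_dirX, h.fderiv_avgPot_axisV, smul_eq_mul, ω]
    ring
  have hin : inner ℝ p.2 (limitField m q B E p).2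
      = q / m * gyroAvg ω (fun p => E p.1 2) p * p.2 2 := by
    simp [limitField, PiLp.inner_apply, Fin.sum_univ_three, ω]
  have hcalc : m / 2 * (2 * inner ℝ p.2 (limitField m q B E p).2)
      + q * fderiv ℝ (avgPot ω Ψ) p (limitField m q B E p) = 0 := by
    rw [hΦ, hin]; field_simp; ring
  have e2 : (2 • innerSL ℝ p.2) (limitField m q B E p).2
      = 2 * inner ℝ p.2 (limitField m q B E p).2 := by
    rw [two_nsmul, two_mul]; rfl
  change _ * (θ⁻¹ * (m / 2 * (2 • innerSL ℝ p.2) (limitField m q B E p).2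
      + q * fderiv ℝ (avgPot ω Ψ) p (limitField m q B E p))) = 0
  rw [e2, hcalc]
  simp

/-- The averaged potential is bounded, so its exponential is squeezed between positive constants,
and the invariant weight defines the same space as `M⁻¹`. -/
lemma exists_gibbs_bounds (h : IsRegularPotential Ψ E K C) {m θ : ℝ} (hm : 0 < m) (hθ : 0 < θ)
    (q ω : ℝ) : ∃ c₁ c₂ : ℝ, 0 < c₁ ∧ 0 < c₂ ∧ ∀ p : Phase,
      c₁ * (maxwellian m θ p.2)⁻¹ ≤ gibbs m q θ ω Ψ p ∧
      gibbs m q θ ω Ψ p ≤ c₂ * (maxwellian m θ p.2)⁻¹ := by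
  set c : ℝ := 1 / (2 * Real.pi * θ / m) ^ (3 / 2 : ℝ) with hc
  have hc0 : 0 < c := by positivity
  have hg : ∀ p : Phase, gibbs m q θ ω Ψ p
      = c * Real.exp (q * avgPot ω Ψ p / θ) * (maxwellian m θ p.2)⁻¹ := by
    intro p
    rw [maxwellian, ← hc, mul_inv, ← Real.exp_neg, neg_neg, gibbs, mul_mul_mul_comm,
      mul_inv_cancel₀ hc0.ne', one_mul, ← Real.exp_add]
    congr 1
    field_simp
    ring
  have hb : ∀ p, |q * avgPot ω Ψ p / θ| ≤ |q| * C / θ := fun p => by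
    rw [abs_div, abs_mul, abs_of_pos hθ]
    gcongr
    exact h.abs_avgPot_le ω p
  refine ⟨c * Real.exp (-(|q| * C / θ)), c * Real.exp (|q| * C / θ), by positivity, by positivity,
    fun p => ?_⟩
  have hM := (maxwellian_pos hm hθ p.2).le
  have := _root_.abs_le.1 (hb p)
  rw [hg]
  constructor
  · exact mul_le_mul_of_nonneg_right
      (mul_le_mul_of_nonneg_left (Real.exp_le_exp.2 this.1) hc0.le) (inv_nonneg.2 hM)
  · exact mul_le_mul_of_nonneg_right
      (mul_le_mul_of_nonneg_left (Real.exp_le_exp.2 this.2) hc0.le) (inv_nonneg.2 hM)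

end IsRegularPotential

/-! ### Representatives of bounded families of densities -/

lemma eLpNorm_sq_weighted (m θ : ℝ) (u : Phase → ℝ) :
    eLpNorm u 2 (weighted m θ) ^ 2 = wNormSq (maxwellian m θ) u := by
  have hM := measurable_maxwellian m θ
  rw [eLpNorm_eq_lintegral_rpow_enorm_toReal (by norm_num) (by norm_num), ← ENNReal.rpow_two,
    ← ENNReal.rpow_mul, weighted, lintegral_withDensity_eq_lintegral_mul_non_measurable _
    (by fun_prop) (Eventually.of_forall fun _ => ENNReal.ofReal_lt_top)]
  simp [wNormSq, mul_comm]

lemma wNormSq_congr (M : R3 → ℝ) {u w : Phase → ℝ} (h : u =ᵐ[volume] w) :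
    wNormSq M u = wNormSq M w :=
  lintegral_congr_ae (by filter_upwards [h] with p hp; rw [hp])

lemma measurable_wNormSq {M : R3 → ℝ} (hM : Measurable M) {h : ℝ → Phase → ℝ}
    (hh : Measurable (Function.uncurry h)) : Measurable fun t => wNormSq M (h t) := by
  refine Measurable.lintegral_prod_right'
    (f := fun z : ℝ × Phase => ‖Function.uncurry h z‖ₑ ^ 2 * ENNReal.ofReal (M z.2.2)⁻¹) ?_
  fun_prop

/-- The density is set to zero at the exceptional and at the negative times. The bound then holds at
every time, and extension by zero to `t < 0` is built in for the uniqueness argument. -/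
lemma LinftyL2Bound.exists_rep {m θ C : ℝ} {f : ℝ → Phase → ℝ} (hf : LinftyL2Bound m θ C f) :
    ∃ f' : ℝ → Phase → ℝ, Measurable (Function.uncurry f') ∧
      (∀ t, wNormSq (maxwellian m θ) (f' t) ≤ ENNReal.ofReal C ^ 2) ∧ (∀ t < 0, f' t = 0) ∧
      ∀ᵐ z ∂timePhase, f z.1 z.2 = f' z.1 z.2 := by
  obtain ⟨hfm, hfb⟩ := hf
  set f0 : ℝ → Phase → ℝ := fun t p => hfm.mk _ (t, p) with hf0
  have hf0m : Measurable (Function.uncurry f0) := hfm.stronglyMeasurable_mk.measurable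
  have hae : ∀ᵐ z ∂timePhase, f z.1 z.2 = f0 z.1 z.2 := hfm.ae_eq_mk
  set S : Set ℝ := {t | 0 ≤ t ∧ wNormSq (maxwellian m θ) (f0 t) ≤ ENNReal.ofReal C ^ 2} with hS
  have hSm : MeasurableSet S := measurableSet_Ici.inter
    (measurableSet_le (measurable_wNormSq (measurable_maxwellian m θ) hf0m) measurable_const)
  have hSae : ∀ᵐ t ∂(volume : Measure ℝ).restrict (Ici 0), t ∈ S := by
    filter_upwards [Measure.ae_ae_of_ae_prod hae, hfb, ae_restrict_mem measurableSet_Ici]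
      with t h1 h2 h3
    refine ⟨h3, ?_⟩
    rw [← wNormSq_congr _ h1, ← eLpNorm_sq_weighted]
    gcongr
  classical
  refine ⟨fun t p => S.indicator (fun t => f0 t p) t, ?_, fun t => ?_, fun t ht => ?_, ?_⟩
  · have : (Function.uncurry fun t p => S.indicator (fun t => f0 t p) t)
        = (Prod.fst ⁻¹' S).indicator (Function.uncurry f0) := by
      ext z; by_cases hz : z.1 ∈ S <;> simp [Function.uncurry, hz]
    rw [this]
    exact hf0m.indicator (measurable_fst hSm)
  · by_cases ht : t ∈ S
    · simpa [ht] using ht.2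
    · simp [ht, wNormSq]
  · have : t ∉ S := fun h => not_le.2 ht h.1
    ext p; simp [this]
  · have h2 : ∀ᵐ z ∂timePhase, z.1 ∈ S := Measure.quasiMeasurePreserving_fst.ae hSae
    filter_upwards [hae, h2] with z hz hz2
    simp [hz2, hz]

lemma exists_maxwellian_le {m θ : ℝ} (hm : 0 < m) (hθ : 0 < θ) :
    ∃ c : ℝ, 0 < c ∧ ∀ v, maxwellian m θ v ≤ c := by
  refine ⟨1 / (2 * Real.pi * θ / m) ^ (3 / 2 : ℝ), by positivity, fun v => ?_⟩
  unfold maxwellian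
  refine mul_le_of_le_one_right (by positivity) (Real.exp_le_one_iff.2 ?_)
  have : 0 ≤ m * ‖v‖ ^ 2 / (2 * θ) := by positivity
  linarith

/-- The Maxwellian is bounded above, so `M⁻¹` dominates a positive constant; the uniform bound in
time is integrated over a bounded interval. -/
lemma memLp_two_restrict_closedBall {m θ : ℝ} (hm : 0 < m) (hθ : 0 < θ) {h : ℝ → Phase → ℝ}
    (hh : Measurable (Function.uncurry h)) {D : ℝ≥0∞} (hD : D ≠ ∞)
    (hb : ∀ t, wNormSq (maxwellian m θ) (h t) ≤ D) (R : ℝ) :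
    MemLp (fun z : ℝ × Phase => h z.1 z.2) 2
      ((volume : Measure (ℝ × Phase)).restrict (Metric.closedBall 0 R)) := by
  have hM := measurable_maxwellian m θ
  obtain ⟨c, hc, hMc⟩ := exists_maxwellian_le hm hθ
  have hhm : Measurable fun z : ℝ × Phase => h z.1 z.2 := hh
  refine ⟨hhm.aestronglyMeasurable, ?_⟩
  rw [eLpNorm_lt_top_iff_lintegral_rpow_enorm_lt_top (by norm_num) (by norm_num)]
  have hle : (volume : Measure (ℝ × Phase)).restrict (Metric.closedBall 0 R)
      ≤ ((volume : Measure ℝ).restrict (Icc (-R) R)).prod (volume : Measure Phase) := by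
    have e : ((volume : Measure ℝ).restrict (Icc (-R) R)).prod (volume : Measure Phase)
        = (volume : Measure (ℝ × Phase)).restrict (Icc (-R) R ×ˢ univ) := by
      rw [Measure.volume_eq_prod ℝ Phase, ← Measure.prod_restrict, Measure.restrict_univ]
    rw [e]
    refine Measure.restrict_mono (fun z hz => ?_) le_rfl
    have hz' : ‖z‖ ≤ R := by simpa using hz
    have := (norm_fst_le z).trans hz'
    exact ⟨abs_le.1 this, mem_univ _⟩
  refine (lintegral_mono' hle le_rfl).trans_lt ?_
  have hpt : ∀ z : ℝ × Phase, ‖h z.1 z.2‖ₑ ^ (2 : ℝ≥0∞).toReal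
      ≤ ENNReal.ofReal c * (‖h z.1 z.2‖ₑ ^ 2 * ENNReal.ofReal (maxwellian m θ z.2.2)⁻¹) := by
    intro z
    have hp := maxwellian_pos hm hθ z.2.2
    have h1 : 1 ≤ ENNReal.ofReal c * ENNReal.ofReal (maxwellian m θ z.2.2)⁻¹ := by
      rw [← ENNReal.ofReal_mul hc.le, ← ENNReal.ofReal_one]
      refine ENNReal.ofReal_le_ofReal ?_
      rw [← div_eq_mul_inv, one_le_div hp]
      exact hMc _
    calc ‖h z.1 z.2‖ₑ ^ (2 : ℝ≥0∞).toReal = ‖h z.1 z.2‖ₑ ^ 2 * 1 := by simp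
      _ ≤ ‖h z.1 z.2‖ₑ ^ 2 * (ENNReal.ofReal c * ENNReal.ofReal (maxwellian m θ z.2.2)⁻¹) := by
        gcongr
      _ = _ := by ring
  refine (lintegral_mono hpt).trans_lt ?_
  rw [lintegral_const_mul _ (by fun_prop)]
  refine ENNReal.mul_lt_top ENNReal.ofReal_lt_top ?_
  rw [lintegral_prod _ (by fun_prop)]
  calc _ ≤ ∫⁻ t in Icc (-R) R, D := lintegral_mono fun t => hb t
    _ < ∞ := by
      rw [setLIntegral_const]
      exact ENNReal.mul_lt_top hD.lt_top (by simp)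

/-! ### Uniqueness for kinetic equations with a stationary density -/

section uniqueness

variable {m θ : ℝ} {A : Phase → Phase} {K : ℝ≥0} {W : Phase → ℝ} {c₁ c₂ : ℝ}

/-- The weight `exp (-2 λ t) W`. -/
def decayWeight (lam : ℝ) (W : Phase → ℝ) (z : ℝ × Phase) : ℝ :=
  Real.exp (-(2 * lam) * z.1) * W z.2

lemma contDiff_decayWeight (lam : ℝ) (hW : ContDiff ℝ 1 W) :
    ContDiff ℝ 1 (decayWeight lam W) := by
  unfold decayWeight
  exact ((contDiff_const.mul contDiff_fst).exp).mul (hW.comp contDiff_snd)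

lemma fderiv_decayWeight (lam : ℝ) (hW : ContDiff ℝ 1 W)
    (hWA : ∀ p, fderiv ℝ W p (A p) = 0) (z : ℝ × Phase) :
    fderiv ℝ (decayWeight lam W) z (1, A z.2) = -(2 * lam) * decayWeight lam W z := by
  have h1 : HasFDerivAt (fun z : ℝ × Phase => Real.exp (-(2 * lam) * z.1)) _ z :=
    ((hasFDerivAt_fst (𝕜 := ℝ) (E := ℝ) (F := Phase)).const_mul (-(2 * lam))).exp
  have h2 : HasFDerivAt (fun z : ℝ × Phase => W z.2) _ z :=
    (hW.differentiable (by simp) z.2).hasFDerivAt.comp z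
      (hasFDerivAt_snd (𝕜 := ℝ) (E := ℝ) (F := Phase))
  have h3 : HasFDerivAt (decayWeight lam W) _ z := h1.mul h2
  rw [h3.fderiv]
  simp [hWA, decayWeight]
  ring

/-- The squared norm of `h` in `L²(exp (-2 λ t) M⁻¹)`. -/
def decayNormSq (m θ lam : ℝ) (h : ℝ → Phase → ℝ) : ℝ≥0∞ :=
  ∫⁻ t, ENNReal.ofReal (Real.exp (-(2 * lam) * t)) * wNormSq (maxwellian m θ) (h t)

lemma decayNormSq_lt_top {lam : ℝ} (hlam : 0 < lam) {h : ℝ → Phase → ℝ} {D : ℝ≥0∞} (hD : D ≠ ∞)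
    (hb : ∀ t, wNormSq (maxwellian m θ) (h t) ≤ D) (h0 : ∀ t < 0, h t = 0) :
    decayNormSq m θ lam h < ∞ := by
  have hle : ∀ t, ENNReal.ofReal (Real.exp (-(2 * lam) * t)) * wNormSq (maxwellian m θ) (h t)
      ≤ (Ici (0 : ℝ)).indicator (fun t => ENNReal.ofReal (Real.exp (-(2 * lam) * t)) * D) t := by
    intro t
    by_cases ht : t < 0
    · simp [h0 t ht, wNormSq]
    · rw [indicator_of_mem (by simpa using ht)]
      gcongr
      exact hb t
  refine (lintegral_mono hle).trans_lt ?_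
  rw [lintegral_indicator measurableSet_Ici, lintegral_mul_const _ (by fun_prop)]
  refine ENNReal.mul_lt_top ?_ hD.lt_top
  have : IntegrableOn (fun t : ℝ => Real.exp (-(2 * lam) * t)) (Ici 0) :=
    (integrableOn_Ici_iff_integrableOn_Ioi (by finiteness)).2
      (exp_neg_integrableOn_Ioi 0 (by positivity))
  exact this.lintegral_lt_top

lemma lintegral_decayWeight_eq {lam : ℝ} (hWm : Measurable W)
    {h : ℝ → Phase → ℝ} (hh : Measurable (Function.uncurry h)) :
    ∫⁻ z : ℝ × Phase, ENNReal.ofReal (h z.1 z.2 ^ 2 * decayWeight lam W z)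
      = ∫⁻ t, ENNReal.ofReal (Real.exp (-(2 * lam) * t)) *
          ∫⁻ p, ‖h t p‖ₑ ^ 2 * ENNReal.ofReal (W p) := by
  have hhm : Measurable fun z : ℝ × Phase => h z.1 z.2 := hh
  have hhm' : ∀ t, Measurable (h t) := fun t => hh.comp measurable_prodMk_left
  have hw : Measurable (decayWeight lam W) := by unfold decayWeight; fun_prop
  rw [Measure.volume_eq_prod, lintegral_prod _ (by fun_prop)]
  refine lintegral_congr fun t => ?_
  rw [← lintegral_const_mul _ (by have := hhm' t; fun_prop)]
  refine lintegral_congr fun p => ?_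
  simp only [decayWeight]
  rw [← sq_abs (h t p), ENNReal.ofReal_mul (by positivity), ENNReal.ofReal_mul (by positivity),
    ENNReal.ofReal_pow (abs_nonneg _), ← Real.norm_eq_abs, ofReal_norm]
  ring

lemma integrable_decayWeight_and_bounds {lam : ℝ} (hm : 0 < m) (hθ : 0 < θ) (hW : Measurable W)
    (hc₁ : 0 < c₁) (hc₂ : 0 < c₂)
    (hWb : ∀ p : Phase, c₁ * (maxwellian m θ p.2)⁻¹ ≤ W p ∧ W p ≤ c₂ * (maxwellian m θ p.2)⁻¹)
    {h : ℝ → Phase → ℝ} (hh : Measurable (Function.uncurry h))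
    (hfin : decayNormSq m θ lam h < ∞) :
    Integrable (fun z : ℝ × Phase => h z.1 z.2 ^ 2 * decayWeight lam W z) ∧
    c₁ * (decayNormSq m θ lam h).toReal ≤ ∫ z : ℝ × Phase, h z.1 z.2 ^ 2 * decayWeight lam W z ∧
    ∫ z : ℝ × Phase, h z.1 z.2 ^ 2 * decayWeight lam W z
      ≤ c₂ * (decayNormSq m θ lam h).toReal := by
  have hM := measurable_maxwellian m θ
  have hhm : Measurable fun z : ℝ × Phase => h z.1 z.2 := hh
  have hhm' : ∀ t, Measurable (h t) := fun t => hh.comp measurable_prodMk_left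
  have hwN := measurable_wNormSq hM hh
  have hW0 : ∀ p, 0 ≤ W p := fun p =>
    (mul_nonneg hc₁.le (inv_nonneg.2 (maxwellian_pos hm hθ p.2).le)).trans (hWb p).1
  have hw : Measurable (decayWeight lam W) := by unfold decayWeight; fun_prop
  have hnn : ∀ z : ℝ × Phase, 0 ≤ h z.1 z.2 ^ 2 * decayWeight lam W z := fun z =>
    mul_nonneg (sq_nonneg _) (mul_nonneg (Real.exp_pos _).le (hW0 _))
  have hb : ∀ t, ENNReal.ofReal c₁ * wNormSq (maxwellian m θ) (h t)
        ≤ (∫⁻ p, ‖h t p‖ₑ ^ 2 * ENNReal.ofReal (W p)) ∧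
      (∫⁻ p, ‖h t p‖ₑ ^ 2 * ENNReal.ofReal (W p))
        ≤ ENNReal.ofReal c₂ * wNormSq (maxwellian m θ) (h t) := by
    intro t
    have := hhm' t
    rw [wNormSq, ← lintegral_const_mul _ (by fun_prop), ← lintegral_const_mul _ (by fun_prop)]
    constructor
    · refine lintegral_mono fun p => ?_
      rw [mul_left_comm, ← ENNReal.ofReal_mul hc₁.le]
      gcongr
      exact (hWb p).1
    · refine lintegral_mono fun p => ?_
      rw [mul_left_comm (ENNReal.ofReal c₂), ← ENNReal.ofReal_mul hc₂.le]
      gcongr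
      exact (hWb p).2
  have hup : ∫⁻ z : ℝ × Phase, ENNReal.ofReal (h z.1 z.2 ^ 2 * decayWeight lam W z)
      ≤ ENNReal.ofReal c₂ * decayNormSq m θ lam h := by
    rw [lintegral_decayWeight_eq hW hh, decayNormSq, ← lintegral_const_mul _ (by fun_prop)]
    refine lintegral_mono fun t => ?_
    rw [mul_left_comm]
    gcongr
    exact (hb t).2
  have hlow : ENNReal.ofReal c₁ * decayNormSq m θ lam h
      ≤ ∫⁻ z : ℝ × Phase, ENNReal.ofReal (h z.1 z.2 ^ 2 * decayWeight lam W z) := by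
    rw [lintegral_decayWeight_eq hW hh, decayNormSq, ← lintegral_const_mul _ (by fun_prop)]
    refine lintegral_mono fun t => ?_
    rw [mul_left_comm]
    gcongr
    exact (hb t).1
  have htop := hup.trans_lt (ENNReal.mul_lt_top ENNReal.ofReal_lt_top hfin)
  have hae : AEStronglyMeasurable (fun z : ℝ × Phase => h z.1 z.2 ^ 2 * decayWeight lam W z) :=
    Measurable.aestronglyMeasurable (by fun_prop)
  have heq := integral_eq_lintegral_of_nonneg_ae (Eventually.of_forall hnn) hae
  refine ⟨⟨hae, ?_⟩, ?_, ?_⟩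
  · rwa [hasFiniteIntegral_iff_ofReal (Eventually.of_forall hnn)]
  · rw [heq, ← ENNReal.toReal_ofReal hc₁.le, ← ENNReal.toReal_mul]
    exact ENNReal.toReal_mono htop.ne hlow
  · rw [heq, ← ENNReal.toReal_ofReal hc₂.le, ← ENNReal.toReal_mul]
    exact ENNReal.toReal_mono (ENNReal.mul_lt_top ENNReal.ofReal_lt_top hfin).ne hup

/-- Energy estimate in the weight `exp (-2 λ t) W`. Renormalization gives the equation for `h²`,
stationarity of `W` leaves only `-2 λ` from the transport of the weight, and the source is dominated
by `h` with constant `L`. There is no initial term: `h` is already extended by zero to negative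
times and the equation is assumed on the whole space. -/
lemma ae_eq_zero_of_weak (hm : 0 < m) (hθ : 0 < θ) (hA : LipschitzWith K A)
    (hdiv : ∀ ρ : ℝ × Phase → ℝ, ContDiff ℝ ((⊤ : ℕ∞) : WithTop ℕ∞) ρ → HasCompactSupport ρ →
      ∫ z, fderiv ℝ ρ z (1, A z.2) = 0)
    (hW : ContDiff ℝ 1 W) (hWA : ∀ p, fderiv ℝ W p (A p) = 0) (hc₁ : 0 < c₁) (hc₂ : 0 < c₂)
    (hWb : ∀ p : Phase, c₁ * (maxwellian m θ p.2)⁻¹ ≤ W p ∧ W p ≤ c₂ * (maxwellian m θ p.2)⁻¹)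
    {h g : ℝ → Phase → ℝ} (hh : Measurable (Function.uncurry h))
    (hg : Measurable (Function.uncurry g)) {D L : ℝ≥0∞} (hD : D ≠ ∞) (hL : L ≠ ∞)
    (hb : ∀ t, wNormSq (maxwellian m θ) (h t) ≤ D) (h0 : ∀ t < 0, h t = 0)
    (hgb : ∀ t, wNormSq (maxwellian m θ) (g t) ≤ L * wNormSq (maxwellian m θ) (h t))
    (heq : ∀ ψ : ℝ × Phase → ℝ, ContDiff ℝ 1 ψ → HasCompactSupport ψ →
      ∫ z : ℝ × Phase, h z.1 z.2 * fderiv ℝ ψ z (1, A z.2) = -∫ z : ℝ × Phase, g z.1 z.2 * ψ z) :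
    ∀ᵐ z : ℝ × Phase, h z.1 z.2 = 0 := by
  have hM := measurable_maxwellian m θ
  have hhm : Measurable fun z : ℝ × Phase => h z.1 z.2 := hh
  have hgm : Measurable fun z : ℝ × Phase => g z.1 z.2 := hg
  have hgb' : ∀ t, wNormSq (maxwellian m θ) (g t) ≤ L * D := fun t =>
    (hgb t).trans (mul_le_mul' le_rfl (hb t))
  have hLD : L * D ≠ ∞ := ENNReal.mul_ne_top hL hD
  have hW0 : ∀ p, 0 < W p := fun p =>
    (mul_pos hc₁ (inv_pos.2 (maxwellian_pos hm hθ p.2))).trans_le (hWb p).1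
  -- With `a` the integral of `h² w`, the estimate obtained is `2 λ a ≤ (c₂ L / c₁ + 1) a`. The
  -- choice makes `2 λ` exceed that constant by `2`, forcing `a = 0`.
  set lam : ℝ := (c₂ * L.toReal / c₁ + 1) / 2 + 1 with hlam
  have hlam0 : 0 < lam := by positivity
  set w := decayWeight lam W with hw
  have hw1 : ContDiff ℝ 1 w := contDiff_decayWeight lam hW
  have hwpos : ∀ z, 0 < w z := fun z => mul_pos (Real.exp_pos _) (hW0 _)
  have hY := decayNormSq_lt_top (m := m) (θ := θ) hlam0 hD hb h0
  have hYg : decayNormSq m θ lam g ≤ L * decayNormSq m θ lam h := by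
    have hwN := measurable_wNormSq hM hh
    rw [decayNormSq, decayNormSq, ← lintegral_const_mul _ (by fun_prop)]
    refine lintegral_mono fun t => ?_
    rw [mul_left_comm]
    gcongr
    exact hgb t
  have hYgt := hYg.trans_lt (ENNReal.mul_lt_top hL.lt_top hY)
  obtain ⟨ih, ih1, -⟩ := integrable_decayWeight_and_bounds hm hθ hW.continuous.measurable hc₁ hc₂
    hWb hh hY
  obtain ⟨ig, -, ig2⟩ := integrable_decayWeight_and_bounds hm hθ hW.continuous.measurable hc₁ hc₂
    hWb hg hYgt
  have ren := fun (ζ : ℝ × Phase → ℝ) (hζ : ContDiff ℝ 1 ζ) (hζc : HasCompactSupport ζ) =>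
    integral_sq_mul_fderiv_of_weak (μ := (volume : Measure (ℝ × Phase)))
      (A := fun z : ℝ × Phase => ((1 : ℝ), A z.2))
      ((LipschitzWith.const (1 : ℝ)).prodMk (hA.comp LipschitzWith.prod_snd)) hdiv hhm hgm
      (memLp_two_restrict_closedBall hm hθ hh hD hb)
      (memLp_two_restrict_closedBall hm hθ hg hLD hgb') heq hζ hζc
  -- cutoff functions
  let b : ContDiffBump (0 : ℝ × Phase) := ⟨1, 2, by norm_num, by norm_num⟩
  have hbs : ContDiff ℝ 1 b := b.contDiff
  have hbD : Continuous (fderiv ℝ b) := hbs.continuous_fderiv (by simp)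
  obtain ⟨c, hc⟩ := (b.hasCompactSupport.fderiv (𝕜 := ℝ)).exists_bound_of_continuous hbD
  have hc0 : 0 ≤ c := (norm_nonneg _).trans (hc 0)
  set s : ℕ → ℝ := fun n => ((n : ℝ) + 1)⁻¹ with hs
  have hs0 : ∀ n, 0 < s n := fun n => by positivity
  have hst : Tendsto s atTop (𝓝 0) := by
    simpa [hs, one_div] using tendsto_one_div_add_atTop_nhds_zero_nat (𝕜 := ℝ)
  set χ : ℕ → ℝ × Phase → ℝ := fun n z => b (s n • z) with hχ
  have hχ1 : ∀ n, ContDiff ℝ 1 (χ n) := fun n => hbs.comp (contDiff_const_smul _)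
  have hχc : ∀ n, HasCompactSupport (χ n) := fun n =>
    b.hasCompactSupport.comp_smul (hs0 n).ne'
  set κ : ℕ → ℝ × Phase → ℝ := fun n z => fderiv ℝ b (s n • z) (s n • (1, A z.2)) with hκ
  have hχD : ∀ n z, fderiv ℝ (χ n) z (1, A z.2) = κ n z := by
    intro n z
    simp only [hχ, hκ]
    rw [fderiv_comp_smul, map_smul]
    rfl
  have hid : ∀ n, ∫ z : ℝ × Phase, h z.1 z.2 ^ 2 * w z * (κ n z - 2 * lam * χ n z)
      = -(2 * ∫ z : ℝ × Phase, g z.1 z.2 * h z.1 z.2 * w z * χ n z) := by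
    intro n
    have := ren (fun z => χ n z * w z) ((hχ1 n).mul hw1) (hχc n).mul_right
    calc _ = ∫ z : ℝ × Phase, h z.1 z.2 ^ 2 * fderiv ℝ (fun z => χ n z * w z) z (1, A z.2) := by
          congr 1; ext z
          rw [fderiv_fun_mul ((hχ1 n).differentiable (by simp) z)
            (hw1.differentiable (by simp) z)]
          simp only [FunLike.coe_add, FunLike.coe_smul, Pi.add_apply,
            Pi.smul_apply, smul_eq_mul, hχD]
          rw [hw, fderiv_decayWeight lam hW hWA]
          ring
      _ = _ := this
      _ = _ := by congr 3; ext z; ring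
  set C₁ : ℝ := c * (1 + ‖A 0‖ + 2 * K) with hC₁
  -- The cutoff at scale `1 / s` has gradient of size `s`, supported where `s ‖z‖ ≤ 2`, while `A`
  -- grows at most linearly. The product is bounded independently of `n`, which is enough for
  -- dominated convergence since it tends to zero pointwise.
  have hκb : ∀ n z, |κ n z| ≤ C₁ := by
    intro n z
    by_cases hz : s n • z ∈ tsupport b
    · have hz2 : s n * ‖z‖ ≤ 2 := by
        rw [b.tsupport_eq] at hz
        have : ‖s n • z‖ ≤ 2 := by simpa using hz
        rwa [norm_smul, Real.norm_of_nonneg (hs0 n).le] at this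
      have hs1 : s n ≤ 1 := inv_le_one_of_one_le₀ (by simp)
      have hA1 : ‖((1 : ℝ), A z.2)‖ ≤ 1 + ‖A 0‖ + K * ‖z‖ := by
        have h1 : ‖A z.2‖ ≤ ‖A 0‖ + K * ‖z‖ := by
          have := hA.norm_sub_le z.2 0
          rw [sub_zero] at this
          have h2 := norm_le_norm_add_norm_sub' (A z.2) (A 0)
          have h3 := mul_le_mul_of_nonneg_left (norm_snd_le z) K.coe_nonneg
          linarith
        refine (norm_prod_le_iff).2 ⟨?_, ?_⟩
        · have : 0 ≤ (K : ℝ) * ‖z‖ := by positivity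
          simp only [norm_one]
          linarith [norm_nonneg (A 0)]
        · simp only; linarith
      have hnn : 0 ≤ 1 + ‖A 0‖ := by positivity
      calc |κ n z| ≤ ‖fderiv ℝ b (s n • z)‖ * ‖s n • ((1 : ℝ), A z.2)‖ :=
            (fderiv ℝ b (s n • z)).le_opNorm _
        _ ≤ c * (s n * (1 + ‖A 0‖ + K * ‖z‖)) := by
            rw [norm_smul, Real.norm_of_nonneg (hs0 n).le]
            have := (hs0 n).le
            gcongr
            exact hc _
        _ ≤ C₁ := by
            rw [hC₁]
            refine mul_le_mul_of_nonneg_left ?_ hc0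
            have e1 : s n * (1 + ‖A 0‖) ≤ 1 + ‖A 0‖ := mul_le_of_le_one_left hnn hs1
            have e2 : K * (s n * ‖z‖) ≤ K * 2 := mul_le_mul_of_nonneg_left hz2 K.coe_nonneg
            linarith
    · have : fderiv ℝ b (s n • z) = 0 :=
        image_eq_zero_of_notMem_tsupport fun h => hz (tsupport_fderiv_subset ℝ h)
      simp only [hκ, this]
      simp [hC₁]
      positivity
  have hχb : ∀ n z, |χ n z| ≤ 1 := fun n z => by
    rw [abs_of_nonneg b.nonneg]; exact b.le_one
  have hκm : ∀ n, Continuous (κ n) := fun n => by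
    have := hA.continuous
    simp only [hκ]; fun_prop
  have hκt : ∀ z, Tendsto (fun n => κ n z) atTop (𝓝 0) := by
    intro z
    have hcont : Continuous fun r : ℝ => fderiv ℝ b (r • z) (r • ((1 : ℝ), A z.2)) := by fun_prop
    have h1 := (hcont.tendsto 0).comp hst
    rw [zero_smul ℝ ((1 : ℝ), A z.2), map_zero] at h1
    exact h1
  have hχt : ∀ z, Tendsto (fun n => χ n z) atTop (𝓝 1) := by
    intro z
    have hcont : Continuous fun r : ℝ => b (r • z) := by
      have := hbs.continuous; fun_prop
    have h1 := (hcont.tendsto 0).comp hst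
    rw [zero_smul, b.one_of_mem_closedBall (Metric.mem_closedBall_self b.rIn_pos.le)] at h1
    exact h1
  have igh : Integrable fun z : ℝ × Phase => g z.1 z.2 * h z.1 z.2 * w z := by
    refine (ig.add ih).mono' (Measurable.aestronglyMeasurable ?_) (Eventually.of_forall fun z => ?_)
    · have := hw1.continuous.measurable; fun_prop
    · simp only [Pi.add_apply]
      rw [norm_mul, Real.norm_of_nonneg (hwpos z).le, ← add_mul]
      refine mul_le_mul_of_nonneg_right ?_ (hwpos z).le
      rw [Real.norm_eq_abs, abs_le]
      constructor <;> nlinarith [sq_nonneg (g z.1 z.2 + h z.1 z.2), sq_nonneg (g z.1 z.2 - h z.1 z.2)]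
  have T1 : Tendsto (fun n => ∫ z : ℝ × Phase, h z.1 z.2 ^ 2 * w z * (κ n z - 2 * lam * χ n z)) atTop
      (𝓝 (∫ z : ℝ × Phase, h z.1 z.2 ^ 2 * w z * (0 - 2 * lam * 1))) := by
    refine tendsto_integral_of_dominated_convergence
      (fun z => h z.1 z.2 ^ 2 * w z * (C₁ + 2 * lam)) (fun n => ?_) (ih.mul_const _)
      (fun n => Eventually.of_forall fun z => ?_) (Eventually.of_forall fun z => ?_)
    · have := hw1.continuous.measurable
      have := (hκm n).measurable
      have := (hχ1 n).continuous.measurable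
      exact Measurable.aestronglyMeasurable (by fun_prop)
    · have hnn : 0 ≤ h z.1 z.2 ^ 2 * w z := mul_nonneg (sq_nonneg _) (hwpos z).le
      rw [norm_mul, Real.norm_of_nonneg hnn]
      refine mul_le_mul_of_nonneg_left ?_ hnn
      refine (norm_sub_le _ _).trans (add_le_add (hκb n z) ?_)
      rw [norm_mul, Real.norm_of_nonneg (by positivity : 0 ≤ 2 * lam)]
      exact mul_le_of_le_one_right (by positivity) (hχb n z)
    · exact ((hκt z).sub ((hχt z).const_mul _)).const_mul _
  have T2 : Tendsto (fun n => ∫ z : ℝ × Phase, g z.1 z.2 * h z.1 z.2 * w z * χ n z) atTop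
      (𝓝 (∫ z : ℝ × Phase, g z.1 z.2 * h z.1 z.2 * w z * 1)) := by
    refine tendsto_integral_of_dominated_convergence
      (fun z => ‖g z.1 z.2 * h z.1 z.2 * w z‖) (fun n => ?_) igh.norm
      (fun n => Eventually.of_forall fun z => ?_) (Eventually.of_forall fun z => ?_)
    · have := hw1.continuous.measurable
      have := (hχ1 n).continuous.measurable
      exact Measurable.aestronglyMeasurable (by fun_prop)
    · rw [norm_mul]
      exact mul_le_of_le_one_right (norm_nonneg _) (hχb n z)
    · exact (hχt z).const_mul _
  have lim := tendsto_nhds_unique (T1.congr hid) (T2.const_mul 2).neg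
  rw [integral_mul_const] at lim
  simp only [mul_one, zero_sub] at lim
  set a := ∫ z : ℝ × Phase, h z.1 z.2 ^ 2 * w z with ha
  have hle : 2 * ∫ z : ℝ × Phase, g z.1 z.2 * h z.1 z.2 * w z
      ≤ (∫ z : ℝ × Phase, g z.1 z.2 ^ 2 * w z) + a := by
    rw [ha, ← integral_add ig ih, ← integral_const_mul]
    refine integral_mono (igh.const_mul 2) (ig.add ih) fun z => ?_
    simp only
    nlinarith [mul_nonneg (sq_nonneg (g z.1 z.2 - h z.1 z.2)) (hwpos z).le]
  have hYr : (decayNormSq m θ lam g).toReal ≤ L.toReal * (decayNormSq m θ lam h).toReal := by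
    rw [← ENNReal.toReal_mul]
    exact ENNReal.toReal_mono (ENNReal.mul_lt_top hL.lt_top hY).ne hYg
  have hYa : (decayNormSq m θ lam h).toReal ≤ a / c₁ := by
    rw [le_div_iff₀ hc₁, mul_comm]; exact ih1
  have hga : (∫ z : ℝ × Phase, g z.1 z.2 ^ 2 * w z) ≤ c₂ * L.toReal / c₁ * a := by
    refine ig2.trans ?_
    calc c₂ * (decayNormSq m θ lam g).toReal ≤ c₂ * (L.toReal * (a / c₁)) := by
          have : 0 ≤ L.toReal := ENNReal.toReal_nonneg
          gcongr
          exact hYr.trans (by gcongr)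
      _ = _ := by ring
  have hnn : ∀ z : ℝ × Phase, 0 ≤ h z.1 z.2 ^ 2 * w z := fun z =>
    mul_nonneg (sq_nonneg _) (hwpos z).le
  have ha0 : 0 ≤ a := integral_nonneg hnn
  have ha1 : a = 0 := by
    have : 2 * lam * a = (c₂ * L.toReal / c₁ + 1) * a + 2 * a := by rw [hlam]; ring
    linarith
  have := (integral_eq_zero_iff_of_nonneg hnn ih).1 ha1
  filter_upwards [this] with z hz
  have hz' : h z.1 z.2 ^ 2 * w z = 0 := hz
  have := (mul_eq_zero.1 hz').resolve_right (hwpos z).ne'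
  exact pow_eq_zero_iff (two_ne_zero) |>.1 this

end uniqueness

/-! ### Symmetry of averages over periodic flows -/

lemma integral_gyroMeasure_neg {f : ℝ → ℝ} (hf : Function.Periodic f (2 * Real.pi)) :
    ∫ α, f (-α) ∂gyroMeasure = ∫ α, f α ∂gyroMeasure := by
  simp only [integral_gyroMeasure]
  rw [intervalIntegral.integral_comp_neg]
  have := hf.intervalIntegral_add_eq (t := -(2 * Real.pi)) (s := 0)
  simp only [neg_add_cancel, zero_add] at this
  rw [neg_zero, this]

/-- A `2π`-periodic measure preserving flow with uniformly bounded distortion. -/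
structure IsAngleFlow {X : Type*} [NormedAddCommGroup X] [MeasurableSpace X] (μ : Measure X)
    (T : ℝ → X → X) : Prop where
  continuous : Continuous fun a : ℝ × X => T a.1 a.2
  zero : ∀ x, T 0 x = x
  add : ∀ α β x, T (α + β) x = T α (T β x)
  two_pi : ∀ x, T (2 * Real.pi) x = x
  measurePreserving : ∀ α, MeasurePreserving (T α) μ μ
  bound : ∃ C : ℝ≥0, ∀ α x, ‖T α x‖ ≤ C * ‖x‖

namespace IsAngleFlow

variable {X : Type*} [NormedAddCommGroup X] [ProperSpace X] [MeasurableSpace X] [BorelSpace X]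
  [SecondCountableTopology X] {μ : Measure X} {T : ℝ → X → X} {u F : X → ℝ}

set_option linter.unusedSectionVars false

lemma periodic (h : IsAngleFlow μ T) (x : X) :
    Function.Periodic (fun α => T α x) (2 * Real.pi) := fun α => by
  simp only [h.add, h.two_pi]

lemma neg_cancel (h : IsAngleFlow μ T) (α : ℝ) (x : X) : T α (T (-α) x) = x := by
  rw [← h.add, add_neg_cancel, h.zero]

lemma cancel_neg (h : IsAngleFlow μ T) (α : ℝ) (x : X) : T (-α) (T α x) = x := by
  rw [← h.add, neg_add_cancel, h.zero]

lemma continuous_apply (h : IsAngleFlow μ T) (α : ℝ) : Continuous (T α) :=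
  h.continuous.comp (Continuous.prodMk_right α)

lemma exists_closedBall (h : IsAngleFlow μ T) (hFc : HasCompactSupport F) :
    ∃ R : ℝ, ∀ x ∉ Metric.closedBall (0 : X) R, ∀ α, F (T α x) = 0 := by
  obtain ⟨C, hC⟩ := h.bound
  obtain ⟨R, hR⟩ := hFc.isCompact.isBounded.subset_closedBall (0 : X)
  refine ⟨C * R, fun x hx α => image_eq_zero_of_notMem_tsupport fun hm => hx ?_⟩
  have h1 : ‖T α x‖ ≤ R := by simpa using hR hm
  have h2 := hC (-α) (T α x)
  rw [h.cancel_neg] at h2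
  simpa using h2.trans (mul_le_mul_of_nonneg_left h1 C.coe_nonneg)

lemma hasCompactSupport_avg (h : IsAngleFlow μ T) (hFc : HasCompactSupport F) :
    HasCompactSupport fun x => ∫ α, F (T α x) ∂gyroMeasure := by
  obtain ⟨R, hR⟩ := h.exists_closedBall hFc
  refine HasCompactSupport.intro (isCompact_closedBall (0 : X) R) fun x hx => ?_
  simp [hR x hx]

lemma lintegral_comp_le (h : IsAngleFlow μ T) (hu : LocallyIntegrable u μ) (hF : Continuous F)
    (hFc : HasCompactSupport F) :
    ∃ K : ℝ≥0∞, K ≠ ∞ ∧ ∀ α, ∫⁻ x, ‖u x‖ₑ * ‖F (T α x)‖ₑ ∂μ ≤ K := by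
  obtain ⟨R, hR⟩ := h.exists_closedBall hFc
  obtain ⟨c, hc⟩ := hFc.exists_bound_of_continuous hF
  have hi := hu.integrableOn_isCompact (isCompact_closedBall (0 : X) R)
  refine ⟨(∫⁻ x in Metric.closedBall 0 R, ‖u x‖ₑ ∂μ) * ENNReal.ofReal c,
    ENNReal.mul_ne_top hi.2.ne ENNReal.ofReal_ne_top, fun α => ?_⟩
  rw [← lintegral_mul_const' _ _ ENNReal.ofReal_ne_top,
    ← lintegral_indicator Metric.isClosed_closedBall.measurableSet]
  refine lintegral_mono fun x => ?_
  by_cases hx : x ∈ Metric.closedBall (0 : X) R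
  · rw [indicator_of_mem hx, ← ofReal_norm (F _)]
    gcongr
    exact hc _
  · simp [hR x hx]

variable [SFinite μ]

lemma integrable_mul_comp (h : IsAngleFlow μ T) (hum : Measurable u) (hu : LocallyIntegrable u μ)
    (hF : Continuous F) (hFc : HasCompactSupport F) :
    Integrable (fun a : X × ℝ => u a.1 * F (T a.2 a.1)) (μ.prod gyroMeasure) := by
  obtain ⟨K, hK, hKb⟩ := h.lintegral_comp_le hu hF hFc
  have hT := h.continuous.measurable
  have hTm : Measurable fun a : X × ℝ => T a.2 a.1 := hT.comp measurable_swap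
  have hFm := hF.measurable
  refine ⟨Measurable.aestronglyMeasurable (by fun_prop), ?_⟩
  rw [HasFiniteIntegral]
  simp only [enorm_mul]
  rw [lintegral_prod_symm _ (by fun_prop)]
  calc _ ≤ ∫⁻ _, K ∂gyroMeasure := lintegral_mono fun α => hKb α
    _ < ∞ := by simpa using hK.lt_top

lemma integrable_comp_mul (h : IsAngleFlow μ T) (hum : Measurable u) (hu : LocallyIntegrable u μ)
    (hF : Continuous F) (hFc : HasCompactSupport F) :
    Integrable (fun a : X × ℝ => u (T a.2 a.1) * F a.1) (μ.prod gyroMeasure) := by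
  obtain ⟨K, hK, hKb⟩ := h.lintegral_comp_le hu hF hFc
  have hT := h.continuous.measurable
  have hTm : Measurable fun a : X × ℝ => T a.2 a.1 := hT.comp measurable_swap
  have hFm := hF.measurable
  refine ⟨Measurable.aestronglyMeasurable (by fun_prop), ?_⟩
  rw [HasFiniteIntegral]
  simp only [enorm_mul]
  rw [lintegral_prod_symm _ (by fun_prop)]
  have e : ∀ α, ∫⁻ x, ‖u (T α x)‖ₑ * ‖F x‖ₑ ∂μ = ∫⁻ x, ‖u x‖ₑ * ‖F (T (-α) x)‖ₑ ∂μ := by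
    intro α
    have hTα := (h.continuous_apply (-α)).measurable
    rw [← (h.measurePreserving α).lintegral_comp
      (f := fun x => ‖u x‖ₑ * ‖F (T (-α) x)‖ₑ) (by fun_prop)]
    simp only [h.cancel_neg]
  simp only [e]
  calc _ ≤ ∫⁻ _, K ∂gyroMeasure := lintegral_mono fun α => hKb (-α)
    _ < ∞ := by simpa using hK.lt_top

lemma integral_comp_mul_comp (h : IsAngleFlow μ T) (α : ℝ) (G : X → ℝ) :
    ∫ x, G (T α x) ∂μ = ∫ x, G x ∂μ := by
  let e : X ≃ₜ X :=
    { toFun := T α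
      invFun := T (-α)
      left_inv := h.cancel_neg α
      right_inv := h.neg_cancel α
      continuous_toFun := h.continuous_apply α
      continuous_invFun := h.continuous_apply (-α) }
  exact (h.measurePreserving α).integral_comp e.measurableEmbedding G

/-- Averaging is symmetric. -/
lemma integral_mul_avg (h : IsAngleFlow μ T) (hum : Measurable u) (hu : LocallyIntegrable u μ)
    (hF : Continuous F) (hFc : HasCompactSupport F) :
    ∫ x, u x * (∫ α, F (T α x) ∂gyroMeasure) ∂μ
      = ∫ x, (∫ α, u (T α x) ∂gyroMeasure) * F x ∂μ := by
  simp only [← integral_const_mul, ← integral_mul_const]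
  rw [integral_integral_swap (f := fun x α => u x * F (T α x))
      (h.integrable_mul_comp hum hu hF hFc),
    integral_integral_swap (f := fun x α => u (T α x) * F x)
      (h.integrable_comp_mul hum hu hF hFc)]
  have e : ∀ α, ∫ x, u x * F (T α x) ∂μ = (fun α => ∫ x, u (T α x) * F x ∂μ) (-α) := by
    intro α
    simp only
    rw [← h.integral_comp_mul_comp α fun x => u (T (-α) x) * F x]
    simp only [h.cancel_neg]
  simp only [e]
  refine integral_gyroMeasure_neg (f := fun α => ∫ x, u (T α x) * F x ∂μ) fun α => ?_
  simp only [h.add, h.two_pi]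

/-- After Fubini, the change of variables by the flow makes the integral independent of the angle.
-/
lemma integral_mul_avg_of_invariant (h : IsAngleFlow μ T) (hum : Measurable u)
    (hu : LocallyIntegrable u μ) (hinv : ∀ α, ∀ᵐ x ∂μ, u (T α x) = u x)
    (hF : Continuous F) (hFc : HasCompactSupport F) :
    ∫ x, u x * (∫ α, F (T α x) ∂gyroMeasure) ∂μ = ∫ x, u x * F x ∂μ := by
  simp only [← integral_const_mul]
  rw [integral_integral_swap (h.integrable_mul_comp hum hu hF hFc)]
  have e : ∀ α, ∫ x, u x * F (T α x) ∂μ = ∫ x, u x * F x ∂μ := by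
    intro α
    rw [← h.integral_comp_mul_comp α fun x => u x * F x]
    refine integral_congr_ae ?_
    filter_upwards [hinv α] with x hx
    rw [hx]
  simp [e]

end IsAngleFlow

instance : SFinite timePhase := by unfold timePhase; infer_instance

lemma isAngleFlow_larmor (ω : ℝ) : IsAngleFlow (volume : Measure Phase) (larmor ω) where
  continuous := continuous_larmor ω
  zero := larmor_zero ω
  add := larmor_add ω
  two_pi := larmor_two_pi ω
  measurePreserving := measurePreserving_larmor ω
  bound := exists_norm_larmor_le ω

/-- The cyclotronic flow on `ℝ × ℝ³ × ℝ³`. -/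
def larmorT (ω α : ℝ) (z : ℝ × Phase) : ℝ × Phase := (z.1, larmor ω α z.2)

lemma isAngleFlow_larmorT (ω : ℝ) : IsAngleFlow timePhase (larmorT ω) where
  continuous := by
    have := (continuous_larmor ω).comp
      (f := fun a : ℝ × (ℝ × Phase) => (a.1, a.2.2)) (by fun_prop)
    exact (continuous_fst.comp continuous_snd).prodMk this
  zero z := by simp [larmorT]
  add α β z := by simp [larmorT, larmor_add]
  two_pi z := by simp [larmorT]
  measurePreserving α := measurePreserving_prodMap_larmor ω α
  bound := by
    obtain ⟨C, hC⟩ := exists_norm_larmor_le ω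
    refine ⟨max 1 C, fun α z => norm_prod_le_iff.2 ⟨?_, ?_⟩⟩
    · calc ‖z.1‖ ≤ 1 * ‖z‖ := by rw [one_mul]; exact norm_fst_le z
        _ ≤ _ := by gcongr; exact_mod_cast le_max_left _ _
    · calc ‖larmor ω α z.2‖ ≤ C * ‖z.2‖ := hC α z.2
        _ ≤ _ := by
          gcongr
          · exact_mod_cast le_max_right _ _
          · exact norm_snd_le z

/-! ### Averaged test functions -/

/-- `larmorT` as a continuous linear map. -/
def larmorTCLM (ω α : ℝ) : ℝ × Phase →L[ℝ] ℝ × Phase :=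
  (ContinuousLinearMap.id ℝ ℝ).prodMap (larmorCLM ω α)

lemma continuous_larmorTCLM (ω : ℝ) : Continuous (larmorTCLM ω) := by
  refine continuous_clm_apply.2 fun z => ?_
  have := (isAngleFlow_larmorT ω).continuous
  exact this.comp (f := fun a : ℝ => (a, z)) (by fun_prop)

/-- The average of a function of time and phase space along the cyclotronic flow. -/
def avgTest (ω : ℝ) (ψ : ℝ × Phase → ℝ) (z : ℝ × Phase) : ℝ :=
  ∫ α, ψ (larmorT ω α z) ∂gyroMeasure

section avgTest

variable {ω : ℝ} {ψ : ℝ × Phase → ℝ}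

lemma contDiff_avgTest (hψ : ContDiff ℝ 1 ψ) : ContDiff ℝ 1 (avgTest ω ψ) :=
  contDiff_angleAvg (continuous_larmorTCLM ω) hψ

lemma hasCompactSupport_avgTest (hψ : HasCompactSupport ψ) : HasCompactSupport (avgTest ω ψ) :=
  (isAngleFlow_larmorT ω).hasCompactSupport_avg hψ

lemma avgTest_larmorT (α : ℝ) (z : ℝ × Phase) :
    avgTest ω ψ (larmorT ω α z) = avgTest ω ψ z := by
  have h := isAngleFlow_larmorT ω
  simp only [avgTest, ← h.add]
  exact integral_gyroMeasure_add (f := fun a => ψ (larmorT ω a z)) ((h.periodic z).comp ψ) α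

lemma fderiv_avgTest (hψ : ContDiff ℝ 1 ψ) (z w : ℝ × Phase) :
    fderiv ℝ (avgTest ω ψ) z w = ∫ α, fderiv ℝ ψ (larmorT ω α z) (larmorT ω α w) ∂gyroMeasure :=
  fderiv_angleAvg (continuous_larmorTCLM ω) hψ z w

/-- Chain rule for a function invariant under a linear flow. It lets vectors at any point of a
Larmor circle be pulled back to one base point. -/
lemma fderiv_avgTest_larmorT (hψ : ContDiff ℝ 1 ψ) (α : ℝ) (z w : ℝ × Phase) :
    fderiv ℝ (avgTest ω ψ) (larmorT ω α z) (larmorT ω α w) = fderiv ℝ (avgTest ω ψ) z w := by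
  have hd := (contDiff_avgTest (ω := ω) hψ).differentiable (by simp) (larmorT ω α z)
  have h1 : HasFDerivAt (fun z => avgTest ω ψ (larmorTCLM ω α z))
      ((fderiv ℝ (avgTest ω ψ) (larmorT ω α z)).comp (larmorTCLM ω α)) z :=
    hd.hasFDerivAt.comp z (larmorTCLM ω α).hasFDerivAt
  have h2 : (fun z => avgTest ω ψ (larmorTCLM ω α z)) = avgTest ω ψ :=
    funext fun z => avgTest_larmorT α z
  rw [h2] at h1
  rw [h1.fderiv]
  rfl

/-- The average is constant along the orbit, whose velocity is a nonzero multiple of the cyclotronic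
field. This identity removes the term in `ε⁻¹`. -/
lemma fderiv_avgTest_cyclotronField (hω : ω ≠ 0) (hψ : ContDiff ℝ 1 ψ) (z : ℝ × Phase) :
    fderiv ℝ (avgTest ω ψ) z (0, cyclotronField ω z.2) = 0 := by
  have hd := (contDiff_avgTest (ω := ω) hψ).differentiable (by simp) z
  have h1 : HasDerivAt (fun a => larmorT ω a z)
      (0, -ω⁻¹ • cyclotronField ω (larmor ω 0 z.2)) 0 :=
    (hasDerivAt_const 0 z.1).prodMk (hasDerivAt_larmor ω 0 hω z.2)
  have h0 : larmorT ω 0 z = z := (isAngleFlow_larmorT ω).zero z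
  have hd' : HasFDerivAt (avgTest ω ψ) (fderiv ℝ (avgTest ω ψ) z) (larmorT ω 0 z) := by
    rw [h0]; exact hd.hasFDerivAt
  have h2 := hd'.comp_hasDerivAt (0 : ℝ) h1
  have h3 : (avgTest ω ψ ∘ fun a => larmorT ω a z) = fun _ => avgTest ω ψ z :=
    funext fun a => avgTest_larmorT a z
  rw [h3] at h2
  have h4 := h2.unique (hasDerivAt_const _ _)
  rw [larmor_zero, show ((0 : ℝ), -ω⁻¹ • cyclotronField ω z.2)
    = (-ω⁻¹) • ((0 : ℝ), cyclotronField ω z.2) by simp, map_smul, smul_eq_mul] at h4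
  exact (mul_eq_zero.1 h4).resolve_left (neg_ne_zero.2 (inv_ne_zero hω))

end avgTest

/-- The part `v₃ ∂_{x₃} + (q/m) E · ∇_v` of the field of the kinetic equation. -/
def slowField (m q : ℝ) (E : R3 → R3) (p : Phase) : Phase := (glue 0 (p.2 2), (q / m) • E p.1)

lemma epsField_eq (m q B : ℝ) (E : R3 → R3) (ε : ℝ) (p : Phase) :
    epsField m q B E ε p = slowField m q E p + ε⁻¹ • cyclotronField (omegaC m q B) p := by
  refine Prod.ext ?_ ?_ <;> apply R3.ext <;>
    simp [epsField, slowField, cyclotronField] <;> ring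

/-- The `i`th velocity direction. -/
def dirV (i : Fin 3) : Phase := (0, EuclideanSpace.single i 1)

/-! ### Averaging the slow transport along a Larmor circle -/

section slow

variable {Ψ : R3 → ℝ} {E : R3 → R3} {K : ℝ≥0} {C : ℝ} {ψ : ℝ × Phase → ℝ}

/-- The electric field does no work along a Larmor circle. -/
lemma IsRegularPotential.integral_work (h : IsRegularPotential Ψ E K C) {ω : ℝ} (hω : ω ≠ 0)
    (p : Phase) :
    ∫ α, (E (larmor ω α p).1 0 * (larmor ω α p).2 0
      + E (larmor ω α p).1 1 * (larmor ω α p).2 1) ∂gyroMeasure = 0 := by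
  have hc : Continuous fun α => larmor ω α p :=
    (continuous_larmor ω).comp (f := fun a : ℝ => (a, p)) (by fun_prop)
  have hE : ∀ i, Continuous fun α => E (larmor ω α p).1 i := fun i =>
    (h.lipschitz_fst i).continuous.comp hc
  have hv : ∀ i, Continuous fun p : Phase => p.2 i := fun i => by fun_prop
  -- Up to the factor `ω⁻¹`, the power of the perpendicular field is the derivative of the potential
  -- along the circle, so its integral over a period vanishes.
  have hd : ∀ α, HasDerivAt (fun α => Ψ (larmor ω α p).1)
      (ω⁻¹ * (E (larmor ω α p).1 0 * (larmor ω α p).2 0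
        + E (larmor ω α p).1 1 * (larmor ω α p).2 1)) α := by
    intro α
    have h1 := (h.contDiff_fst.differentiable (by simp) (larmor ω α p)).hasFDerivAt.comp_hasDerivAt
      α (hasDerivAt_larmor ω α hω p)
    refine h1.congr_deriv ?_
    rw [h.fderiv_fst]
    simp [Fin.sum_univ_three, cyclotronField]
    ring
  have h0 := intervalIntegral.integral_eq_sub_of_hasDerivAt (a := 0) (b := 2 * Real.pi)
    (fun α _ => hd α) (Continuous.intervalIntegrable (continuous_const.mul
      (((hE 0).mul ((hv 0).comp hc)).add ((hE 1).mul ((hv 1).comp hc)))) _ _)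
  rw [larmor_two_pi, larmor_zero, sub_self, intervalIntegral.integral_const_mul] at h0
  rw [integral_gyroMeasure, (mul_eq_zero.1 h0).resolve_left (inv_ne_zero hω), mul_zero]

/-- Pulled back to the base point by the linear flow, the slow field is a combination of fixed
directions whose coefficients depend on the angle. Their means give the limit field plus a remainder
produced by the mean force seen in the rotating frame. That mean force is orthogonal to the
perpendicular velocity, so the remainder is a multiple of the cyclotronic field and is invisible to
averaged tests. Orthogonality determines the direction of the mean force only when the perpendicular
velocity is nonzero. -/
lemma IsRegularPotential.integral_fderiv_avgTest_slowField (h : IsRegularPotential Ψ E K C)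
    {m q B : ℝ} (hm : m ≠ 0) (hq : q ≠ 0) (hB : B ≠ 0) (hψ : ContDiff ℝ 1 ψ) (z : ℝ × Phase)
    (hz : bar z.2.2 ≠ 0) :
    ∫ α, fderiv ℝ (avgTest (omegaC m q B) ψ) (larmorT (omegaC m q B) α z)
        (1, slowField m q E (larmorT (omegaC m q B) α z).2) ∂gyroMeasure
      = fderiv ℝ (avgTest (omegaC m q B) ψ) z (1, limitField m q B E z.2) := by
  set ω := omegaC m q B with hωdef
  have hω : ω ≠ 0 := by rw [hωdef, omegaC]; positivity
  have hωB : ω⁻¹ * (q / m) = B⁻¹ := by rw [hωdef, omegaC]; field_simp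
  obtain ⟨t, p⟩ := z
  simp only at hz
  set ℓ := fderiv ℝ (avgTest ω ψ) (t, p) with hℓ
  have hc : Continuous fun α => larmor ω α p :=
    (continuous_larmor ω).comp (f := fun a : ℝ => (a, p)) (by fun_prop)
  have hE : ∀ i, Continuous fun α => E (larmor ω α p).1 i := fun i =>
    (h.lipschitz_fst i).continuous.comp hc
  obtain ⟨a0, ha0⟩ : ∃ a : ℝ → ℝ, a = fun α => E (larmor ω α p).1 0 := ⟨_, rfl⟩
  obtain ⟨a1, ha1⟩ : ∃ a : ℝ → ℝ, a = fun α => E (larmor ω α p).1 1 := ⟨_, rfl⟩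
  obtain ⟨a2, ha2⟩ : ∃ a : ℝ → ℝ, a = fun α => E (larmor ω α p).1 2 := ⟨_, rfl⟩
  have hE0 : Continuous a0 := ha0 ▸ hE 0
  have hE1 : Continuous a1 := ha1 ▸ hE 1
  have hE2 : Continuous a2 := ha2 ▸ hE 2
  -- The perpendicular acceleration rotated back by the angle `α`: its components are `e0` and `e1`.
  set e0 : ℝ → ℝ := fun α => q / m * (Real.cos α * a0 α
    + Real.sin α * a1 α) with he0
  set e1 : ℝ → ℝ := fun α => q / m * (-Real.sin α * a0 α
    + Real.cos α * a1 α) with he1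
  have hce0 : Continuous e0 := by simp only [he0]; fun_prop
  have hce1 : Continuous e1 := by simp only [he1]; fun_prop
  -- A change of velocity at a fixed position also moves the centre of the circle. This accounts for
  -- the term in `B⁻¹`, the electric drift; the terms in `ω⁻¹` compensate the displacement that the
  -- rotated acceleration would otherwise carry.
  have hvec : ∀ α, slowField m q E (larmor ω α p) = larmor ω α
      ((B⁻¹ * a1 α - ω⁻¹ * e1 α) • dirX 0
        + (-B⁻¹ * a0 α + ω⁻¹ * e0 α) • dirX 1 + p.2 2 • dirX 2
        + e0 α • dirV 0 + e1 α • dirV 1 + (q / m * a2 α) • dirV 2) := by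
    intro α
    have hcs := Real.sin_sq_add_cos_sq α
    rw [← hωB]
    simp only [he0, he1, ha0, ha1, ha2, slowField]
    have e3 : (larmor ω α p).2 2 = p.2 2 := by simp [larmor]
    rw [e3]
    generalize E (larmor ω α p).1 = a
    refine Prod.ext ?_ ?_ <;> apply R3.ext <;> simp [larmor, dirX, dirV]
    · linear_combination ω⁻¹ * (q / m) * a 1 * hcs
    · linear_combination -ω⁻¹ * (q / m) * a 0 * hcs
    · linear_combination -(q / m) * a 0 * hcs
    · linear_combination -(q / m) * a 1 * hcs
  have hval : ∀ α, fderiv ℝ (avgTest ω ψ) (larmorT ω α (t, p))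
        (1, slowField m q E (larmorT ω α (t, p)).2)
      = ℓ (1, 0) + (B⁻¹ * a1 α - ω⁻¹ * e1 α) * ℓ (0, dirX 0)
        + (-B⁻¹ * a0 α + ω⁻¹ * e0 α) * ℓ (0, dirX 1) + p.2 2 * ℓ (0, dirX 2)
        + e0 α * ℓ (0, dirV 0) + e1 α * ℓ (0, dirV 1)
        + (q / m * a2 α) * ℓ (0, dirV 2) := by
    intro α
    have h1 : ((1 : ℝ), slowField m q E (larmorT ω α (t, p)).2) = larmorT ω α ((1, 0)
        + (B⁻¹ * a1 α - ω⁻¹ * e1 α) • (0, dirX 0)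
        + (-B⁻¹ * a0 α + ω⁻¹ * e0 α) • (0, dirX 1) + p.2 2 • (0, dirX 2)
        + e0 α • (0, dirV 0) + e1 α • (0, dirV 1)
        + (q / m * a2 α) • (0, dirV 2)) := by
      refine Prod.ext ?_ ?_
      · simp [larmorT]
      · simp only [larmorT]
        rw [hvec]
        simp
    rw [h1, fderiv_avgTest_larmorT hψ]
    simp only [map_add, map_smul, smul_eq_mul, hℓ]
  simp only [hval]
  have hI : ∀ {f : ℝ → ℝ}, Continuous f → Integrable f gyroMeasure := fun hf =>
    integrable_gyroMeasure_of_continuous hf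
  have hlin : ∫ α, (ℓ (1, 0) + (B⁻¹ * a1 α - ω⁻¹ * e1 α) * ℓ (0, dirX 0)
        + (-B⁻¹ * a0 α + ω⁻¹ * e0 α) * ℓ (0, dirX 1) + p.2 2 * ℓ (0, dirX 2)
        + e0 α * ℓ (0, dirV 0) + e1 α * ℓ (0, dirV 1)
        + (q / m * a2 α) * ℓ (0, dirV 2)) ∂gyroMeasure
      = ℓ (1, 0) + (B⁻¹ * gyroAvg ω (fun p => E p.1 1) p
          - ω⁻¹ * ∫ α, e1 α ∂gyroMeasure) * ℓ (0, dirX 0)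
        + (-B⁻¹ * gyroAvg ω (fun p => E p.1 0) p
          + ω⁻¹ * ∫ α, e0 α ∂gyroMeasure) * ℓ (0, dirX 1) + p.2 2 * ℓ (0, dirX 2)
        + (∫ α, e0 α ∂gyroMeasure) * ℓ (0, dirV 0) + (∫ α, e1 α ∂gyroMeasure) * ℓ (0, dirV 1)
        + (q / m * gyroAvg ω (fun p => E p.1 2) p) * ℓ (0, dirV 2) := by
    have g0 : gyroAvg ω (fun p => E p.1 0) p = ∫ α, a0 α ∂gyroMeasure := by rw [gyroAvg_eq, ha0]
    have g1 : gyroAvg ω (fun p => E p.1 1) p = ∫ α, a1 α ∂gyroMeasure := by rw [gyroAvg_eq, ha1]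
    have g2 : gyroAvg ω (fun p => E p.1 2) p = ∫ α, a2 α ∂gyroMeasure := by rw [gyroAvg_eq, ha2]
    rw [g0, g1, g2]
    rw [integral_add (hI (by fun_prop)) (hI (by fun_prop)),
      integral_add (hI (by fun_prop)) (hI (by fun_prop)),
      integral_add (hI (by fun_prop)) (hI (by fun_prop)),
      integral_add (hI (by fun_prop)) (hI (by fun_prop)),
      integral_add (hI (by fun_prop)) (hI (by fun_prop)),
      integral_add (hI (by fun_prop)) (hI (by fun_prop))]
    simp only [integral_mul_const, integral_const_mul]
    rw [integral_sub (hI (by fun_prop)) (hI (by fun_prop)),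
      integral_add (hI (by fun_prop)) (hI (by fun_prop))]
    simp only [integral_const_mul]
    simp
  rw [hlin]
  have horth : (∫ α, e0 α ∂gyroMeasure) * p.2 0 + (∫ α, e1 α ∂gyroMeasure) * p.2 1 = 0 := by
    rw [← integral_mul_const, ← integral_mul_const,
      ← integral_add (hI (by fun_prop)) (hI (by fun_prop))]
    have hw := h.integral_work hω p
    have : ∀ α, e0 α * p.2 0 + e1 α * p.2 1
        = q / m * (E (larmor ω α p).1 0 * (larmor ω α p).2 0
          + E (larmor ω α p).1 1 * (larmor ω α p).2 1) := by
      intro α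
      simp only [he0, he1, ha0, ha1]
      have r0 : (larmor ω α p).2 0 = Real.cos α * p.2 0 - Real.sin α * p.2 1 := by simp [larmor]
      have r1 : (larmor ω α p).2 1 = Real.sin α * p.2 0 + Real.cos α * p.2 1 := by simp [larmor]
      rw [r0, r1]
      ring
    simp only [this]
    rw [integral_const_mul, hw, mul_zero]
  have hcyc := fderiv_avgTest_cyclotronField hω hψ (t, p)
  have hcycv : ((0 : ℝ), cyclotronField ω (t, p).2) = p.2 0 • (0, dirX 0) + p.2 1 • (0, dirX 1)
      + (ω * p.2 1) • (0, dirV 0) + (-(ω * p.2 0)) • (0, dirV 1) := by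
    refine Prod.ext (by simp) ?_
    refine Prod.ext ?_ ?_ <;> apply R3.ext <;> simp [cyclotronField, dirX, dirV]
  rw [hcycv] at hcyc
  simp only [map_add, map_smul, smul_eq_mul] at hcyc
  rw [← hℓ] at hcyc
  set I0 := ∫ α, e0 α ∂gyroMeasure
  set I1 := ∫ α, e1 α ∂gyroMeasure
  -- The vector `(I0, I1)` is orthogonal to the perpendicular velocity, hence parallel to `(v₂,
  -- -v₁)`. The remainder is then proportional to the cyclotronic field, along which the derivative
  -- is zero. Multiplication by the squared perpendicular speed avoids naming the proportionality
  -- factor.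
  have hzero : -(ω⁻¹ * I1) * ℓ (0, dirX 0) + ω⁻¹ * I0 * ℓ (0, dirX 1) + I0 * ℓ (0, dirV 0)
      + I1 * ℓ (0, dirV 1) = 0 := by
    have hn : 0 < p.2 0 ^ 2 + p.2 1 ^ 2 := by
      have : 0 < ‖bar p.2‖ ^ 2 := by positivity
      rw [norm_sq_R2] at this
      simpa using this
    have h0 : (p.2 0 ^ 2 + p.2 1 ^ 2) * I0 = (I0 * p.2 1 - I1 * p.2 0) * p.2 1 := by
      linear_combination p.2 0 * horth
    have h1 : (p.2 0 ^ 2 + p.2 1 ^ 2) * I1 = -(I0 * p.2 1 - I1 * p.2 0) * p.2 0 := by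
      linear_combination p.2 1 * horth
    have : (p.2 0 ^ 2 + p.2 1 ^ 2) * (-(ω⁻¹ * I1) * ℓ (0, dirX 0) + ω⁻¹ * I0 * ℓ (0, dirX 1)
        + I0 * ℓ (0, dirV 0) + I1 * ℓ (0, dirV 1)) = 0 := by
      have hωi : ω * ω⁻¹ = 1 := mul_inv_cancel₀ hω
      linear_combination (ω⁻¹ * ℓ (0, dirX 1) + ℓ (0, dirV 0)) * h0
        + (-ω⁻¹ * ℓ (0, dirX 0) + ℓ (0, dirV 1)) * h1
        + ω⁻¹ * (I0 * p.2 1 - I1 * p.2 0) * hcyc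
        - (I0 * p.2 1 - I1 * p.2 0) * (p.2 1 * ℓ (0, dirV 0) - p.2 0 * ℓ (0, dirV 1)) * hωi
    exact (mul_eq_zero.1 this).resolve_left hn.ne'
  have hlim : ((1 : ℝ), limitField m q B E (t, p).2) = (1, 0)
      + (B⁻¹ * gyroAvg ω (fun p => E p.1 1) p) • (0, dirX 0)
      + (-B⁻¹ * gyroAvg ω (fun p => E p.1 0) p) • (0, dirX 1) + p.2 2 • (0, dirX 2)
      + (q / m * gyroAvg ω (fun p => E p.1 2) p) • (0, dirV 2) := by
    rw [limitField_eq_sum]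
    refine Prod.ext ?_ ?_ <;> simp [ω, axisV, dirV]
  rw [hlim]
  simp only [map_add, map_smul, smul_eq_mul]
  linear_combination hzero

/-- The coefficients are averages or `v₃`, hence invariant, and the directions of the field are
fixed by the flow. -/
lemma larmor_limitField (m q B : ℝ) (E : R3 → R3) (α : ℝ) (p : Phase) :
    larmor (omegaC m q B) α (limitField m q B E p)
      = limitField m q B E (larmor (omegaC m q B) α p) := by
  have e3 : (larmor (omegaC m q B) α p).2 2 = p.2 2 := by simp [larmor]
  have : limitField m q B E (larmor (omegaC m q B) α p) = limitField m q B E p := by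
    rw [limitField_eq_sum, limitField_eq_sum]
    simp only [gyroAvg_larmor, e3]
  rw [this]
  refine Prod.ext ?_ ?_ <;> apply R3.ext <;> simp [larmor, limitField]

lemma integral_fderiv_limitField_larmorT (m q B : ℝ) (E : R3 → R3) (hψ : ContDiff ℝ 1 ψ)
    (z : ℝ × Phase) :
    ∫ α, fderiv ℝ ψ (larmorT (omegaC m q B) α z)
        (1, limitField m q B E (larmorT (omegaC m q B) α z).2) ∂gyroMeasure
      = fderiv ℝ (avgTest (omegaC m q B) ψ) z (1, limitField m q B E z.2) := by
  rw [fderiv_avgTest hψ]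
  congr 1
  ext α
  simp only [larmorT, larmor_limitField]

end slow

/-! ### Weak compactness along ultrafilters -/

/-- Banach–Alaoglu for the dual followed by the Riesz representation. Along an ultrafilter a bounded
family converges outright, so neither separability nor a choice of subsequences enters. -/
lemma exists_weak_limit {H ι : Type*} [NormedAddCommGroup H] [InnerProductSpace ℝ H]
    [CompleteSpace H] (U : Ultrafilter ι) {x : ι → H} {C : ℝ} (hx : ∀ᶠ i in U, ‖x i‖ ≤ C) :
    ∃ g : H, ∀ φ : H, Tendsto (fun i => inner ℝ (x i) φ) U (𝓝 (inner ℝ g φ)) := by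
  let F : ι → WeakDual ℝ H := fun i => StrongDual.toWeakDual (innerSL ℝ (x i))
  have hK := WeakDual.isCompact_closedBall (𝕜 := ℝ) (E := H) 0 C
  obtain ⟨y, -, hy⟩ := hK.ultrafilter_le_nhds (U.map F) (by
    rw [le_principal_iff, Ultrafilter.coe_map, mem_map]
    filter_upwards [hx] with i hi
    simp only [mem_preimage, Metric.mem_closedBall, dist_zero_right]
    refine le_trans (le_of_eq ?_) hi
    exact innerSL_apply_norm (𝕜 := ℝ) (x i))
  refine ⟨(InnerProductSpace.toDual ℝ H).symm (WeakDual.toStrongDual y), fun φ => ?_⟩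
  rw [InnerProductSpace.toDual_symm_apply]
  exact ((WeakDual.eval_continuous φ).tendsto y).comp hy

lemma integral_mul_eq_inner {Z : Type*} [MeasurableSpace Z] {ν : Measure Z} {f g : Z → ℝ}
    (hf : MemLp f 2 ν) (hg : MemLp g 2 ν) :
    inner ℝ (hf.toLp f) (hg.toLp g) = ∫ z, f z * g z ∂ν := by
  rw [L2.inner_def]
  refine integral_congr_ae ?_
  filter_upwards [hf.coeFn_toLp, hg.coeFn_toLp] with z h1 h2
  simp [h1, h2, mul_comm]

/-! ### The space `L²(exp (-t) M⁻¹ dt dx dv)` -/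

/-- The measure `exp (-t) M(v)⁻¹ dt dx dv` on `ℝ₊ × ℝ³ × ℝ³`. -/
def expMeasure (m θ : ℝ) : Measure (ℝ × Phase) :=
  timePhase.withDensity fun z => ENNReal.ofReal (Real.exp (-z.1) * (maxwellian m θ z.2.2)⁻¹)

lemma timePhase_eq : timePhase = (volume : Measure (ℝ × Phase)).restrict (Ici 0 ×ˢ univ) := by
  rw [Measure.volume_eq_prod ℝ Phase, ← Measure.prod_restrict, Measure.restrict_univ, timePhase]

lemma timePhase_le : timePhase ≤ (volume : Measure (ℝ × Phase)) := by
  rw [timePhase_eq]; exact Measure.restrict_le_self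

instance : IsLocallyFiniteMeasure timePhase := by
  rw [timePhase_eq]; infer_instance

section expMeasure

variable {m θ : ℝ} (hm : 0 < m) (hθ : 0 < θ)

lemma measurable_expDensity (m θ : ℝ) : Measurable fun z : ℝ × Phase =>
    ENNReal.ofReal (Real.exp (-z.1) * (maxwellian m θ z.2.2)⁻¹) := by
  have hM := measurable_maxwellian m θ
  fun_prop

lemma lintegral_expMeasure {F : ℝ × Phase → ℝ} (hF : Measurable F) :
    ∫⁻ z, ‖F z‖ₑ ^ 2 ∂expMeasure m θ
      = ∫⁻ t in Ici (0 : ℝ), ENNReal.ofReal (Real.exp (-t)) *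
          wNormSq (maxwellian m θ) (fun p => F (t, p)) := by
  have hM := measurable_maxwellian m θ
  rw [expMeasure, lintegral_withDensity_eq_lintegral_mul _ (measurable_expDensity m θ)
    (by fun_prop), timePhase, lintegral_prod _ (by fun_prop)]
  refine lintegral_congr fun t => ?_
  rw [wNormSq, ← lintegral_const_mul _ (by fun_prop)]
  refine lintegral_congr fun p => ?_
  simp only [Pi.mul_apply]
  rw [ENNReal.ofReal_mul (Real.exp_pos _).le]
  ring

lemma eLpNorm_sq_expMeasure {F : ℝ × Phase → ℝ} (hF : Measurable F) :
    eLpNorm F 2 (expMeasure m θ) ^ 2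
      = ∫⁻ t in Ici (0 : ℝ), ENNReal.ofReal (Real.exp (-t)) *
          wNormSq (maxwellian m θ) (fun p => F (t, p)) := by
  rw [← lintegral_expMeasure hF, eLpNorm_eq_lintegral_rpow_enorm_toReal (by norm_num)
    (by norm_num), ← ENNReal.rpow_two, ← ENNReal.rpow_mul]
  simp

lemma lintegral_exp_neg_Ici : ∫⁻ t in Ici (0 : ℝ), ENNReal.ofReal (Real.exp (-t)) = 1 := by
  have hi : IntegrableOn (fun t : ℝ => Real.exp (-t)) (Ici 0) :=
    (integrableOn_Ici_iff_integrableOn_Ioi (by finiteness)).2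
      (by simpa using exp_neg_integrableOn_Ioi 0 (one_pos))
  rw [← ofReal_integral_eq_lintegral_ofReal hi (Eventually.of_forall fun t => (Real.exp_pos _).le),
    integral_Ici_eq_integral_Ioi, integral_exp_neg_Ioi]
  simp

/-- The weight `exp (-t)` has mass one on the half line, so a ball of `L^∞(ℝ₊; L²)` sits in the ball
of the same radius of a Hilbert space, where weak compactness is available. -/
lemma memLp_expMeasure {F : ℝ → Phase → ℝ} (hF : Measurable (Function.uncurry F)) {C : ℝ}
    (hb : ∀ t, wNormSq (maxwellian m θ) (F t) ≤ ENNReal.ofReal C ^ 2) :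
    MemLp (fun z : ℝ × Phase => F z.1 z.2) 2 (expMeasure m θ) ∧
      eLpNorm (fun z : ℝ × Phase => F z.1 z.2) 2 (expMeasure m θ) ≤ ENNReal.ofReal C := by
  have hFm : Measurable fun z : ℝ × Phase => F z.1 z.2 := hF
  have hle : eLpNorm (fun z : ℝ × Phase => F z.1 z.2) 2 (expMeasure m θ) ≤ ENNReal.ofReal C := by
    refine (ENNReal.pow_le_pow_left_iff (two_ne_zero)).1 ?_
    rw [eLpNorm_sq_expMeasure hFm]
    calc _ ≤ ∫⁻ t in Ici (0 : ℝ), ENNReal.ofReal (Real.exp (-t)) * ENNReal.ofReal C ^ 2 :=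
          lintegral_mono fun t => mul_le_mul' le_rfl (hb t)
      _ = _ := by rw [lintegral_mul_const _ (by fun_prop), lintegral_exp_neg_Ici, one_mul]
  exact ⟨⟨hFm.aestronglyMeasurable, hle.trans_lt ENNReal.ofReal_lt_top⟩, hle⟩

include hm hθ

lemma ae_expMeasure_iff {P : ℝ × Phase → Prop} :
    (∀ᵐ z ∂expMeasure m θ, P z) ↔ ∀ᵐ z ∂timePhase, P z := by
  constructor
  · intro h
    refine (withDensity_absolutelyContinuous' (measurable_expDensity m θ).aemeasurable
      (Eventually.of_forall fun z => ?_)).ae_le h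
    have := maxwellian_pos hm hθ z.2.2
    simp only [ne_eq, ENNReal.ofReal_eq_zero, not_le]
    positivity
  · intro h
    exact (withDensity_absolutelyContinuous _ _).ae_le h

lemma integral_expMeasure (f : ℝ × Phase → ℝ) :
    ∫ z, f z ∂expMeasure m θ
      = ∫ z, Real.exp (-z.1) * (maxwellian m θ z.2.2)⁻¹ * f z ∂timePhase := by
  rw [expMeasure, integral_withDensity_eq_integral_toReal_smul (measurable_expDensity m θ)
    (Eventually.of_forall fun _ => ENNReal.ofReal_lt_top)]
  refine integral_congr_ae (Eventually.of_forall fun z => ?_)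
  have := maxwellian_pos hm hθ z.2.2
  simp only [smul_eq_mul]
  rw [ENNReal.toReal_ofReal (by positivity)]

lemma isLocallyFiniteMeasure_expMeasure : IsLocallyFiniteMeasure (expMeasure m θ) := by
  refine IsLocallyFiniteMeasure.withDensity_ofReal ?_
  have h1 := continuous_maxwellian m θ
  have h2 : Continuous fun z : ℝ × Phase => (maxwellian m θ z.2.2)⁻¹ :=
    (h1.comp (continuous_snd.comp continuous_snd)).inv₀ fun z => (maxwellian_pos hm hθ _).ne'
  fun_prop

/-- The density against which `expMeasure` represents integration against `Θ dt dx dv`. -/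
lemma memLp_dual {Θ : ℝ × Phase → ℝ} (hΘ : Continuous Θ) (hΘc : HasCompactSupport Θ) :
    MemLp (fun z => Θ z * (Real.exp z.1 * maxwellian m θ z.2.2)) 2 (expMeasure m θ) := by
  have := isLocallyFiniteMeasure_expMeasure hm hθ
  have h1 := continuous_maxwellian m θ
  exact Continuous.memLp_of_hasCompactSupport (by fun_prop) hΘc.mul_right

lemma integral_mul_dual (f Θ : ℝ × Phase → ℝ) :
    ∫ z, f z * (Θ z * (Real.exp z.1 * maxwellian m θ z.2.2)) ∂expMeasure m θ
      = ∫ z, f z * Θ z ∂timePhase := by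
  rw [integral_expMeasure hm hθ]
  refine integral_congr_ae (Eventually.of_forall fun z => ?_)
  have := maxwellian_pos hm hθ z.2.2
  simp only
  rw [Real.exp_neg]
  field_simp

end expMeasure

/-! ### The collision operator on the space of time dependent densities -/

section Qop

variable {m θ : ℝ} {Y : Type*} [MeasureSpace Y] [SFinite (volume : Measure Y)]
  {k : Phase → Y → ℝ} {j : Phase → Y → Phase} {C : ℝ≥0∞}

lemma ae_wNormSq_lt_top {F : ℝ × Phase → ℝ} (hF : Measurable F)
    (hF2 : eLpNorm F 2 (expMeasure m θ) < ∞) :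
    ∀ᵐ t ∂(volume : Measure ℝ).restrict (Ici 0),
      wNormSq (maxwellian m θ) (fun p => F (t, p)) < ∞ := by
  have h2 : ∫⁻ t in Ici (0 : ℝ), ENNReal.ofReal (Real.exp (-t)) *
      wNormSq (maxwellian m θ) (fun p => F (t, p)) ≠ ∞ := by
    rw [← eLpNorm_sq_expMeasure hF]
    exact ENNReal.pow_ne_top hF2.ne
  have hwm : Measurable fun t => wNormSq (maxwellian m θ) (fun p => F (t, p)) :=
    measurable_wNormSq (measurable_maxwellian m θ) (h := fun t p => F (t, p)) hF
  filter_upwards [ae_lt_top (by fun_prop) h2] with t ht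
  by_contra hcon
  rw [not_lt_top_iff] at hcon
  rw [hcon, ENNReal.mul_top (by simpa using Real.exp_pos (-t))] at ht
  exact lt_irrefl _ ht

namespace IsColKernel

lemma eLpNorm_kerCol_le (h : IsColKernel (maxwellian m θ) k j C) {F : ℝ × Phase → ℝ}
    (hF : Measurable F) (hF2 : eLpNorm F 2 (expMeasure m θ) < ∞) :
    eLpNorm (fun z : ℝ × Phase => kerCol (maxwellian m θ) k j (fun p => F (z.1, p)) z.2) 2
      (expMeasure m θ) ≤ 2 * C * eLpNorm F 2 (expMeasure m θ) := by
  have hwm : Measurable fun t => wNormSq (maxwellian m θ) (fun p => F (t, p)) :=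
    measurable_wNormSq (measurable_maxwellian m θ) (h := fun t p => F (t, p)) hF
  refine (ENNReal.pow_le_pow_left_iff (two_ne_zero)).1 ?_
  rw [eLpNorm_sq_expMeasure (h.measurable_kerCol (f := fun t p => F (t, p)) hF), mul_pow,
    eLpNorm_sq_expMeasure hF, ← lintegral_const_mul _ (by fun_prop)]
  refine lintegral_mono_ae ?_
  filter_upwards [ae_wNormSq_lt_top hF hF2] with t ht
  have := h.wNormSq_kerCol_le (u := fun p => F (t, p)) (by fun_prop) ht
  calc _ ≤ ENNReal.ofReal (Real.exp (-t)) *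
        (4 * C ^ 2 * wNormSq (maxwellian m θ) (fun p => F (t, p))) := mul_le_mul' le_rfl this
    _ = _ := by ring

lemma memLp_kerCol (h : IsColKernel (maxwellian m θ) k j C) {F : ℝ × Phase → ℝ}
    (hF : Measurable F) (hF2 : eLpNorm F 2 (expMeasure m θ) < ∞) :
    MemLp (fun z : ℝ × Phase => kerCol (maxwellian m θ) k j (fun p => F (z.1, p)) z.2) 2
      (expMeasure m θ) := by
  refine ⟨(h.measurable_kerCol (f := fun t p => F (t, p)) hF).aestronglyMeasurable, ?_⟩
  exact (h.eLpNorm_kerCol_le hF hF2).trans_lt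
    (ENNReal.mul_lt_top (ENNReal.mul_lt_top (by simp) h.ne_top.lt_top) hF2)

variable (hm : 0 < m) (hθ : 0 < θ)
include hm hθ

/-- The collision operator as a bounded operator on `L²(exp (-t) M⁻¹ dt dx dv)`. -/
lemma exists_clm (h : IsColKernel (maxwellian m θ) k j C) :
    ∃ Q : Lp ℝ 2 (expMeasure m θ) →L[ℝ] Lp ℝ 2 (expMeasure m θ),
      ∀ (F : ℝ × Phase → ℝ) (_ : Measurable F) (hF2 : MemLp F 2 (expMeasure m θ)),
        Q (hF2.toLp F) =ᵐ[expMeasure m θ]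
          fun z => kerCol (maxwellian m θ) k j (fun p => F (z.1, p)) z.2 := by
  have hms : ∀ F : Lp ℝ 2 (expMeasure m θ), Measurable F := fun F =>
    (Lp.stronglyMeasurable F).measurable
  have hcongr : ∀ {F G : ℝ × Phase → ℝ}, F =ᵐ[expMeasure m θ] G →
      (fun z : ℝ × Phase => kerCol (maxwellian m θ) k j (fun p => F (z.1, p)) z.2)
        =ᵐ[expMeasure m θ]
      fun z : ℝ × Phase => kerCol (maxwellian m θ) k j (fun p => G (z.1, p)) z.2 := by
    intro F G hFG
    refine (ae_expMeasure_iff hm hθ).2 ?_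
    exact h.kerCol_congr_prod (f := fun t p => F (t, p)) (g := fun t p => G (t, p))
      ((ae_expMeasure_iff hm hθ).1 hFG)
  let L : Lp ℝ 2 (expMeasure m θ) →ₗ[ℝ] Lp ℝ 2 (expMeasure m θ) :=
    { toFun := fun F => (h.memLp_kerCol (hms F) (Lp.eLpNorm_lt_top F)).toLp _
      map_add' := by
        intro F G
        rw [← MemLp.toLp_add, MemLp.toLp_eq_toLp_iff]
        refine (hcongr (Lp.coeFn_add F G)).trans ?_
        refine (ae_expMeasure_iff hm hθ).2 ?_
        have h1 := h.measurable_kerCol (f := fun t p => (F + G : ℝ × Phase → ℝ) (t, p))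
          ((hms F).add (hms G))
        have h2 := h.measurable_kerCol (f := fun t p => F (t, p)) (hms F)
        have h3 := h.measurable_kerCol (f := fun t p => G (t, p)) (hms G)
        refine (Measure.ae_prod_iff_ae_ae (measurableSet_eq_fun h1 (h2.add h3))).2 ?_
        filter_upwards [ae_wNormSq_lt_top (hms F) (Lp.eLpNorm_lt_top F),
          ae_wNormSq_lt_top (hms G) (Lp.eLpNorm_lt_top G)] with t hF hG
        exact h.kerCol_add ((hms F).comp measurable_prodMk_left) hF
          ((hms G).comp measurable_prodMk_left) hG
      map_smul' := by
        intro c F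
        rw [← MemLp.toLp_const_smul, MemLp.toLp_eq_toLp_iff]
        refine (hcongr (Lp.coeFn_smul c F)).trans (Eventually.of_forall fun z => ?_)
        exact congrFun (kerCol_smul c fun p => F (z.1, p)) z.2 }
  refine ⟨L.mkContinuous (2 * C.toReal) fun F => ?_, fun F hF hF2 => ?_⟩
  · have h1 : ‖L F‖ = (eLpNorm (fun z : ℝ × Phase =>
        kerCol (maxwellian m θ) k j (fun p => F (z.1, p)) z.2) 2 (expMeasure m θ)).toReal :=
      Lp.norm_toLp _ (h.memLp_kerCol (hms F) (Lp.eLpNorm_lt_top F))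
    rw [h1, Lp.norm_def]
    have h2 := ENNReal.toReal_mono (ENNReal.mul_lt_top (ENNReal.mul_lt_top (by simp)
      h.ne_top.lt_top) (Lp.eLpNorm_lt_top F)).ne (h.eLpNorm_kerCol_le (hms F) (Lp.eLpNorm_lt_top F))
    simpa [ENNReal.toReal_mul] using h2
  · rw [LinearMap.mkContinuous_apply]
    exact (h.memLp_kerCol (hms (hF2.toLp F)) (Lp.eLpNorm_lt_top _)).coeFn_toLp.trans
      (hcongr hF2.coeFn_toLp)

end IsColKernel

end Qop

/-! ### Weak limits of bounded families of densities -/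

section limit

variable {m θ : ℝ}

lemma integral_sq_expMeasure {G : ℝ × Phase → ℝ} (hG : Measurable G) :
    ∫ z, G z ^ 2 ∂expMeasure m θ
      = (∫⁻ t in Ici (0 : ℝ), ENNReal.ofReal (Real.exp (-t)) *
          wNormSq (maxwellian m θ) (fun p => G (t, p))).toReal := by
  rw [integral_eq_lintegral_of_nonneg_ae (Eventually.of_forall fun z => sq_nonneg _)
    (Measurable.aestronglyMeasurable (by fun_prop)), ← lintegral_expMeasure hG]
  congr 1
  refine lintegral_congr fun z => ?_
  rw [← sq_abs, ENNReal.ofReal_pow (abs_nonneg _), ← Real.norm_eq_abs, ofReal_norm]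

lemma lintegral_wNormSq_indicator {S : Set ℝ} (hS : MeasurableSet S) (G : ℝ × Phase → ℝ) :
    ∫⁻ t in Ici (0 : ℝ), ENNReal.ofReal (Real.exp (-t)) *
        wNormSq (maxwellian m θ) (fun p => (Prod.fst ⁻¹' S).indicator G (t, p))
      = ∫⁻ t in S, ENNReal.ofReal (Real.exp (-t)) *
        wNormSq (maxwellian m θ) (fun p => G (t, p)) ∂(volume : Measure ℝ).restrict (Ici 0) := by
  rw [← lintegral_indicator hS]
  refine lintegral_congr fun t => ?_
  by_cases ht : t ∈ S
  · rw [indicator_of_mem ht]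
    congr 2
    ext p
    rw [indicator_of_mem (show (t, p) ∈ Prod.fst ⁻¹' S from ht)]
  · rw [indicator_of_notMem ht]
    have : (fun p => (Prod.fst ⁻¹' S).indicator G (t, p)) = fun _ : Phase => (0 : ℝ) := by
      ext p
      rw [indicator_of_notMem (show (t, p) ∉ Prod.fst ⁻¹' S from ht)]
    rw [this]
    simp [wNormSq]

/-- Weak limits inherit bounds uniform in time. -/
lemma linftyL2Bound_of_weak_limit {ι : Type*} (U : Filter ι) [U.NeBot]
    {F : ι → ℝ → Phase → ℝ} {C : ℝ} (hF : ∀ i, Measurable (Function.uncurry (F i)))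
    (hFb : ∀ i t, wNormSq (maxwellian m θ) (F i t) ≤ ENNReal.ofReal C ^ 2)
    {g : ℝ × Phase → ℝ} (hg : Measurable g) (hg2 : MemLp g 2 (expMeasure m θ))
    (hlim : ∀ φ : ℝ × Phase → ℝ, MemLp φ 2 (expMeasure m θ) →
      Tendsto (fun i => ∫ z, F i z.1 z.2 * φ z ∂expMeasure m θ) U
        (𝓝 (∫ z, g z * φ z ∂expMeasure m θ))) :
    LinftyL2Bound m θ C fun t p => g (t, p) := by
  have hwm : Measurable fun t => wNormSq (maxwellian m θ) (fun p => g (t, p)) :=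
    measurable_wNormSq (measurable_maxwellian m θ) (h := fun t p => g (t, p)) hg
  refine ⟨hg.aestronglyMeasurable, ?_⟩
  have key : (fun t => ENNReal.ofReal (Real.exp (-t)) *
        wNormSq (maxwellian m θ) (fun p => g (t, p)))
      ≤ᵐ[(volume : Measure ℝ).restrict (Ici 0)]
      fun t => ENNReal.ofReal (Real.exp (-t)) * ENNReal.ofReal C ^ 2 := by
    refine ae_le_of_forall_setLIntegral_le_of_sigmaFinite (by fun_prop) fun S hS _ => ?_
    -- Testing with the limit itself on a set `S` of times: `2 F g ≤ F² + g²` passes to the limit as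
    -- `2 A ≤ c + A`. Since `A` is finite this yields `A ≤ c` for every `S`, that is, the bound at
    -- almost every time.
    set φ : ℝ × Phase → ℝ := (Prod.fst ⁻¹' S).indicator g with hφ
    have hS' : MeasurableSet (Prod.fst ⁻¹' S : Set (ℝ × Phase)) := measurable_fst hS
    have hφm : Measurable φ := hg.indicator hS'
    have hφ2 : MemLp φ 2 (expMeasure m θ) := hg2.indicator hS'
    set c : ℝ≥0∞ := ∫⁻ t in S, ENNReal.ofReal (Real.exp (-t)) * ENNReal.ofReal C ^ 2
      ∂(volume : Measure ℝ).restrict (Ici 0) with hc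
    have hct : c ≠ ∞ := by
      have : c ≤ ∫⁻ t in Ici (0 : ℝ), ENNReal.ofReal (Real.exp (-t)) * ENNReal.ofReal C ^ 2 :=
        setLIntegral_le_lintegral _ _
      rw [lintegral_mul_const _ (by fun_prop), lintegral_exp_neg_Ici, one_mul] at this
      exact (this.trans_lt (by finiteness)).ne
    have hφsq := integral_sq_expMeasure (m := m) (θ := θ) hφm
    rw [hφ, lintegral_wNormSq_indicator hS] at hφsq
    set A : ℝ≥0∞ := ∫⁻ t in S, ENNReal.ofReal (Real.exp (-t)) *
        wNormSq (maxwellian m θ) (fun p => g (t, p)) ∂(volume : Measure ℝ).restrict (Ici 0) with hA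
    have hAt : A ≠ ∞ := by
      have := eLpNorm_sq_expMeasure (m := m) (θ := θ) hφm
      rw [hφ, lintegral_wNormSq_indicator hS, ← hA] at this
      rw [← this]
      exact ENNReal.pow_ne_top hφ2.2.ne
    have hle : ∀ i, 2 * ∫ z, F i z.1 z.2 * φ z ∂expMeasure m θ ≤ c.toReal + A.toReal := by
      intro i
      have hFm : Measurable fun z : ℝ × Phase => F i z.1 z.2 := hF i
      obtain ⟨hF2, -⟩ := memLp_expMeasure (m := m) (θ := θ) (hF i) (hFb i)
      set G : ℝ × Phase → ℝ := (Prod.fst ⁻¹' S).indicator fun z => F i z.1 z.2 with hG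
      have hGm : Measurable G := hFm.indicator hS'
      have hG2 : MemLp G 2 (expMeasure m θ) := hF2.indicator hS'
      have hGsq : ∫ z, G z ^ 2 ∂expMeasure m θ ≤ c.toReal := by
        rw [integral_sq_expMeasure hGm, hG, lintegral_wNormSq_indicator hS]
        exact ENNReal.toReal_mono hct (lintegral_mono fun t => mul_le_mul' le_rfl (hFb i t))
      rw [← hφsq]
      refine le_trans ?_ (add_le_add_left hGsq _)
      rw [← integral_const_mul, ← integral_add hG2.integrable_sq hφ2.integrable_sq]
      refine integral_mono ((hF2.integrable_mul hφ2).const_mul 2)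
        (hG2.integrable_sq.add hφ2.integrable_sq) fun z => ?_
      by_cases hz : z ∈ (Prod.fst ⁻¹' S : Set (ℝ × Phase))
      · simp only [hG, hφ, indicator_of_mem hz]
        nlinarith [sq_nonneg (F i z.1 z.2 - g z)]
      · simp [hG, hφ, indicator_of_notMem hz]
    have hl := le_of_tendsto ((hlim φ hφ2).const_mul 2) (Eventually.of_forall hle)
    have e : ∫ z, g z * φ z ∂expMeasure m θ = A.toReal := by
      rw [← hφsq]
      congr 1
      ext z
      by_cases hz : z ∈ (Prod.fst ⁻¹' S : Set (ℝ × Phase))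
      · simp only [hφ, indicator_of_mem hz]; ring
      · simp [hφ, indicator_of_notMem hz]
    rw [e] at hl
    exact (ENNReal.toReal_le_toReal hAt hct).1 (by linarith)
  filter_upwards [key] with t ht
  have h1 : wNormSq (maxwellian m θ) (fun p => g (t, p)) ≤ ENNReal.ofReal C ^ 2 :=
    (ENNReal.mul_le_mul_iff_right (by simpa using Real.exp_pos (-t)) ENNReal.ofReal_ne_top).1 ht
  rw [← eLpNorm_sq_weighted] at h1
  exact (ENNReal.pow_le_pow_left_iff (two_ne_zero)).1 h1

/-- Weak limits commute with the collision operator because it is linear and bounded: its adjoint is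
applied to the test function. -/
lemma exists_weak_limit_densities (hm : 0 < m) (hθ : 0 < θ) {ι : Type*} (U : Ultrafilter ι)
    {F : ι → ℝ → Phase → ℝ} {C : ℝ} (hF : ∀ i, Measurable (Function.uncurry (F i)))
    (hFb : ∀ i t, wNormSq (maxwellian m θ) (F i t) ≤ ENNReal.ofReal C ^ 2)
    {Y : Type*} [MeasureSpace Y] [SFinite (volume : Measure Y)]
    {k : Phase → Y → ℝ} {j : Phase → Y → Phase} {D : ℝ≥0∞}
    (hk : IsColKernel (maxwellian m θ) k j D) :
    ∃ g : ℝ → Phase → ℝ, Measurable (Function.uncurry g) ∧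
      (∀ t, wNormSq (maxwellian m θ) (g t) ≤ ENNReal.ofReal C ^ 2) ∧ (∀ t < 0, g t = 0) ∧
      ∀ φ : ℝ × Phase → ℝ, MemLp φ 2 (expMeasure m θ) →
        Tendsto (fun i => ∫ z, F i z.1 z.2 * φ z ∂expMeasure m θ) U
          (𝓝 (∫ z, g z.1 z.2 * φ z ∂expMeasure m θ)) ∧
        Tendsto (fun i => ∫ z, kerCol (maxwellian m θ) k j (F i z.1) z.2 * φ z ∂expMeasure m θ) U
          (𝓝 (∫ z, kerCol (maxwellian m θ) k j (g z.1) z.2 * φ z ∂expMeasure m θ)) := by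
  have hF2 := fun i => (memLp_expMeasure (m := m) (θ := θ) (hF i) (hFb i)).1
  have hFn := fun i => (memLp_expMeasure (m := m) (θ := θ) (hF i) (hFb i)).2
  obtain ⟨g0, hg0⟩ := exists_weak_limit U (x := fun i => (hF2 i).toLp _)
    (C := (ENNReal.ofReal C).toReal) (Eventually.of_forall fun i => by
      rw [Lp.norm_toLp]
      exact ENNReal.toReal_mono ENNReal.ofReal_ne_top (hFn i))
  have hg0m : Measurable g0 := (Lp.stronglyMeasurable g0).measurable
  have hg02 : MemLp g0 2 (expMeasure m θ) := Lp.memLp g0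
  have hlim0 : ∀ φ : ℝ × Phase → ℝ, MemLp φ 2 (expMeasure m θ) →
      Tendsto (fun i => ∫ z, F i z.1 z.2 * φ z ∂expMeasure m θ) U
        (𝓝 (∫ z, g0 z * φ z ∂expMeasure m θ)) := by
    intro φ hφ
    have := hg0 (hφ.toLp φ)
    simp only [integral_mul_eq_inner] at this
    rwa [show g0 = hg02.toLp g0 from (Lp.toLp_coeFn g0 hg02).symm, integral_mul_eq_inner] at this
  obtain ⟨g, hg, hgb, hgz, hae⟩ := (linftyL2Bound_of_weak_limit (U : Filter ι) hF hFb hg0m hg02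
    hlim0).exists_rep
  have hae' : g0 =ᵐ[expMeasure m θ] fun z => g z.1 z.2 := (ae_expMeasure_iff hm hθ).2 hae
  have hg2 := (memLp_expMeasure (m := m) (θ := θ) hg hgb).1
  have hgL : g0 = hg2.toLp _ := by
    rw [← Lp.toLp_coeFn g0 hg02, MemLp.toLp_eq_toLp_iff]
    exact hae'
  obtain ⟨Q, hQ⟩ := hk.exists_clm hm hθ
  refine ⟨g, hg, hgb, hgz, fun φ hφ => ⟨?_, ?_⟩⟩
  · refine (hlim0 φ hφ).congr' (EventuallyEq.refl _ _) |>.trans (le_of_eq ?_)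
    congr 1
    refine integral_congr_ae ?_
    filter_upwards [hae'] with z hz
    rw [hz]
  · have hin : ∀ (G : ℝ → Phase → ℝ) (hG : Measurable (Function.uncurry G))
        (hG2 : MemLp (fun z : ℝ × Phase => G z.1 z.2) 2 (expMeasure m θ)),
        inner ℝ (hG2.toLp _) (ContinuousLinearMap.adjoint Q (hφ.toLp φ))
          = ∫ z, kerCol (maxwellian m θ) k j (G z.1) z.2 * φ z ∂expMeasure m θ := by
      intro G hG hG2
      rw [real_inner_comm, ContinuousLinearMap.adjoint_inner_left, L2.inner_def]
      refine integral_congr_ae ?_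
      filter_upwards [hQ (fun z => G z.1 z.2) hG hG2, hφ.coeFn_toLp] with z h1 h2
      rw [h1, h2]
      simp
    have := hg0 (ContinuousLinearMap.adjoint Q (hφ.toLp φ))
    rw [hgL] at this
    simpa only [hin _ hg hg2, fun i => hin _ (hF i) (hF2 i)] using this

end limit

/-! ### Weak solutions -/

section weak

variable {m θ : ℝ}

lemma ae_timePhase_of_ae {P : Phase → Prop} (h : ∀ᵐ p, P p) : ∀ᵐ z ∂timePhase, P z.2 :=
  Measure.quasiMeasurePreserving_snd.ae h

lemma wNormSq_smul (M : R3 → ℝ) (c : ℝ) (u : Phase → ℝ) :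
    wNormSq M (c • u) = ‖c‖ₑ ^ 2 * wNormSq M u := by
  rw [wNormSq, wNormSq, ← lintegral_const_mul' _ _ (by finiteness)]
  refine lintegral_congr fun p => ?_
  simp only [Pi.smul_apply, smul_eq_mul, enorm_mul]
  ring

lemma locallyIntegrable_timePhase (hm : 0 < m) (hθ : 0 < θ) {h : ℝ → Phase → ℝ}
    (hh : Measurable (Function.uncurry h)) {D : ℝ≥0∞} (hD : D ≠ ∞)
    (hb : ∀ t, wNormSq (maxwellian m θ) (h t) ≤ D) :
    LocallyIntegrable (fun z : ℝ × Phase => h z.1 z.2) timePhase := by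
  intro z
  obtain ⟨s, hs, hi⟩ := locallyIntegrable_of_memLp_two_closedBall
    (memLp_two_restrict_closedBall hm hθ hh hD hb) z
  exact ⟨s, hs, hi.mono_measure timePhase_le⟩

lemma integrable_mul_of_hasCompactSupport {X : Type*} [MeasurableSpace X] [TopologicalSpace X]
    [OpensMeasurableSpace X] [T2Space X] {μ : Measure X} {u Θ : X → ℝ}
    (hu : LocallyIntegrable u μ) (hΘ : Continuous Θ) (hΘc : HasCompactSupport Θ) :
    Integrable (fun z => u z * Θ z) μ :=
  (hu.integrable_smul_left_of_hasCompactSupport hΘ hΘc).congr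
    (Eventually.of_forall fun z => by simp [mul_comm])

lemma hasCompactSupport_fderiv_apply {V : Type*} [NormedAddCommGroup V] [NormedSpace ℝ V]
    {ψ : V → ℝ} (hψ : HasCompactSupport ψ) (a : V → V) :
    HasCompactSupport fun z => fderiv ℝ ψ z (a z) :=
  (hψ.fderiv (𝕜 := ℝ)).mono' fun z hz => subset_tsupport _ fun h0 => hz (by simp [h0])

lemma continuous_fderiv_apply {V : Type*} [NormedAddCommGroup V] [NormedSpace ℝ V]
    {ψ : V → ℝ} (hψ : ContDiff ℝ 1 ψ) {a : V → V} (ha : Continuous a) :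
    Continuous fun z => fderiv ℝ ψ z (a z) := by
  have := hψ.continuous_fderiv (by simp)
  fun_prop

variable {Y : Type*} [MeasureSpace Y] [SFinite (volume : Measure Y)]
  {k : Phase → Y → ℝ} {j : Phase → Y → Phase} {D : ℝ≥0∞} {c : ℝ}
  {Q : (Phase → ℝ) → Phase → ℝ}

/-- Solutions and fields are only known up to null sets. The collision integral evaluates a density
along lower dimensional fibres, so its invariance relies on `kerCol_congr_prod`. -/
lemma IsWeakSolution.congr {a a' : Phase → Phase} {f₀ : Phase → ℝ} {f f' : ℝ → Phase → ℝ}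
    (hk : IsColKernel (maxwellian m θ) k j D) (hQ : ∀ u, Q u = c • kerCol (maxwellian m θ) k j u)
    (ha : a =ᵐ[volume] a') (hf : ∀ᵐ z ∂timePhase, f z.1 z.2 = f' z.1 z.2)
    (h : IsWeakSolution a Q f₀ f) : IsWeakSolution a' Q f₀ f' := by
  intro ψ hψ hψc
  have e1 : ∫ z, f' z.1 z.2 * fderiv ℝ ψ z (1, a' z.2) ∂timePhase
      = ∫ z, f z.1 z.2 * fderiv ℝ ψ z (1, a z.2) ∂timePhase := by
    refine integral_congr_ae ?_
    filter_upwards [hf, ae_timePhase_of_ae ha] with z h1 h2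
    rw [h1, h2]
  have e2 : ∫ z, Q (f' z.1) z.2 * ψ z ∂timePhase = ∫ z, Q (f z.1) z.2 * ψ z ∂timePhase := by
    refine integral_congr_ae ?_
    filter_upwards [hk.kerCol_congr_prod hf] with z hz
    simp only [hQ, Pi.smul_apply, hz]
  rw [e1, e2]
  exact h ψ hψ hψc

namespace IsColKernel

lemma wNormSq_Q_le (hk : IsColKernel (maxwellian m θ) k j D)
    (hQ : ∀ u, Q u = c • kerCol (maxwellian m θ) k j u) {u : Phase → ℝ} (hu : Measurable u)
    (hu2 : wNormSq (maxwellian m θ) u < ∞) :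
    wNormSq (maxwellian m θ) (Q u) ≤ ‖c‖ₑ ^ 2 * (4 * D ^ 2) * wNormSq (maxwellian m θ) u := by
  rw [hQ, wNormSq_smul, mul_assoc]
  exact mul_le_mul' le_rfl (hk.wNormSq_kerCol_le hu hu2)

set_option linter.unusedSectionVars false in
lemma bound_ne_top (hk : IsColKernel (maxwellian m θ) k j D) : ‖c‖ₑ ^ 2 * (4 * D ^ 2) ≠ ∞ := by
  have := hk.ne_top
  finiteness

lemma measurable_Q (hk : IsColKernel (maxwellian m θ) k j D)
    (hQ : ∀ u, Q u = c • kerCol (maxwellian m θ) k j u) {f : ℝ → Phase → ℝ}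
    (hf : Measurable (Function.uncurry f)) : Measurable fun z : ℝ × Phase => Q (f z.1) z.2 := by
  simp only [hQ, Pi.smul_apply]
  exact (hk.measurable_kerCol hf).const_smul c

lemma locallyIntegrable_Q (hk : IsColKernel (maxwellian m θ) k j D) (hm : 0 < m) (hθ : 0 < θ)
    (hQ : ∀ u, Q u = c • kerCol (maxwellian m θ) k j u) {f : ℝ → Phase → ℝ}
    (hf : Measurable (Function.uncurry f)) {C : ℝ≥0∞} (hC : C ≠ ∞)
    (hb : ∀ t, wNormSq (maxwellian m θ) (f t) ≤ C) :
    LocallyIntegrable (fun z : ℝ × Phase => Q (f z.1) z.2) timePhase := by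
  refine locallyIntegrable_timePhase (h := fun t => Q (f t)) hm hθ (hk.measurable_Q hQ hf)
    (ENNReal.mul_ne_top (hk.bound_ne_top (c := c)) hC) fun t => ?_
  exact (hk.wNormSq_Q_le hQ (hf.comp measurable_prodMk_left) ((hb t).trans_lt hC.lt_top)).trans
    (mul_le_mul' le_rfl (hb t))

end IsColKernel

/-! ### Uniqueness for the limit problem -/

lemma integral_timePhase_eq {f : ℝ × Phase → ℝ} (hf : ∀ z : ℝ × Phase, z.1 < 0 → f z = 0) :
    ∫ z, f z ∂timePhase = ∫ z, f z := by
  rw [timePhase_eq]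
  refine setIntegral_eq_integral_of_forall_compl_eq_zero fun z hz => hf z ?_
  by_contra hcon
  exact hz ⟨not_lt.1 hcon, mem_univ _⟩

/-- In the difference of two solutions the initial data cancel. Extended by zero to negative times,
it satisfies the weak equation on all of `ℝ × Phase` without boundary term, so the energy estimate
with the weight `gibbs` applies. -/
lemma IsRegularPotential.weakSolution_unique {Ψ : R3 → ℝ} {E : R3 → R3} {K : ℝ≥0} {C : ℝ}
    (h : IsRegularPotential Ψ E K C) (hm : 0 < m) (hθ : 0 < θ) (q B : ℝ)
    (hk : IsColKernel (maxwellian m θ) k j D) (hQ : ∀ u, Q u = c • kerCol (maxwellian m θ) k j u)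
    {f₀ : Phase → ℝ} {f g : ℝ → Phase → ℝ} (hf : MemLinftyL2 m θ f) (hg : MemLinftyL2 m θ g)
    (hfs : IsWeakSolution (limitField m q B E) Q f₀ f)
    (hgs : IsWeakSolution (limitField m q B E) Q f₀ g) :
    ∀ᵐ z ∂timePhase, f z.1 z.2 = g z.1 z.2 := by
  obtain ⟨C₁, hf⟩ := hf
  obtain ⟨C₂, hg⟩ := hg
  obtain ⟨f', hfm, hfb, hfz, hfe⟩ := hf.exists_rep
  obtain ⟨g', hgm, hgb, hgz, hge⟩ := hg.exists_rep
  have hfs' := hfs.congr hk hQ (EventuallyEq.refl _ _) hfe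
  have hgs' := hgs.congr hk hQ (EventuallyEq.refl _ _) hge
  have hC1 : ENNReal.ofReal C₁ ^ 2 ≠ ∞ := by finiteness
  have hC2 : ENNReal.ofReal C₂ ^ 2 ≠ ∞ := by finiteness
  -- Written with a scalar multiple so that linearity of the collision operator follows from
  -- `kerCol_add` and `kerCol_smul`.
  set d : ℝ → Phase → ℝ := fun t => f' t + (-1 : ℝ) • g' t with hd
  have hdm : Measurable (Function.uncurry d) := hfm.add (hgm.const_smul (-1 : ℝ))
  have hdb : ∀ t, wNormSq (maxwellian m θ) (d t)
      ≤ 2 * ENNReal.ofReal C₁ ^ 2 + 2 * ENNReal.ofReal C₂ ^ 2 := by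
    intro t
    have hM := measurable_maxwellian m θ
    have hft : Measurable (f' t) := hfm.comp measurable_prodMk_left
    have hgt : Measurable (g' t) := hgm.comp measurable_prodMk_left
    calc wNormSq (maxwellian m θ) (d t)
        ≤ ∫⁻ p, (2 * (‖f' t p‖ₑ ^ 2 * ENNReal.ofReal (maxwellian m θ p.2)⁻¹)
            + 2 * (‖g' t p‖ₑ ^ 2 * ENNReal.ofReal (maxwellian m θ p.2)⁻¹)) := by
          refine lintegral_mono fun p => ?_
          have h1 : ‖d t p‖ₑ ≤ ‖f' t p‖ₑ + ‖g' t p‖ₑ := by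
            simp only [hd, Pi.add_apply, neg_smul, one_smul]
            refine (enorm_add_le _ _).trans ?_
            rw [Pi.neg_apply, enorm_neg]
          have h2 : ‖d t p‖ₑ ^ 2 ≤ 2 * ‖f' t p‖ₑ ^ 2 + 2 * ‖g' t p‖ₑ ^ 2 := by
            refine (pow_le_pow_left' h1 2).trans ?_
            have := ENNReal.rpow_add_le_mul_rpow_add_rpow ‖f' t p‖ₑ ‖g' t p‖ₑ
              (one_le_two : (1 : ℝ) ≤ 2)
            norm_num at this
            rwa [mul_add] at this
          calc _ ≤ (2 * ‖f' t p‖ₑ ^ 2 + 2 * ‖g' t p‖ₑ ^ 2) *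
                ENNReal.ofReal (maxwellian m θ p.2)⁻¹ := mul_le_mul' h2 le_rfl
            _ = _ := by ring
      _ = 2 * wNormSq (maxwellian m θ) (f' t) + 2 * wNormSq (maxwellian m θ) (g' t) := by
          rw [lintegral_add_left (by fun_prop), lintegral_const_mul _ (by fun_prop),
            lintegral_const_mul _ (by fun_prop)]
          rfl
      _ ≤ _ := by gcongr <;> simp [hfb, hgb]
  have hdt : 2 * ENNReal.ofReal C₁ ^ 2 + 2 * ENNReal.ofReal C₂ ^ 2 ≠ ∞ := by finiteness
  have hdz : ∀ t < 0, d t = 0 := fun t ht => by simp [hd, hfz t ht, hgz t ht]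
  have hQz : ∀ t < 0, Q (d t) = 0 := fun t ht => by
    rw [hdz t ht, hQ]; ext p; simp [kerCol]
  obtain ⟨K', hK'⟩ := h.exists_lipschitz_limitField m q B
  obtain ⟨c₁, c₂, hc₁, hc₂, hWb⟩ := h.exists_gibbs_bounds hm hθ q (omegaC m q B)
  have hQd : ∀ᵐ z ∂timePhase, Q (d z.1) z.2 = Q (f' z.1) z.2 - Q (g' z.1) z.2 := by
    refine (Measure.ae_prod_iff_ae_ae (measurableSet_eq_fun (hk.measurable_Q hQ hdm)
      ((hk.measurable_Q hQ hfm).sub (hk.measurable_Q hQ hgm)))).2 (Eventually.of_forall fun t => ?_)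
    have hgt : Measurable (g' t) := hgm.comp measurable_prodMk_left
    have hw : wNormSq (maxwellian m θ) ((-1 : ℝ) • g' t) < ∞ := by
      rw [wNormSq_smul]
      exact ENNReal.mul_lt_top (by finiteness) ((hgb t).trans_lt hC2.lt_top)
    filter_upwards [hk.kerCol_add (hfm.comp measurable_prodMk_left) ((hfb t).trans_lt hC1.lt_top)
      (hgt.const_smul (-1 : ℝ)) hw] with p hp
    have hp' : kerCol (maxwellian m θ) k j (d t) p
        = kerCol (maxwellian m θ) k j (f' t) p - kerCol (maxwellian m θ) k j (g' t) p := by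
      refine hp.trans ?_
      rw [Pi.add_apply, IsColKernel.kerCol_smul]
      simp [sub_eq_add_neg]
      rfl
    change Q (d t) p = Q (f' t) p - Q (g' t) p
    rw [hQ, hQ, hQ, Pi.smul_apply, Pi.smul_apply, Pi.smul_apply, hp', smul_sub]
  have hzero := ae_eq_zero_of_weak hm hθ hK'
    (fun ρ hρ hρc => h.integral_fderiv_limitField m q B hρ hρc)
    (h.contDiff_gibbs m q θ (omegaC m q B)) (h.fderiv_gibbs_limitField hm.ne' q B θ) hc₁ hc₂ hWb
    hdm (g := fun t => Q (d t)) (hk.measurable_Q hQ hdm) hdt (hk.bound_ne_top (c := c)) hdb hdz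
    (fun t => hk.wNormSq_Q_le hQ (hdm.comp measurable_prodMk_left)
      ((hdb t).trans_lt hdt.lt_top)) (fun ψ hψ hψc => by
      rw [← integral_timePhase_eq (fun z hz => by simp [hdz z.1 hz]),
        ← integral_timePhase_eq (fun z hz => by simp [hQz z.1 hz])]
      have hcont : Continuous fun z : ℝ × Phase => fderiv ℝ ψ z (1, limitField m q B E z.2) :=
        continuous_fderiv_apply hψ (a := fun z : ℝ × Phase => (1, limitField m q B E z.2))
          (continuous_const.prodMk (hK'.continuous.comp continuous_snd))
      have hcs : HasCompactSupport fun z : ℝ × Phase =>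
          fderiv ℝ ψ z (1, limitField m q B E z.2) :=
        hasCompactSupport_fderiv_apply hψc fun z : ℝ × Phase => (1, limitField m q B E z.2)
      have i1 := integrable_mul_of_hasCompactSupport
        (locallyIntegrable_timePhase hm hθ hfm hC1 hfb) hcont hcs
      have i2 := integrable_mul_of_hasCompactSupport
        (locallyIntegrable_timePhase hm hθ hgm hC2 hgb) hcont hcs
      have i3 := integrable_mul_of_hasCompactSupport
        (hk.locallyIntegrable_Q hm hθ hQ hfm hC1 hfb) hψ.continuous hψc
      have i4 := integrable_mul_of_hasCompactSupport
        (hk.locallyIntegrable_Q hm hθ hQ hgm hC2 hgb) hψ.continuous hψc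
      have s1 := hfs' ψ hψ hψc
      have s2 := hgs' ψ hψ hψc
      have e1 : ∫ z, d z.1 z.2 * fderiv ℝ ψ z (1, limitField m q B E z.2) ∂timePhase
          = (∫ z, f' z.1 z.2 * fderiv ℝ ψ z (1, limitField m q B E z.2) ∂timePhase)
            - ∫ z, g' z.1 z.2 * fderiv ℝ ψ z (1, limitField m q B E z.2) ∂timePhase := by
        rw [← integral_sub i1 i2]
        congr 1
        ext z
        simp [hd]
        ring
      have e2 : ∫ z, Q (d z.1) z.2 * ψ z ∂timePhase
          = (∫ z, Q (f' z.1) z.2 * ψ z ∂timePhase) - ∫ z, Q (g' z.1) z.2 * ψ z ∂timePhase := by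
        rw [← integral_sub i3 i4]
        refine integral_congr_ae ?_
        filter_upwards [hQd] with z hz
        rw [hz]; ring
      rw [e1, e2]
      linarith)
  have hzero' : ∀ᵐ z ∂timePhase, d z.1 z.2 = 0 :=
    (Measure.absolutelyContinuous_of_le timePhase_le).ae_le hzero
  filter_upwards [hzero', hfe, hge] with z h1 h2 h3
  rw [h2, h3]
  simp only [hd, Pi.add_apply, neg_smul, one_smul, Pi.neg_apply] at h1
  linarith

end weak

/-! ### The limit equation -/

section limit

variable {ω : ℝ} {g : ℝ → Phase → ℝ}

/-- The null set depends on the angle, and the quantifiers are exchanged through the average: `g`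
agrees almost everywhere with `gyroAvg ω g`, which is invariant under every rotation exactly. -/
lemma ae_forall_larmor_of_invariant (hg : Measurable (Function.uncurry g))
    (hinv : ∀ α, ∀ᵐ z ∂timePhase, g z.1 (larmor ω α z.2) = g z.1 z.2) :
    ∀ᵐ t ∂(volume : Measure ℝ).restrict (Ici 0),
      ∀ α, (fun p => g t (larmor ω α p)) =ᵐ[volume] g t := by
  have hT := (isAngleFlow_larmorT ω).continuous.measurable
  have hms : MeasurableSet {a : ℝ × (ℝ × Phase) |
      g a.2.1 (larmor ω a.1 a.2.2) = g a.2.1 a.2.2} :=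
    measurableSet_eq_fun (hg.comp hT) (hg.comp measurable_snd)
  have h1 : ∀ᵐ z ∂timePhase, ∀ᵐ α ∂gyroMeasure, g z.1 (larmor ω α z.2) = g z.1 z.2 :=
    (Measure.ae_ae_comm hms).1 (Eventually.of_forall hinv)
  have h2 : ∀ᵐ z ∂timePhase, gyroAvg ω (g z.1) z.2 = g z.1 z.2 := by
    filter_upwards [h1] with z hz
    rw [gyroAvg_eq, integral_congr_ae hz]
    simp
  filter_upwards [Measure.ae_ae_of_ae_prod h2] with t ht α
  have h3 := (measurePreserving_larmor ω α).quasiMeasurePreserving.ae ht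
  filter_upwards [ht, h3] with p h4 h5
  rw [← h5, ← h4, gyroAvg_larmor]

variable {m q B : ℝ} {Ψ : R3 → ℝ} {E : R3 → R3} {K : ℝ≥0} {C : ℝ}

lemma IsRegularPotential.continuous_slowField (h : IsRegularPotential Ψ E K C) (m q : ℝ) :
    Continuous (slowField m q E) := by
  have hE : Continuous E := by
    refine (PiLp.continuous_toLp 2 _).comp (g := WithLp.toLp 2)
      (f := fun x => fun i => E x i) (continuous_pi fun i => (h.lipschitz i).continuous)
  have hE' : Continuous fun p : Phase => E p.1 := hE.comp continuous_fst
  unfold slowField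
  fun_prop

lemma IsWeakSolution.eps_split (h : IsRegularPotential Ψ E K C) {Q : (Phase → ℝ) → Phase → ℝ}
    {f₀ : Phase → ℝ} {f : ℝ → Phase → ℝ} {ε : ℝ}
    (hs : IsWeakSolution (epsField m q B E ε) Q f₀ f)
    (hf : LocallyIntegrable (fun z : ℝ × Phase => f z.1 z.2) timePhase)
    {ψ : ℝ × Phase → ℝ} (hψ : ContDiff ℝ 1 ψ) (hψc : HasCompactSupport ψ) :
    (∫ z, f z.1 z.2 * fderiv ℝ ψ z (1, slowField m q E z.2) ∂timePhase)
      + ε⁻¹ * (∫ z, f z.1 z.2 * fderiv ℝ ψ z (0, cyclotronField (omegaC m q B) z.2) ∂timePhase)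
      + ∫ p, f₀ p * ψ (0, p) = -∫ z, Q (f z.1) z.2 * ψ z ∂timePhase := by
  rw [← hs ψ hψ hψc]
  have hc1 : Continuous fun z : ℝ × Phase => ((1 : ℝ), slowField m q E z.2) :=
    continuous_const.prodMk ((h.continuous_slowField m q).comp continuous_snd)
  have hc2 : Continuous fun z : ℝ × Phase => ((0 : ℝ), cyclotronField (omegaC m q B) z.2) :=
    continuous_const.prodMk ((continuous_cyclotronField _).comp continuous_snd)
  have i1 := integrable_mul_of_hasCompactSupport hf (continuous_fderiv_apply hψ hc1)
    (hasCompactSupport_fderiv_apply hψc _)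
  have i2 := integrable_mul_of_hasCompactSupport hf (continuous_fderiv_apply hψ hc2)
    (hasCompactSupport_fderiv_apply hψc _)
  rw [← integral_const_mul, ← integral_add i1 (i2.const_mul _)]
  congr 2
  ext z
  have : ((1 : ℝ), epsField m q B E ε z.2) = (1, slowField m q E z.2)
      + ε⁻¹ • ((0 : ℝ), cyclotronField (omegaC m q B) z.2) := by
    simp [epsField_eq]
  rw [this, map_add, map_smul, smul_eq_mul]
  ring

variable {U : Ultrafilter ℝ} {Q : (Phase → ℝ) → Phase → ℝ} {f₀ : Phase → ℝ}
  {F : ℝ → ℝ → Phase → ℝ}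

/-- The weak limits are invariant under the cyclotronic flow. -/
lemma IsRegularPotential.invariant_of_weak_limit (h : IsRegularPotential Ψ E K C)
    (hω : omegaC m q B ≠ 0) (hU : (U : Filter ℝ) ≤ 𝓝[>] 0)
    (hs : ∀ᶠ ε in U, IsWeakSolution (epsField m q B E ε) Q f₀ (F ε))
    (hF : ∀ ε, LocallyIntegrable (fun z : ℝ × Phase => F ε z.1 z.2) timePhase)
    (hg : LocallyIntegrable (fun z : ℝ × Phase => g z.1 z.2) timePhase)
    (hlim : ∀ Θ : ℝ × Phase → ℝ, Continuous Θ → HasCompactSupport Θ →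
      Tendsto (fun ε => ∫ z, F ε z.1 z.2 * Θ z ∂timePhase) U
        (𝓝 (∫ z, g z.1 z.2 * Θ z ∂timePhase)))
    (hlimQ : ∀ Θ : ℝ × Phase → ℝ, Continuous Θ → HasCompactSupport Θ →
      Tendsto (fun ε => ∫ z, Q (F ε z.1) z.2 * Θ z ∂timePhase) U
        (𝓝 (∫ z, Q (g z.1) z.2 * Θ z ∂timePhase))) (α : ℝ) :
    ∀ᵐ z ∂timePhase, g z.1 (larmor (omegaC m q B) α z.2) = g z.1 z.2 := by
  refine larmor_ae_eq_of_weak_time hω hg (fun ψ hψ hψc => ?_) α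
  have hc1 : Continuous fun z : ℝ × Phase => ((1 : ℝ), slowField m q E z.2) :=
    continuous_const.prodMk ((h.continuous_slowField m q).comp continuous_snd)
  have hc2 : Continuous fun z : ℝ × Phase => ((0 : ℝ), cyclotronField (omegaC m q B) z.2) :=
    continuous_const.prodMk ((continuous_cyclotronField _).comp continuous_snd)
  have t1 := hlim _ (continuous_fderiv_apply hψ hc1) (hasCompactSupport_fderiv_apply hψc _)
  have t2 := hlim _ (continuous_fderiv_apply hψ hc2) (hasCompactSupport_fderiv_apply hψc _)
  have t3 := hlimQ _ hψ.continuous hψc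
  have hε : Tendsto (fun ε : ℝ => ε) U (𝓝 0) := hU.trans nhdsWithin_le_nhds
  have hpos : ∀ᶠ ε : ℝ in U, 0 < ε := hU self_mem_nhdsWithin
  -- The equation multiplied by `ε`: every term except the fast one is bounded and disappears in the
  -- limit.
  have t4 := hε.neg.mul ((t1.add_const (∫ p, f₀ p * ψ (0, p))).add t3)
  rw [neg_zero, zero_mul] at t4
  refine tendsto_nhds_unique t2 (t4.congr' ?_)
  filter_upwards [hs, hpos] with ε h1 h2
  have h3 := h1.eps_split h (hF ε) hψ hψc
  have h4 : ε * ε⁻¹ = 1 := mul_inv_cancel₀ h2.ne'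
  linear_combination -ε * h3
    + (∫ z, F ε z.1 z.2 * fderiv ℝ ψ z (0, cyclotronField (omegaC m q B) z.2) ∂timePhase) * h4

/-- Averaged test functions do not see the fast motion. -/
lemma IsRegularPotential.weak_limit_avgTest (h : IsRegularPotential Ψ E K C)
    (hω : omegaC m q B ≠ 0)
    (hs : ∀ᶠ ε in U, IsWeakSolution (epsField m q B E ε) Q f₀ (F ε))
    (hF : ∀ ε, LocallyIntegrable (fun z : ℝ × Phase => F ε z.1 z.2) timePhase)
    (hlim : ∀ Θ : ℝ × Phase → ℝ, Continuous Θ → HasCompactSupport Θ →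
      Tendsto (fun ε => ∫ z, F ε z.1 z.2 * Θ z ∂timePhase) U
        (𝓝 (∫ z, g z.1 z.2 * Θ z ∂timePhase)))
    (hlimQ : ∀ Θ : ℝ × Phase → ℝ, Continuous Θ → HasCompactSupport Θ →
      Tendsto (fun ε => ∫ z, Q (F ε z.1) z.2 * Θ z ∂timePhase) U
        (𝓝 (∫ z, Q (g z.1) z.2 * Θ z ∂timePhase)))
    {ψ : ℝ × Phase → ℝ} (hψ : ContDiff ℝ 1 ψ) (hψc : HasCompactSupport ψ) :
    (∫ z, g z.1 z.2 *
        fderiv ℝ (avgTest (omegaC m q B) ψ) z (1, slowField m q E z.2) ∂timePhase)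
      + ∫ p, f₀ p * avgTest (omegaC m q B) ψ (0, p)
      = -∫ z, Q (g z.1) z.2 * avgTest (omegaC m q B) ψ z ∂timePhase := by
  have hψ' := contDiff_avgTest (ω := omegaC m q B) hψ
  have hψc' := hasCompactSupport_avgTest (ω := omegaC m q B) hψc
  have hc1 : Continuous fun z : ℝ × Phase => ((1 : ℝ), slowField m q E z.2) :=
    continuous_const.prodMk ((h.continuous_slowField m q).comp continuous_snd)
  have t1 := hlim _ (continuous_fderiv_apply hψ' hc1) (hasCompactSupport_fderiv_apply hψc' _)
  have t3 := hlimQ _ hψ'.continuous hψc'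
  refine tendsto_nhds_unique (t1.add_const _) (t3.neg.congr' ?_)
  filter_upwards [hs] with ε h1
  have h3 := h1.eps_split h (hF ε) hψ' hψc'
  simp only [fderiv_avgTest_cyclotronField hω hψ, mul_zero, integral_zero, add_zero] at h3
  exact h3.symm

end limit

/-! ### The averaged equation satisfied by the weak limits -/

section equation

variable {m q B θ τ : ℝ} {Ψ : R3 → ℝ} {E : R3 → R3} {K : ℝ≥0} {C : ℝ} {g : ℝ → Phase → ℝ}
  {σ : ℝ → ℝ} {s₀ S₀ : ℝ} {D : ℝ≥0∞}

/-- Since `g` is invariant, both integrands may be replaced by their means over Larmor circles, and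
these means agree wherever the perpendicular velocity is nonzero. -/
lemma IsRegularPotential.integral_invariant_slowField (h : IsRegularPotential Ψ E K C)
    (hm : m ≠ 0) (hq : q ≠ 0) (hB : B ≠ 0) (hg : Measurable (Function.uncurry g))
    (hgl : LocallyIntegrable (fun z : ℝ × Phase => g z.1 z.2) timePhase)
    (hinv : ∀ α, ∀ᵐ z ∂timePhase, g z.1 (larmor (omegaC m q B) α z.2) = g z.1 z.2)
    {ψ : ℝ × Phase → ℝ} (hψ : ContDiff ℝ 1 ψ) (hψc : HasCompactSupport ψ) :
    ∫ z, g z.1 z.2 *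
        fderiv ℝ (avgTest (omegaC m q B) ψ) z (1, slowField m q E z.2) ∂timePhase
      = ∫ z, g z.1 z.2 * fderiv ℝ ψ z (1, limitField m q B E z.2) ∂timePhase := by
  have hψ' := contDiff_avgTest (ω := omegaC m q B) hψ
  have hψc' := hasCompactSupport_avgTest (ω := omegaC m q B) hψc
  obtain ⟨K', hK'⟩ := h.exists_lipschitz_limitField m q B
  have hc1 : Continuous fun z : ℝ × Phase => ((1 : ℝ), slowField m q E z.2) :=
    continuous_const.prodMk ((h.continuous_slowField m q).comp continuous_snd)
  have hc2 : Continuous fun z : ℝ × Phase => ((1 : ℝ), limitField m q B E z.2) :=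
    continuous_const.prodMk (hK'.continuous.comp continuous_snd)
  have hfl := isAngleFlow_larmorT (omegaC m q B)
  have hg' : Measurable fun z : ℝ × Phase => g z.1 z.2 := hg
  rw [← hfl.integral_mul_avg_of_invariant hg' hgl hinv (continuous_fderiv_apply hψ' hc1)
      (hasCompactSupport_fderiv_apply hψc' _),
    ← hfl.integral_mul_avg_of_invariant hg' hgl hinv (continuous_fderiv_apply hψ hc2)
      (hasCompactSupport_fderiv_apply hψc _)]
  refine integral_congr_ae ?_
  filter_upwards [ae_timePhase_of_ae ae_bar_snd_ne_zero] with z hz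
  rw [h.integral_fderiv_avgTest_slowField hm hq hB hψ z hz,
    integral_fderiv_limitField_larmorT m q B E hψ z]

/-- Symmetry of the average transfers it from the test function to the initial datum; this is why
the limit starts from the averaged datum. -/
lemma integral_mul_avgTest_zero {ω : ℝ} {f₀ : Phase → ℝ} (hf₀ : Integrable f₀)
    {ψ : ℝ × Phase → ℝ} (hψ : Continuous ψ) (hψc : HasCompactSupport ψ) :
    ∫ p, f₀ p * avgTest ω ψ (0, p) = ∫ p, gyroAvg ω f₀ p * ψ (0, p) := by
  obtain ⟨f₁, hf₁, he⟩ := hf₀.aestronglyMeasurable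
  have hi := hf₀.congr he
  have hcs : HasCompactSupport fun p : Phase => ψ (0, p) :=
    hψc.comp_isClosedEmbedding ⟨isEmbedding_prodMkRight 0, by
      have : range (Prod.mk (0 : ℝ) : Phase → ℝ × Phase) = Prod.fst ⁻¹' {0} := by
        ext ⟨t, p⟩
        simp [eq_comm]
      rw [this]
      exact isClosed_singleton.preimage continuous_fst⟩
  have e1 := (isAngleFlow_larmor ω).integral_mul_avg hf₁.measurable hi.locallyIntegrable
    (F := fun p => ψ (0, p)) (by fun_prop) hcs
  have e2 : ∫ p, f₀ p * avgTest ω ψ (0, p) = ∫ p, f₁ p * avgTest ω ψ (0, p) := by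
    refine integral_congr_ae ?_
    filter_upwards [he] with p hp
    rw [hp]
  have e3 : ∫ p, gyroAvg ω f₀ p * ψ (0, p) = ∫ p, gyroAvg ω f₁ p * ψ (0, p) := by
    refine integral_congr_ae ?_
    filter_upwards [gyroAvg_congr (ω := ω) he] with p hp
    rw [hp]
  rw [e2, e3]
  simp only [gyroAvg_eq]
  exact e1

/-- The average is moved from the test function to the collision term. At almost every time the
density is invariant under all rotations, and there the averaged collision term is given by the
explicit kernel. -/
lemma integral_QB_mul_avgTest (hm : 0 < m) (hθ : 0 < θ) (hσ : Measurable σ) (hs₀ : 0 < s₀)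
    (hσ_bound : ∀ r : ℝ, 0 ≤ r → s₀ ≤ σ r ∧ σ r ≤ S₀) {ω : ℝ} (hω : ω ≠ 0) (τ : ℝ)
    (hg : Measurable (Function.uncurry g)) (hD : D ≠ ∞)
    (hb : ∀ t, wNormSq (maxwellian m θ) (g t) ≤ D)
    (hinv : ∀ α, ∀ᵐ z ∂timePhase, g z.1 (larmor ω α z.2) = g z.1 z.2)
    {ψ : ℝ × Phase → ℝ} (hψ : Continuous ψ) (hψc : HasCompactSupport ψ) :
    ∫ z, QB m θ τ (fun v v' => σ ‖v - v'‖) (g z.1) z.2 * avgTest ω ψ z ∂timePhase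
      = ∫ z, avgQB m θ τ ω σ (g z.1) z.2 * ψ z ∂timePhase := by
  have hK := isColKernel_relax hm hθ hσ hs₀ hσ_bound
  have hA := isColKernel_avg hm hθ hσ hs₀ hσ_bound hω
  have hQm := hK.measurable_Q (QB_eq_kerCol m θ τ σ) hg
  have hAm := hA.measurable_Q (avgQB_eq_kerCol m θ τ ω σ) hg
  have e1 := (isAngleFlow_larmorT ω).integral_mul_avg hQm
    (hK.locallyIntegrable_Q hm hθ (QB_eq_kerCol m θ τ σ) hg hD hb) hψ hψc
  refine e1.trans (integral_congr_ae ?_)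
  have hT := (isAngleFlow_larmorT ω).continuous.measurable
  have hGm : Measurable fun z : ℝ × Phase =>
      ∫ α, QB m θ τ (fun v v' => σ ‖v - v'‖) (g (larmorT ω α z).1) (larmorT ω α z).2
        ∂gyroMeasure := by
    refine (StronglyMeasurable.integral_prod_left' (f := fun a : ℝ × (ℝ × Phase) =>
      QB m θ τ (fun v v' => σ ‖v - v'‖) (g (larmorT ω a.1 a.2).1) (larmorT ω a.1 a.2).2)
      (Measurable.stronglyMeasurable ?_)).measurable
    exact hQm.comp hT
  have key : ∀ᵐ z ∂timePhase,
      ∫ α, QB m θ τ (fun v v' => σ ‖v - v'‖) (g (larmorT ω α z).1) (larmorT ω α z).2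
        ∂gyroMeasure = avgQB m θ τ ω σ (g z.1) z.2 := by
    refine (Measure.ae_prod_iff_ae_ae (measurableSet_eq_fun hGm hAm)).2 ?_
    filter_upwards [ae_forall_larmor_of_invariant hg hinv] with t ht
    have hgt : Measurable (g t) := hg.comp measurable_prodMk_left
    filter_upwards [gyroAvg_QB_of_invariant hm hθ hσ hs₀ hσ_bound hω τ hgt
      ((hb t).trans_lt hD.lt_top) ht] with p hp
    rw [← hp, gyroAvg_eq]
    rfl
  filter_upwards [key] with z hz
  rw [hz]

/-- Weak limits of the solutions of the penalized problems solve the averaged problem. -/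
lemma IsRegularPotential.isWeakSolution_of_weak_limit (h : IsRegularPotential Ψ E K C)
    (hm : 0 < m) (hq : q ≠ 0) (hB : 0 < B) (hθ : 0 < θ) (hσ : Measurable σ) (hs₀ : 0 < s₀)
    (hσ_bound : ∀ r : ℝ, 0 ≤ r → s₀ ≤ σ r ∧ σ r ≤ S₀)
    {U : Ultrafilter ℝ} (hU : (U : Filter ℝ) ≤ 𝓝[>] 0) {f₀ : Phase → ℝ} (hf₀ : Integrable f₀)
    {F : ℝ → ℝ → Phase → ℝ}
    (hs : ∀ᶠ ε in U, IsWeakSolution (epsField m q B E ε)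
      (QB m θ τ (fun v v' => σ ‖v - v'‖)) f₀ (F ε))
    (hFm : ∀ ε, Measurable (Function.uncurry (F ε))) (hD : D ≠ ∞)
    (hFb : ∀ ε t, wNormSq (maxwellian m θ) (F ε t) ≤ D)
    (hg : Measurable (Function.uncurry g)) (hgb : ∀ t, wNormSq (maxwellian m θ) (g t) ≤ D)
    (hlim : ∀ φ : ℝ × Phase → ℝ, MemLp φ 2 (expMeasure m θ) →
        Tendsto (fun ε => ∫ z, F ε z.1 z.2 * φ z ∂expMeasure m θ) U
          (𝓝 (∫ z, g z.1 z.2 * φ z ∂expMeasure m θ)) ∧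
        Tendsto (fun ε => ∫ z, kerCol (maxwellian m θ) (relaxKernel σ) relaxPoint (F ε z.1) z.2
          * φ z ∂expMeasure m θ) U
          (𝓝 (∫ z, kerCol (maxwellian m θ) (relaxKernel σ) relaxPoint (g z.1) z.2
            * φ z ∂expMeasure m θ))) :
    IsWeakSolution (limitField m q B E) (avgQB m θ τ (omegaC m q B) σ)
      (gyroAvg (omegaC m q B) f₀) g := by
  have hω : omegaC m q B ≠ 0 := by unfold omegaC; positivity
  have hFl := fun ε => locallyIntegrable_timePhase hm hθ (hFm ε) hD (hFb ε)
  have hgl := locallyIntegrable_timePhase hm hθ hg hD hgb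
  -- Compactly supported tests for `dt dx dv` become square integrable tests for `expMeasure` after
  -- multiplication by `exp t` and `M`.
  have l1 : ∀ Θ : ℝ × Phase → ℝ, Continuous Θ → HasCompactSupport Θ →
      Tendsto (fun ε => ∫ z, F ε z.1 z.2 * Θ z ∂timePhase) U
        (𝓝 (∫ z, g z.1 z.2 * Θ z ∂timePhase)) := fun Θ hΘ hΘc => by
    have := (hlim _ (memLp_dual hm hθ hΘ hΘc)).1
    rw [integral_mul_dual hm hθ (fun z => g z.1 z.2) Θ] at this
    refine this.congr fun ε => ?_
    rw [integral_mul_dual hm hθ (fun z => F ε z.1 z.2) Θ]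
  have l2 : ∀ Θ : ℝ × Phase → ℝ, Continuous Θ → HasCompactSupport Θ →
      Tendsto (fun ε => ∫ z, QB m θ τ (fun v v' => σ ‖v - v'‖) (F ε z.1) z.2 * Θ z ∂timePhase) U
        (𝓝 (∫ z, QB m θ τ (fun v v' => σ ‖v - v'‖) (g z.1) z.2 * Θ z ∂timePhase)) :=
      fun Θ hΘ hΘc => by
    have := ((hlim _ (memLp_dual hm hθ hΘ hΘc)).2).const_mul (1 / τ)
    have e : ∀ u : ℝ → Phase → ℝ,
        1 / τ * ∫ z, kerCol (maxwellian m θ) (relaxKernel σ) relaxPoint (u z.1) z.2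
            * (Θ z * (Real.exp z.1 * maxwellian m θ z.2.2)) ∂expMeasure m θ
        = ∫ z, QB m θ τ (fun v v' => σ ‖v - v'‖) (u z.1) z.2 * Θ z ∂timePhase := fun u => by
      rw [integral_mul_dual hm hθ
        (fun z => kerCol (maxwellian m θ) (relaxKernel σ) relaxPoint (u z.1) z.2) Θ,
        ← integral_const_mul]
      congr 1
      ext z
      rw [QB_eq_kerCol, Pi.smul_apply, smul_eq_mul, mul_assoc]
    rw [e] at this
    exact this.congr fun ε => e (F ε)
  have hinv := h.invariant_of_weak_limit hω hU hs hFl hgl l1 l2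
  intro ψ hψ hψc
  have := h.weak_limit_avgTest hω hs hFl l1 l2 hψ hψc
  rwa [h.integral_invariant_slowField hm.ne' hq hB.ne' hg hgl hinv hψ hψc,
    integral_mul_avgTest_zero hf₀ hψ.continuous hψc,
    integral_QB_mul_avgTest hm hθ hσ hs₀ hσ_bound hω τ hg hD hgb hinv hψ.continuous hψc] at this

end equation

/-! ### Weak-* convergence -/

section weakStar

variable {m θ C : ℝ}

lemma weighted_absolutelyContinuous (m θ : ℝ) : weighted m θ ≪ (volume : Measure Phase) :=
  withDensity_absolutelyContinuous _ _

lemma measurable_eLpNorm_weighted {w : ℝ → Phase → ℝ} (hw : Measurable (Function.uncurry w)) :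
    Measurable fun t => eLpNorm (w t) 2 (weighted m θ) := by
  have h1 := measurable_wNormSq (measurable_maxwellian m θ) hw
  have h2 : (fun t => eLpNorm (w t) 2 (weighted m θ))
      = fun t => (wNormSq (maxwellian m θ) (w t)) ^ (1 / 2 : ℝ) := by
    ext t
    rw [← eLpNorm_sq_weighted, ← ENNReal.rpow_two, ← ENNReal.rpow_mul]
    norm_num
  rw [h2]
  fun_prop

lemma eLpNorm_weighted_le_of_wNormSq_le {u : Phase → ℝ} {D : ℝ≥0∞}
    (h : wNormSq (maxwellian m θ) u ≤ D ^ 2) : eLpNorm u 2 (weighted m θ) ≤ D := by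
  rw [← eLpNorm_sq_weighted] at h
  exact (ENNReal.pow_le_pow_left_iff two_ne_zero).1 h

lemma linftyL2Bound_of_wNormSq_le {g : ℝ → Phase → ℝ} (hg : Measurable (Function.uncurry g))
    (hgb : ∀ t, wNormSq (maxwellian m θ) (g t) ≤ ENNReal.ofReal C ^ 2) :
    LinftyL2Bound m θ C g :=
  ⟨Measurable.aestronglyMeasurable hg,
    Eventually.of_forall fun t => eLpNorm_weighted_le_of_wNormSq_le (hgb t)⟩

/-- The duality between `L^∞(ℝ₊; L²)` and `L¹(ℝ₊; L²)`. -/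
lemma lintegral_pairing_le (hm : 0 < m) (hθ : 0 < θ) {F w : ℝ → Phase → ℝ}
    (hF : Measurable (Function.uncurry F))
    (hFb : ∀ t, wNormSq (maxwellian m θ) (F t) ≤ ENNReal.ofReal C ^ 2)
    (hw : Measurable (Function.uncurry w)) :
    ∫⁻ z, ‖F z.1 z.2 * w z.1 z.2 * (maxwellian m θ z.2.2)⁻¹‖ₑ ∂timePhase
      ≤ ENNReal.ofReal C * ∫⁻ t in Ici (0 : ℝ), eLpNorm (w t) 2 (weighted m θ) := by
  have hM := measurable_maxwellian m θ
  have hF' : Measurable fun z : ℝ × Phase => F z.1 z.2 := hF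
  have hw' : Measurable fun z : ℝ × Phase => w z.1 z.2 := hw
  rw [timePhase, lintegral_prod _ (by fun_prop),
    ← lintegral_const_mul _ (measurable_eLpNorm_weighted hw)]
  refine lintegral_mono fun t => ?_
  have hFt : Measurable (F t) := hF.comp measurable_prodMk_left
  have hwt : Measurable (w t) := hw.comp measurable_prodMk_left
  have hH := eLpNorm_smul_le_mul_eLpNorm (p := 2) (q := 2) (r := 1) (μ := weighted m θ)
    hwt.aestronglyMeasurable hFt.aestronglyMeasurable
  have e : eLpNorm (F t • w t) 1 (weighted m θ)
      = ∫⁻ p, ‖F t p * w t p * (maxwellian m θ p.2)⁻¹‖ₑ := by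
    rw [eLpNorm_one_eq_lintegral_enorm, weighted,
      lintegral_withDensity_eq_lintegral_mul _ (by fun_prop)
        (by simp only [Pi.smul_apply', smul_eq_mul]; fun_prop)]
    refine lintegral_congr fun p => ?_
    have := maxwellian_pos hm hθ p.2
    simp only [Pi.mul_apply, Pi.smul_apply', smul_eq_mul, enorm_mul]
    rw [Real.enorm_eq_ofReal (inv_nonneg.2 this.le)]
    ring
  rw [e] at hH
  exact hH.trans (mul_le_mul' (eLpNorm_weighted_le_of_wNormSq_le (hFb t)) le_rfl)

lemma integrable_pairing (hm : 0 < m) (hθ : 0 < θ) {F w : ℝ → Phase → ℝ}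
    (hF : Measurable (Function.uncurry F))
    (hFb : ∀ t, wNormSq (maxwellian m θ) (F t) ≤ ENNReal.ofReal C ^ 2)
    (hw : Measurable (Function.uncurry w))
    (hwi : ∫⁻ t in Ici (0 : ℝ), eLpNorm (w t) 2 (weighted m θ) < ∞) :
    Integrable (fun z : ℝ × Phase => F z.1 z.2 * w z.1 z.2 * (maxwellian m θ z.2.2)⁻¹)
      timePhase := by
  have hM := measurable_maxwellian m θ
  have hF' : Measurable fun z : ℝ × Phase => F z.1 z.2 := hF
  have hw' : Measurable fun z : ℝ × Phase => w z.1 z.2 := hw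
  exact ⟨Measurable.aestronglyMeasurable (by fun_prop),
    (lintegral_pairing_le hm hθ hF hFb hw).trans_lt (ENNReal.mul_lt_top (by finiteness) hwi)⟩

lemma abs_integral_pairing_le (hm : 0 < m) (hθ : 0 < θ) {F w : ℝ → Phase → ℝ}
    (hF : Measurable (Function.uncurry F))
    (hFb : ∀ t, wNormSq (maxwellian m θ) (F t) ≤ ENNReal.ofReal C ^ 2)
    (hw : Measurable (Function.uncurry w))
    (hwi : ∫⁻ t in Ici (0 : ℝ), eLpNorm (w t) 2 (weighted m θ) < ∞) :
    |∫ z, F z.1 z.2 * w z.1 z.2 * (maxwellian m θ z.2.2)⁻¹ ∂timePhase|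
      ≤ (ENNReal.ofReal C * ∫⁻ t in Ici (0 : ℝ), eLpNorm (w t) 2 (weighted m θ)).toReal := by
  have h1 := (enorm_integral_le_lintegral_enorm
    (fun z : ℝ × Phase => F z.1 z.2 * w z.1 z.2 * (maxwellian m θ z.2.2)⁻¹)
    (μ := timePhase)).trans (lintegral_pairing_le hm hθ hF hFb hw)
  have h2 := ENNReal.toReal_mono (ENNReal.mul_lt_top (by finiteness) hwi).ne h1
  simpa using h2

/-- The densities truncated in time and in norm are dense in `L¹(ℝ₊; L²)`. -/
lemma tendsto_lintegral_truncation {N : ℝ → ℝ≥0∞} (hN : Measurable N)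
    (hNi : ∫⁻ t in Ici (0 : ℝ), N t < ∞) :
    Tendsto (fun n : ℕ => ∫⁻ t in Ici (0 : ℝ), {t | t ≤ (n : ℝ) ∧ N t ≤ n}ᶜ.indicator N t) atTop
      (𝓝 0) := by
  have hs : ∀ n : ℕ, MeasurableSet {t | t ≤ (n : ℝ) ∧ N t ≤ n} := fun n =>
    (measurableSet_le measurable_id measurable_const).inter (measurableSet_le hN measurable_const)
  have := tendsto_lintegral_of_dominated_convergence
    (μ := (volume : Measure ℝ).restrict (Ici 0))
    (F := fun n : ℕ => {t | t ≤ (n : ℝ) ∧ N t ≤ n}ᶜ.indicator N) (f := fun _ => 0) N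
    (fun n => hN.indicator (hs n).compl)
    (fun n => Eventually.of_forall fun t => indicator_le_self _ _ t) hNi.ne ?_
  · simpa using this
  · filter_upwards [ae_lt_top hN hNi.ne] with t ht
    obtain ⟨n₁, hn₁⟩ := exists_nat_ge t
    obtain ⟨n₂, hn₂⟩ := ENNReal.exists_nat_gt ht.ne
    refine tendsto_const_nhds.congr' ?_
    filter_upwards [eventually_ge_atTop (max n₁ n₂)] with n hn
    rw [indicator_of_notMem]
    simp only [mem_compl_iff, mem_ofPred_eq, not_not]
    exact ⟨hn₁.trans (by exact_mod_cast (le_max_left _ _).trans hn),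
      hn₂.le.trans (by exact_mod_cast (le_max_right _ _).trans hn)⟩

/-- Weak convergence against `L²` tests and boundedness give weak-* convergence. -/
lemma tendsto_pairing_of_bounded (hm : 0 < m) (hθ : 0 < θ) {ι : Type*} {l : Filter ι}
    {F : ι → ℝ → Phase → ℝ} {g : ℝ → Phase → ℝ}
    (hF : ∀ i, Measurable (Function.uncurry (F i)))
    (hFb : ∀ i t, wNormSq (maxwellian m θ) (F i t) ≤ ENNReal.ofReal C ^ 2)
    (hg : Measurable (Function.uncurry g))
    (hgb : ∀ t, wNormSq (maxwellian m θ) (g t) ≤ ENNReal.ofReal C ^ 2)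
    (hlim : ∀ φ : ℝ × Phase → ℝ, MemLp φ 2 (expMeasure m θ) →
        Tendsto (fun i => ∫ z, F i z.1 z.2 * φ z ∂expMeasure m θ) l
          (𝓝 (∫ z, g z.1 z.2 * φ z ∂expMeasure m θ)))
    {w : ℝ → Phase → ℝ} (hw : Measurable (Function.uncurry w))
    (hwi : ∫⁻ t in Ici (0 : ℝ), eLpNorm (w t) 2 (weighted m θ) < ∞) :
    Tendsto (fun i => ∫ z, F i z.1 z.2 * w z.1 z.2 * (maxwellian m θ z.2.2)⁻¹ ∂timePhase) l
      (𝓝 (∫ z, g z.1 z.2 * w z.1 z.2 * (maxwellian m θ z.2.2)⁻¹ ∂timePhase)) := by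
  set N : ℝ → ℝ≥0∞ := fun t => eLpNorm (w t) 2 (weighted m θ) with hN
  have hNm : Measurable N := measurable_eLpNorm_weighted hw
  have hNc := tendsto_lintegral_truncation hNm hwi
  set A : ℕ → Set ℝ := fun n => {t | t ≤ (n : ℝ) ∧ N t ≤ n} with hA
  have hAm : ∀ n : ℕ, MeasurableSet (A n) := fun n =>
    (measurableSet_le measurable_id measurable_const).inter (measurableSet_le hNm measurable_const)
  have hw' : Measurable fun z : ℝ × Phase => w z.1 z.2 := hw
  -- the truncated tests
  have trunc : ∀ (S : Set ℝ), MeasurableSet S →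
      Measurable (Function.uncurry (S.indicator w)) ∧
      ∀ t, eLpNorm (S.indicator w t) 2 (weighted m θ) = S.indicator N t := by
    intro S hS
    refine ⟨?_, fun t => ?_⟩
    · have : Function.uncurry (S.indicator w)
          = (Prod.fst ⁻¹' S).indicator (Function.uncurry w) := by
        ext ⟨t, p⟩
        by_cases ht : t ∈ S <;> simp [Function.uncurry, ht]
      rw [this]
      exact hw.indicator (measurable_fst hS)
    · by_cases ht : t ∈ S <;> simp [ht, hN]
  -- Discarding the test function outside `A n` costs an error bounded by the duality estimate,
  -- uniformly over the family.
  have split : ∀ (n : ℕ) (G : ℝ → Phase → ℝ), Measurable (Function.uncurry G) →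
      (∀ t, wNormSq (maxwellian m θ) (G t) ≤ ENNReal.ofReal C ^ 2) →
      |(∫ z, G z.1 z.2 * w z.1 z.2 * (maxwellian m θ z.2.2)⁻¹ ∂timePhase)
        - ∫ z, G z.1 z.2 * (A n).indicator w z.1 z.2 * (maxwellian m θ z.2.2)⁻¹ ∂timePhase|
      ≤ (ENNReal.ofReal C * ∫⁻ t in Ici (0 : ℝ), (A n)ᶜ.indicator N t).toReal := by
    intro n G hG hGb
    obtain ⟨h1, h2⟩ := trunc (A n) (hAm n)
    obtain ⟨h3, h4⟩ := trunc (A n)ᶜ (hAm n).compl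
    have hi1 : ∫⁻ t in Ici (0 : ℝ), eLpNorm ((A n).indicator w t) 2 (weighted m θ) < ∞ := by
      simp only [h2]
      exact (lintegral_mono fun t => indicator_le_self _ _ t).trans_lt hwi
    have hi2 : ∫⁻ t in Ici (0 : ℝ), eLpNorm ((A n)ᶜ.indicator w t) 2 (weighted m θ) < ∞ := by
      simp only [h4]
      exact (lintegral_mono fun t => indicator_le_self _ _ t).trans_lt hwi
    have h5 := abs_integral_pairing_le hm hθ hG hGb h3 hi2
    simp only [h4] at h5
    rw [← integral_sub (integrable_pairing hm hθ hG hGb hw hwi)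
      (integrable_pairing hm hθ hG hGb h1 hi1)]
    refine le_of_eq_of_le ?_ h5
    congr 2
    ext z
    by_cases hz : z.1 ∈ A n <;> simp [hz]
  have conv : ∀ n : ℕ, Tendsto (fun i => ∫ z, F i z.1 z.2 * (A n).indicator w z.1 z.2 *
      (maxwellian m θ z.2.2)⁻¹ ∂timePhase) l
      (𝓝 (∫ z, g z.1 z.2 * (A n).indicator w z.1 z.2 * (maxwellian m θ z.2.2)⁻¹ ∂timePhase)) := by
    intro n
    obtain ⟨h1, h2⟩ := trunc (A n) (hAm n)
    -- On `A n` time and norm are both at most `n`, so `exp t` times the truncated test has norm at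
    -- most `exp n * n` at every time, hence is an admissible `L²` test.
    have hL2 := (memLp_expMeasure (m := m) (θ := θ)
      (F := fun t => Real.exp t • (A n).indicator w t) (C := Real.exp n * n) (by
        have h1' : Measurable fun z : ℝ × Phase => (A n).indicator w z.1 z.2 := h1
        simp only [Function.uncurry_def, Pi.smul_apply, smul_eq_mul]
        fun_prop) (fun t => by
        rw [wNormSq_smul, ← eLpNorm_sq_weighted, h2, ← mul_pow]
        refine pow_le_pow_left' ?_ 2
        by_cases ht : t ∈ A n
        · rw [indicator_of_mem ht, ENNReal.ofReal_mul (Real.exp_pos _).le, ENNReal.ofReal_natCast,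
            Real.enorm_eq_ofReal (Real.exp_pos _).le]
          exact mul_le_mul' (ENNReal.ofReal_le_ofReal (Real.exp_le_exp.2 ht.1)) ht.2
        · rw [indicator_of_notMem ht, mul_zero]
          exact zero_le)).1
    have e : ∀ G : ℝ → Phase → ℝ,
        ∫ z, G z.1 z.2 * (Real.exp z.1 • (A n).indicator w z.1) z.2 ∂expMeasure m θ
        = ∫ z, G z.1 z.2 * (A n).indicator w z.1 z.2 * (maxwellian m θ z.2.2)⁻¹ ∂timePhase := by
      intro G
      rw [integral_expMeasure hm hθ]
      congr 1
      ext z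
      simp only [Pi.smul_apply, smul_eq_mul]
      rw [Real.exp_neg]
      field_simp
    have := hlim _ hL2
    rw [e] at this
    exact this.congr fun i => e (F i)
  rw [Metric.tendsto_nhds]
  intro η hη
  have hz : Tendsto (fun n : ℕ => (ENNReal.ofReal C *
      ∫⁻ t in Ici (0 : ℝ), (A n)ᶜ.indicator N t).toReal) atTop (𝓝 0) := by
    have h1 := ENNReal.Tendsto.const_mul (a := ENNReal.ofReal C) hNc
      (Or.inr ENNReal.ofReal_ne_top)
    rw [mul_zero] at h1
    exact (ENNReal.tendsto_toReal (ENNReal.zero_ne_top)).comp h1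
  obtain ⟨n, hn⟩ := (hz.eventually (gt_mem_nhds (show (0 : ℝ) < η / 3 by positivity))).exists
  filter_upwards [Metric.tendsto_nhds.1 (conv n) (η / 3) (by positivity)] with i hi
  have b1 := split n (F i) (hF i) (hFb i)
  have b2 := split n g hg hgb
  rw [Real.dist_eq] at hi ⊢
  rw [abs_le] at b1 b2
  rw [abs_lt] at hi ⊢
  constructor <;> linarith [hi.1, hi.2, b1.1, b1.2, b2.1, b2.2]

end weakStar

/-! ### The average of the relaxation operator, and the convergence result -/

section main

variable {m q B θ τ : ℝ} {σ : ℝ → ℝ} {s₀ S₀ : ℝ}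

lemma exists_volume_le_smul_weighted (hm : 0 < m) (hθ : 0 < θ) :
    ∃ c : ℝ≥0∞, c ≠ ∞ ∧ (volume : Measure Phase) ≤ c • weighted m θ := by
  obtain ⟨c, hc, hcb⟩ := exists_maxwellian_le hm hθ
  have hM := measurable_maxwellian m θ
  refine ⟨ENNReal.ofReal c, ENNReal.ofReal_ne_top, ?_⟩
  rw [weighted, ← withDensity_smul _ (by fun_prop)]
  conv_lhs => rw [← withDensity_one (μ := (volume : Measure Phase))]
  refine withDensity_mono (Eventually.of_forall fun p => ?_)
  have hp := maxwellian_pos hm hθ p.2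
  simp only [Pi.one_apply, Pi.smul_apply, smul_eq_mul]
  rw [← ENNReal.ofReal_mul hc.le, ENNReal.one_le_ofReal, ← div_eq_mul_inv, one_le_div hp]
  exact hcb _

/-- A measurable representative is locally integrable because `M` is bounded above, so the weak
kernel condition gives invariance under the flow. Both collision operators ignore the change of
representative. -/
lemma MemKerT.gyroAvg_QB (hm : 0 < m) (hθ : 0 < θ) (hσ : Measurable σ) (hs₀ : 0 < s₀)
    (hσ_bound : ∀ r : ℝ, 0 ≤ r → s₀ ≤ σ r ∧ σ r ≤ S₀) {ω : ℝ} (hω : ω ≠ 0) (τ : ℝ)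
    {u : Phase → ℝ} (hu : MemKerT m θ ω u) :
    gyroAvg ω (QB m θ τ (fun v v' => σ ‖v - v'‖) u) =ᵐ[volume] avgQB m θ τ ω σ u := by
  have hK := isColKernel_relax hm hθ hσ hs₀ hσ_bound
  have hA := isColKernel_avg hm hθ hσ hs₀ hσ_bound hω
  have hac : (volume : Measure Phase) ≪ weighted m θ := by
    refine withDensity_absolutelyContinuous' ?_ (Eventually.of_forall fun p => ?_)
    · have hM := measurable_maxwellian m θ
      exact Measurable.aemeasurable (by fun_prop)
    · have := maxwellian_pos hm hθ p.2
      simpa using this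
  obtain ⟨w, hwm, hw⟩ := hu.1.aestronglyMeasurable
  have hw' : u =ᵐ[volume] w := hac.ae_le hw
  have hw2 : wNormSq (maxwellian m θ) w < ∞ := by
    rw [← eLpNorm_sq_weighted, ← eLpNorm_congr_ae hw]
    exact ENNReal.pow_lt_top hu.1.2
  have hwl : LocallyIntegrable w := by
    have hw2' : MemLp w 2 (volume : Measure Phase) := by
      obtain ⟨c, hc, hle⟩ := exists_volume_le_smul_weighted hm hθ
      exact MemLp.of_measure_le_smul hc hle ((memLp_congr_ae hw).1 hu.1)
    exact locallyIntegrable_of_memLp_two_closedBall fun R => hw2'.restrict _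
  have hinv := larmor_ae_eq_of_weak hω hwl fun ψ hψ hψc => by
    rw [← hu.2 ψ hψ hψc]
    refine integral_congr_ae ?_
    filter_upwards [hw'] with p hp
    rw [hp]
  have h1 := gyroAvg_QB_of_invariant hm hθ hσ hs₀ hσ_bound hω τ hwm.measurable hw2 hinv
  have h2 : QB m θ τ (fun v v' => σ ‖v - v'‖) u =ᵐ[volume]
      QB m θ τ (fun v v' => σ ‖v - v'‖) w := by
    rw [QB_eq_kerCol, QB_eq_kerCol]
    exact (hK.kerCol_congr hw').const_smul _
  have h3 : avgQB m θ τ ω σ u =ᵐ[volume] avgQB m θ τ ω σ w := by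
    rw [avgQB_eq_kerCol, avgQB_eq_kerCol]
    exact (hA.kerCol_congr hw').const_smul _
  exact (gyroAvg_congr h2).trans (h1.trans h3.symm)

lemma epsField_congr (m q B : ℝ) {E E' : R3 → R3} (h : E =ᵐ[volume] E') (ε : ℝ) :
    epsField m q B E ε =ᵐ[volume] epsField m q B E' ε := by
  have : ∀ᵐ p : Phase, E p.1 = E' p.1 := Measure.quasiMeasurePreserving_fst.ae h
  filter_upwards [this] with p hp
  simp only [epsField, hp]

/-- Convergence of bounded families of weak solutions, for a regular potential. -/
lemma IsRegularPotential.exists_limit {Ψ : R3 → ℝ} {E : R3 → R3} {K : ℝ≥0} {A C : ℝ}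
    (h : IsRegularPotential Ψ E K A) (hm : 0 < m) (hq : q ≠ 0) (hB : 0 < B) (hθ : 0 < θ)
    (hσ : Measurable σ) (hs₀ : 0 < s₀) (hσ_bound : ∀ r : ℝ, 0 ≤ r → s₀ ≤ σ r ∧ σ r ≤ S₀)
    {f₀ : Phase → ℝ} (hf₀ : Integrable f₀) {F : ℝ → ℝ → Phase → ℝ}
    (hs : ∀ᶠ ε in 𝓝[>] 0, IsWeakSolution (epsField m q B E ε)
      (QB m θ τ (fun v v' => σ ‖v - v'‖)) f₀ (F ε))
    (hFm : ∀ ε, Measurable (Function.uncurry (F ε)))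
    (hFb : ∀ ε t, wNormSq (maxwellian m θ) (F ε t) ≤ ENNReal.ofReal C ^ 2) :
    ∃ g : ℝ → Phase → ℝ, MemLinftyL2 m θ g ∧
      IsWeakSolution (limitField m q B E) (avgQB m θ τ (omegaC m q B) σ)
        (gyroAvg (omegaC m q B) f₀) g ∧ WeakStarTendsto m θ F g := by
  have hω : omegaC m q B ≠ 0 := by unfold omegaC; positivity
  have hK := isColKernel_relax hm hθ hσ hs₀ hσ_bound
  have hA := isColKernel_avg hm hθ hσ hs₀ hσ_bound hω
  have hD : ENNReal.ofReal C ^ 2 ≠ ∞ := by finiteness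
  have key : ∀ U : Ultrafilter ℝ, (U : Filter ℝ) ≤ 𝓝[>] 0 → ∃ g : ℝ → Phase → ℝ,
      Measurable (Function.uncurry g) ∧
      (∀ t, wNormSq (maxwellian m θ) (g t) ≤ ENNReal.ofReal C ^ 2) ∧
      IsWeakSolution (limitField m q B E) (avgQB m θ τ (omegaC m q B) σ)
        (gyroAvg (omegaC m q B) f₀) g ∧
      ∀ φ : ℝ × Phase → ℝ, MemLp φ 2 (expMeasure m θ) →
        Tendsto (fun ε => ∫ z, F ε z.1 z.2 * φ z ∂expMeasure m θ) U
          (𝓝 (∫ z, g z.1 z.2 * φ z ∂expMeasure m θ)) := by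
    intro U hU
    obtain ⟨g, hg, hgb, -, hlim⟩ := exists_weak_limit_densities hm hθ U hFm hFb hK
    exact ⟨g, hg, hgb, h.isWeakSolution_of_weak_limit hm hq hB hθ hσ hs₀ hσ_bound hU hf₀
      (hU hs) hFm hD hFb hg hgb hlim, fun φ hφ => (hlim φ hφ).1⟩
  obtain ⟨g, hg, hgb, hgs, -⟩ := key (Ultrafilter.of (𝓝[>] 0)) (Ultrafilter.of_le _)
  have hgL := linftyL2Bound_of_wNormSq_le hg hgb
  refine ⟨g, ⟨C, hgL⟩, hgs, fun ψ hψ => ?_⟩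
  set w : ℝ → Phase → ℝ := fun t p => hψ.1.mk _ (t, p) with hw
  have hwm : Measurable (Function.uncurry w) := hψ.1.stronglyMeasurable_mk.measurable
  have hwe : ∀ᵐ z ∂timePhase, ψ z.1 z.2 = w z.1 z.2 := hψ.1.ae_eq_mk
  have hwi : ∫⁻ t in Ici (0 : ℝ), eLpNorm (w t) 2 (weighted m θ) < ∞ := by
    refine lt_of_eq_of_lt (lintegral_congr_ae ?_) hψ.2
    filter_upwards [Measure.ae_ae_of_ae_prod hwe] with t ht
    exact (eLpNorm_congr_ae ((weighted_absolutelyContinuous m θ).ae_le ht)).symm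
  have e : ∀ G : ℝ → Phase → ℝ,
      ∫ z, G z.1 z.2 * ψ z.1 z.2 * (maxwellian m θ z.2.2)⁻¹ ∂timePhase
      = ∫ z, G z.1 z.2 * w z.1 z.2 * (maxwellian m θ z.2.2)⁻¹ ∂timePhase := fun G => by
    refine integral_congr_ae ?_
    filter_upwards [hwe] with z hz
    rw [hz]
  simp only [e]
  -- Convergence is checked on each ultrafilter. Each has its own weak limit, which solves the limit
  -- problem and therefore equals the limit `g` obtained from one arbitrary ultrafilter.
  refine (tendsto_iff_ultrafilter _ _ _).2 fun U hU => ?_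
  obtain ⟨g', hg', hgb', hgs', hlim⟩ := key U hU
  have heq := h.weakSolution_unique hm hθ q B hA (avgQB_eq_kerCol m θ τ _ σ)
    ⟨C, linftyL2Bound_of_wNormSq_le hg' hgb'⟩ ⟨C, hgL⟩ hgs' hgs
  have e' : ∫ z, g z.1 z.2 * w z.1 z.2 * (maxwellian m θ z.2.2)⁻¹ ∂timePhase
      = ∫ z, g' z.1 z.2 * w z.1 z.2 * (maxwellian m θ z.2.2)⁻¹ ∂timePhase := by
    refine integral_congr_ae ?_
    filter_upwards [heq] with z hz
    rw [hz]
  rw [e']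
  exact tendsto_pairing_of_bounded hm hθ hFm hFb hg' hgb' hlim hwm hwi

end main

end FiniteLarmor

end

theorem theorem1
    (m q B θ τ : ℝ) (hm : 0 < m) (hq : q ≠ 0) (hB : 0 < B) (hθ : 0 < θ) (hτ : 0 < τ)
    -- the scattering cross section `s(v, v') = σ(|v - v'|)`
    (σ : ℝ → ℝ) (hσ : Measurable σ) (s₀ S₀ : ℝ) (hs₀ : 0 < s₀)
    (hσ_bound : ∀ r : ℝ, 0 ≤ r → s₀ ≤ σ r ∧ σ r ≤ S₀)
    -- the electric field `E = -∇φ`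
    (φ : R3 → ℝ) (hφ : MemW2Infty φ)
    (E : R3 → R3) (hE : ∀ i, HasWeakPartial i φ (fun x => -(E x i)))
    -- the initial datum
    (f_in : Phase → ℝ) (hf_nonneg : ∀ᵐ p, 0 ≤ f_in p) (hf_L1 : Integrable f_in)
    (hf_L2 : MemLp f_in 2 (weighted m θ))
    -- the weak solutions `f ε`, bounded in `L^∞(ℝ₊; L²(M⁻¹ dx dv))`
    (f : ℝ → ℝ → Phase → ℝ) (ε₀ : ℝ) (hε₀ : 0 < ε₀)
    (hf_sol : ∀ ε : ℝ, 0 < ε → ε ≤ ε₀ →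
      IsWeakSolution (epsField m q B E ε) (QB m θ τ (fun v v' => σ ‖v - v'‖)) f_in (f ε))
    (hf_bdd : ∃ C : ℝ, ∀ ε : ℝ, 0 < ε → ε ≤ ε₀ → LinftyL2Bound m θ C (f ε)) :
    -- the integral operator `avgQB` is the average of `QB` on the kernel of `𝒯`
    (∀ u : Phase → ℝ, MemKerT m θ (omegaC m q B) u →
      gyroAvg (omegaC m q B) (QB m θ τ (fun v v' => σ ‖v - v'‖) u)
        =ᵐ[volume] avgQB m θ τ (omegaC m q B) σ u) ∧
    -- the limit problem has exactly one weak solution, and `f ε` converges to it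
    ∃ g : ℝ → Phase → ℝ,
      MemLinftyL2 m θ g ∧
      IsWeakSolution (limitField m q B E) (avgQB m θ τ (omegaC m q B) σ)
        (gyroAvg (omegaC m q B) f_in) g ∧
      (∀ h : ℝ → Phase → ℝ, MemLinftyL2 m θ h →
        IsWeakSolution (limitField m q B E) (avgQB m θ τ (omegaC m q B) σ)
          (gyroAvg (omegaC m q B) f_in) h →
        ∀ᵐ z ∂timePhase, h z.1 z.2 = g z.1 z.2) ∧
      WeakStarTendsto m θ f g := by
  have hω : omegaC m q B ≠ 0 := by unfold omegaC; positivity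
  have hK := isColKernel_relax hm hθ hσ hs₀ hσ_bound
  have hA := isColKernel_avg hm hθ hσ hs₀ hσ_bound hω
  refine ⟨fun u hu => hu.gyroAvg_QB hm hθ hσ hs₀ hσ_bound hω τ, ?_⟩
  -- The field is replaced by its Lipschitz representative; both the penalized and the averaged
  -- equations see it only up to null sets.
  obtain ⟨Ψ, G, K, A, hΨ, hG, hd, hEG⟩ := exists_regular_potential hφ hE
  let E' : R3 → R3 := fun x => WithLp.toLp 2 fun i => G i x
  have hE' : E =ᵐ[volume] E' := by
    filter_upwards [hEG] with x hx
    ext i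
    exact hx i
  have hreg : IsRegularPotential Ψ E' K A := ⟨hΨ, hG, hd⟩
  obtain ⟨C, hC⟩ := hf_bdd
  have hrep : ∀ ε : ℝ, ∃ F : ℝ → Phase → ℝ, Measurable (Function.uncurry F) ∧
      (∀ t, wNormSq (maxwellian m θ) (F t) ≤ ENNReal.ofReal C ^ 2) ∧
      (0 < ε ∧ ε ≤ ε₀ → ∀ᵐ z ∂timePhase, f ε z.1 z.2 = F z.1 z.2) := by
    intro ε
    by_cases hε : 0 < ε ∧ ε ≤ ε₀
    · obtain ⟨F, h1, h2, -, h3⟩ := (hC ε hε.1 hε.2).exists_rep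
      exact ⟨F, h1, h2, fun _ => h3⟩
    -- Parameters outside `(0, ε₀]` receive the zero density: they do not affect the limit, but the
    -- bounds can then be stated for every `ε`.
    · exact ⟨fun _ _ => 0, measurable_const, fun t => by simp [wNormSq], fun h => absurd h hε⟩
  choose F hFm hFb hFe using hrep
  have hev : ∀ᶠ ε : ℝ in 𝓝[>] 0, 0 < ε ∧ ε ≤ ε₀ := Ioc_mem_nhdsGT hε₀
  obtain ⟨g, hgL, hgs, hgw⟩ := hreg.exists_limit (q := q) (B := B) (τ := τ) hm hq hB hθ hσ hs₀
    hσ_bound hf_L1 (F := F) (by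
      filter_upwards [hev] with ε hε
      exact (hf_sol ε hε.1 hε.2).congr hK (QB_eq_kerCol m θ τ σ)
        (epsField_congr m q B hE' ε) (hFe ε hε)) hFm hFb
  have hQ := avgQB_eq_kerCol m θ τ (omegaC m q B) σ
  have hfld := limitField_congr m q B hE'
  refine ⟨g, hgL, hgs.congr hA hQ hfld.symm (Eventually.of_forall fun _ => rfl),
    fun h hhL hhs => hreg.weakSolution_unique hm hθ q B hA hQ hhL hgL
      (hhs.congr hA hQ hfld (Eventually.of_forall fun _ => rfl)) hgs, fun ψ hψ => ?_⟩
  refine (hgw ψ hψ).congr' ?_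
  filter_upwards [hev] with ε hε
  refine integral_congr_ae ?_
  filter_upwards [hFe ε hε] with z hz
  rw [hz]
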